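/- **Corollary (generalized Calabi–Gray manifolds admit no pluriclosed metrics).** Let $\Sigma$ be a compact connected Riemann surface and let $\varphi:\Sigma\to\mathbb{CP}^1$ be a nonconstant holomorphic map such that $\varphi^*\mathcal O(2)\cong K_\Sigma$ as holomorphic line bundles, where $K_\Sigma$ is the canonical bundle of $\Sigma$. Let $(M,g)$ be a compact connected hyperkähler $4$-manifold, with complex structures $I,J,K$ that are Kähler with respect to $g$ and satisfy $IJK=-\mathrm{id}$. Identify $\mathbb{CP}^1$ (with affine coordinate $\zeta$) with the unit sphere in $\mathbb R^3$ by the stereographic projection $$(\alpha,\beta,\gamma)=\left(\frac{1-|\zeta|^2}{1+|\zeta|^2},\ \frac{\zeta+\bar\zeta}{1+|\zeta|^2},\ \frac{i(\bar\zeta-\zeta)}{1+|\zeta|^2}\right),$$ and write $\varphi=(\alpha,\beta,\gamma)$ accordingly. Let $X$ be the generalized Calabi–Gray manifold associated with these data, that is, the smooth manifold $\Sigma\times M$ with the complex structure which at $(s,x)$ is $$J_0=j_\Sigma\oplus\bigl(\alpha(s)I_x+\beta(s)J_x+\gamma(s)K_x\bigr),$$ where $j_\Sigma$ is the complex structure of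 $\Sigma$. Then $X$ admits no pluriclosed metric: there is no smooth positive real $(1,1)$-form $\omega_1$ on $X$ (the fundamental form of a Hermitian metric) with $i\partial\bar\partial\omega_1=0$. -/

import Mathlib

open scoped Manifold ContDiff Bundle LinearAlgebra.Projectivization

noncomputable section

namespace CalabiGray

/-! ### Differential forms on a manifold without boundary -/

section Forms

variable {E : Type*} [NormedAddCommGroup E] [NormedSpace ℝ E]
  {H : Type*} [TopologicalSpace H] (I : ModelWithCorners ℝ E H)
  (X : Type*) [TopologicalSpace X] [ChartedSpace H X]

/-- `F`-valued differential `k`-forms on `X` (no regularity required):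
a real alternating `k`-linear form on every tangent space. -/
abbrev DiffForm (F : Type*) [NormedAddCommGroup F] [NormedSpace ℝ F] (k : ℕ) : Type _ :=
  ∀ x : X, (TangentSpace I x) [⋀^Fin k]→L[ℝ] F

/-- Fields of endomorphisms of the tangent spaces. -/
abbrev EndField : Type _ := ∀ x : X, TangentSpace I x →L[ℝ] TangentSpace I x

variable {I X} {F : Type*} [NormedAddCommGroup F] [NormedSpace ℝ F] {k : ℕ}

/-- The coordinate expression of a form in the preferred chart around `x₀`, that is,
its pull-back under the inverse of this chart. It is meaningful on the target of the chart. -/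
def DiffForm.inChart (η : DiffForm I X F k) (x₀ : X) : E → E [⋀^Fin k]→L[ℝ] F := fun y =>
  (η ((extChartAt I x₀).symm y)).compContinuousLinearMap
    (mfderiv 𝓘(ℝ, E) I (extChartAt I x₀).symm y)

/-- Smooth forms: all coordinate expressions are `C^∞`. -/
def DiffForm.IsSmooth (η : DiffForm I X F k) : Prop :=
  ∀ x₀ : X, ContDiffOn ℝ ∞ (DiffForm.inChart η x₀) (extChartAt I x₀).target

/-- The exterior derivative, computed at `x` in the preferred chart around `x`. -/
def DiffForm.d (η : DiffForm I X F k) : DiffForm I X F (k + 1) := fun x =>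
  (extDeriv (DiffForm.inChart η x) (extChartAt I x x)).compContinuousLinearMap
    (mfderiv I 𝓘(ℝ, E) (extChartAt I x) x)

/-- A real form, regarded as a complex-valued form. -/
def DiffForm.complexify (η : DiffForm I X ℝ k) : DiffForm I X ℂ k := fun x =>
  Complex.ofRealCLM.compContinuousAlternatingMap (η x)

end Forms

/-! ### Types of complex-valued forms -/

section Types

variable {V : Type*} [AddCommGroup V] [Module ℝ V] [TopologicalSpace V] {k : ℕ}

/-- One term of the expansion of `η (w₁, …, wₖ)`, where `η` is extended complex multilinearly and
`w_l` is the `(1,0)`-part `(v_l - i J v_l) / 2` of `v_l` for `l ∈ P` and its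
`(0,1)`-part `(v_l + i J v_l) / 2` for `l ∉ P`: the term in which `J v_l` is chosen
for `l ∈ T` and `v_l` for `l ∉ T`. -/
def typeTerm (J : V →L[ℝ] V) (η : V [⋀^Fin k]→L[ℝ] ℂ) (P T : Finset (Fin k)) :
    ContinuousMultilinearMap ℝ (fun _ : Fin k => V) ℂ :=
  ((1 / 2 : ℂ) ^ k * ∏ l ∈ T, (if l ∈ P then -Complex.I else Complex.I)) •
    η.toContinuousMultilinearMap.compContinuousLinearMap
      (fun l => if l ∈ T then J else ContinuousLinearMap.id ℝ V)

theorem typeTerm_apply (J : V →L[ℝ] V) (η : V [⋀^Fin k]→L[ℝ] ℂ) (P T : Finset (Fin k))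
    (v : Fin k → V) :
    typeTerm J η P T v =
      ((1 / 2 : ℂ) ^ k * ∏ l ∈ T, (if l ∈ P then -Complex.I else Complex.I)) *
        η (fun l => if l ∈ T then J (v l) else v l) := by
  have h : (fun l => if l ∈ T then J (v l) else v l) =
      fun l => (if l ∈ T then J else ContinuousLinearMap.id ℝ V) (v l) := by
    funext l
    split_ifs <;> rfl
  rw [h]
  rfl

theorem typeTerm_map (J : V →L[ℝ] V) (η : V [⋀^Fin k]→L[ℝ] ℂ) (P T : Finset (Fin k))
    (v : Fin k → V) (σ : Equiv.Perm (Fin k)) (hσ : ∀ l, v (σ l) = v l) :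
    typeTerm J η (P.map σ.toEmbedding) (T.map σ.toEmbedding) v =
      Equiv.Perm.sign σ • typeTerm J η P T v := by
  rw [typeTerm_apply, typeTerm_apply]
  have h1 : (fun l => if l ∈ T then J (v l) else v l) =
      (fun l => if l ∈ T.map σ.toEmbedding then J (v l) else v l) ∘ σ := by
    funext l
    simp [hσ]
  have h2 := η.toAlternatingMap.map_perm
    (fun l => if l ∈ T.map σ.toEmbedding then J (v l) else v l) σ
  rw [← h1] at h2
  simp only [ContinuousAlternatingMap.coe_toAlternatingMap] at h2
  rw [h2]
  simp only [Finset.prod_map, Equiv.coe_toEmbedding, Finset.mem_map_equiv,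
    Equiv.symm_apply_apply]
  rcases Int.units_eq_one_or (Equiv.Perm.sign σ) with h | h <;> simp [h]

/-- The component of type `(p, k - p)` of a complex-valued `k`-form `η` on a real vector space with
complex structure `J`. Its value at `(v₁, …, vₖ)` is the sum, over the sets `P` of `p` indices, of
`η_ℂ (w₁, …, wₖ)` with `w_l = v_l^{1,0}` for `l ∈ P` and `w_l = v_l^{0,1}` for `l ∉ P`. -/
def typePart (J : V →L[ℝ] V) (p : ℕ) (η : V [⋀^Fin k]→L[ℝ] ℂ) : V [⋀^Fin k]→L[ℝ] ℂ where
  toContinuousMultilinearMap :=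
    ∑ P ∈ (Finset.univ : Finset (Fin k)).powersetCard p, ∑ T : Finset (Fin k), typeTerm J η P T
  map_eq_zero_of_eq' := by
    intro v i j hv hij
    set σ := Equiv.swap i j with hσdef
    have hσ : ∀ l, v (σ l) = v l := by
      intro l
      rcases eq_or_ne l i with rfl | hi
      · simp [hσdef, hv]
      rcases eq_or_ne l j with rfl | hj
      · simp [hσdef, hv]
      · rw [hσdef, Equiv.swap_apply_of_ne_of_ne hi hj]
    have hsgn : Equiv.Perm.sign σ = -1 := Equiv.Perm.sign_swap hij
    change (∑ P ∈ (Finset.univ : Finset (Fin k)).powersetCard p,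
      ∑ T : Finset (Fin k), typeTerm J η P T) v = 0
    simp only [_root_.sum_apply]
    have key : (∑ P ∈ (Finset.univ : Finset (Fin k)).powersetCard p,
        ∑ T : Finset (Fin k), typeTerm J η P T v) =
        ∑ P ∈ (Finset.univ : Finset (Fin k)).powersetCard p,
        ∑ T : Finset (Fin k), -typeTerm J η P T v := by
      refine Finset.sum_bij (fun P _ => P.map σ.toEmbedding) ?_ ?_ ?_ ?_
      · intro P hP
        simpa [Finset.mem_powersetCard] using hP
      · intro P _ Q _ h
        exact Finset.map_injective _ h
      · intro Q hQ
        refine ⟨Q.map σ.symm.toEmbedding, ?_, ?_⟩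
        · simpa [Finset.mem_powersetCard] using hQ
        · ext l
          simp [Finset.mem_map_equiv]
      · intro P _
        refine Fintype.sum_equiv (Equiv.finsetCongr σ) _ _ ?_
        intro T
        have := typeTerm_map J η P T v σ hσ
        rw [hsgn] at this
        rw [Equiv.finsetCongr_apply, this]
        simp
    have h0 := key
    simp only [Finset.sum_neg_distrib] at h0
    exact self_eq_neg.mp h0

end Types

/-! ### The operators `∂` and `∂̄`, and pluriclosed metrics -/

section Pluriclosed

variable {E : Type*} [NormedAddCommGroup E] [NormedSpace ℝ E]
  {H : Type*} [TopologicalSpace H] {I : ModelWithCorners ℝ E H}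
  {X : Type*} [TopologicalSpace X] [ChartedSpace H X] {k : ℕ}

/-- `∂` with respect to the complex structure `J`: on forms of type `(p,q)` it is the component of
type `(p+1,q)` of the exterior derivative. -/
def del (J : EndField I X) (η : DiffForm I X ℂ k) : DiffForm I X ℂ (k + 1) := fun x =>
  ∑ p ∈ Finset.range (k + 1),
    typePart (J x) (p + 1) (DiffForm.d (fun y => typePart (J y) p (η y)) x)

/-- `∂̄` with respect to the complex structure `J`: on forms of type `(p,q)` it is the component of
type `(p,q+1)` of the exterior derivative. -/
def delbar (J : EndField I X) (η : DiffForm I X ℂ k) : DiffForm I X ℂ (k + 1) := fun x =>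
  ∑ p ∈ Finset.range (k + 1),
    typePart (J x) p (DiffForm.d (fun y => typePart (J y) p (η y)) x)

/-- Hermitian metrics on `(X, J)`, identified with their fundamental forms: the smooth
positive real forms of type `(1,1)`. -/
structure IsHermitianMetric (J : EndField I X) (η : DiffForm I X ℝ 2) : Prop where
  smooth : DiffForm.IsSmooth η
  type_one_one : ∀ (x : X) (u v : TangentSpace I x), η x ![J x u, J x v] = η x ![u, v]
  pos : ∀ (x : X) (v : TangentSpace I x), v ≠ 0 → 0 < η x ![v, J x v]

/-- The pluriclosed condition `i ∂∂̄ η = 0`. -/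
def IsPluriclosed (J : EndField I X) (η : DiffForm I X ℝ 2) : Prop :=
  ∀ x : X, Complex.I • del J (delbar J (DiffForm.complexify η)) x = 0

end Pluriclosed

/-! ### Hyperkähler 4-manifolds -/

section Hyperkahler

/-- The model space of real 4-manifolds. -/
abbrev R4 : Type := EuclideanSpace ℝ (Fin 4)

variable (M : Type*) [TopologicalSpace M] [ChartedSpace R4 M] [IsManifold (𝓡 4) ∞ M]

/-- Smooth Riemannian metrics on `M`. -/
abbrev Metric : Type _ :=
  Bundle.ContMDiffRiemannianMetric (𝓡 4) ∞ R4 (fun x : M => TangentSpace (𝓡 4) x)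

variable {M}

/-- `A` is a smooth almost complex structure which is orthogonal for the metric `g`. -/
structure IsCompatible (g : Metric M) (A : EndField (𝓡 4) M) : Prop where
  smooth : ContMDiff (𝓡 4) ((𝓡 4).prod 𝓘(ℝ, R4 →L[ℝ] R4)) ∞
    (fun x : M => Bundle.TotalSpace.mk' (R4 →L[ℝ] R4)
      (E := fun x : M => TangentSpace (𝓡 4) x →L[ℝ] TangentSpace (𝓡 4) x) x (A x))
  sq : ∀ (x : M) (v : TangentSpace (𝓡 4) x), A x (A x v) = -v
  orthogonal : ∀ (x : M) (v w : TangentSpace (𝓡 4) x),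
    g.inner x (A x v) (A x w) = g.inner x v w

/-- Integrability of an almost complex structure: its Nijenhuis tensor vanishes. -/
def IsIntegrable (A : EndField (𝓡 4) M) : Prop :=
  ∀ Y Z : ∀ x : M, TangentSpace (𝓡 4) x,
    ContMDiff (𝓡 4) (𝓡 4).tangent ∞ (fun x => (⟨x, Y x⟩ : TangentBundle (𝓡 4) M)) →
    ContMDiff (𝓡 4) (𝓡 4).tangent ∞ (fun x => (⟨x, Z x⟩ : TangentBundle (𝓡 4) M)) →
    ∀ x : M,
      VectorField.mlieBracket (𝓡 4) (fun y => A y (Y y)) (fun y => A y (Z y)) x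
        - A x (VectorField.mlieBracket (𝓡 4) (fun y => A y (Y y)) Z x)
        - A x (VectorField.mlieBracket (𝓡 4) Y (fun y => A y (Z y)) x)
        - VectorField.mlieBracket (𝓡 4) Y Z x = 0

/-- The fundamental form `(v₁, v₂) ↦ g (A v₁, v₂)`. -/
def fundamentalForm (g : Metric M) (A : EndField (𝓡 4) M) (h : IsCompatible g A) :
    DiffForm (𝓡 4) M ℝ 2 := fun x =>
  { toFun := fun v => g.inner x (A x (v 0)) (v 1)
    map_update_add' := by
      intro _ v i a b
      fin_cases i <;> simp [Function.update]
    map_update_smul' := by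
      intro _ v i c a
      fin_cases i <;> simp [Function.update]
    cont := by
      have h1 : Continuous fun v : Fin 2 → TangentSpace (𝓡 4) x => A x (v 0) :=
        (A x).continuous.comp (continuous_apply 0)
      have h2 : Continuous fun v : Fin 2 → TangentSpace (𝓡 4) x => v 1 := continuous_apply 1
      exact ContinuousLinearMap.continuous₂ (E := R4) (F := R4) (G := ℝ) (g.inner x)
        |>.comp (h1.prodMk h2)
    map_eq_zero_of_eq' := by
      have key : ∀ w : TangentSpace (𝓡 4) x, g.inner x (A x w) w = 0 := by
        intro w
        have e := h.orthogonal x (A x w) w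
        have e2 := g.symm x (A x w) w
        rw [h.sq, map_neg, neg_apply] at e
        linarith
      intro v i j hv hij
      fin_cases i <;> fin_cases j <;> simp_all }

/-- `(M, g, A)` is a Kähler manifold. -/
structure IsKahler (g : Metric M) (A : EndField (𝓡 4) M) : Prop where
  compatible : IsCompatible g A
  integrable : IsIntegrable A
  closed : ∀ x : M, DiffForm.d (fundamentalForm g A compatible) x = 0

variable (M) in
/-- A hyperkähler structure on a 4-manifold: a Riemannian metric with three complex structures
`I`, `J`, `K` satisfying `IJK = -1`, each of which is Kähler for the metric. -/
structure Hyperkahler where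
  g : Metric M
  I : EndField (𝓡 4) M
  J : EndField (𝓡 4) M
  K : EndField (𝓡 4) M
  kahler_I : IsKahler g I
  kahler_J : IsKahler g J
  kahler_K : IsKahler g K
  mul_mul : ∀ (x : M) (v : TangentSpace (𝓡 4) x), I x (J x (K x v)) = -v

end Hyperkahler

/-! ### Stereographic projection -/

section Sphere

/-- The complex projective line, with homogeneous coordinates `[z₁ : z₂] = [v 0 : v 1]` and affine
coordinate `ζ = z₂ / z₁`. -/
abbrev CP1 : Type := ℙ ℂ (Fin 2 → ℂ)

/-- The point of the unit sphere in `ℝ³` belonging to homogeneous coordinates `(z₁, z₂)`: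
`(|z₁|² - |z₂|², 2 Re (z₂ z̄₁), 2 Im (z₂ z̄₁)) / (|z₁|² + |z₂|²)`. -/
def sphereVec (v : Fin 2 → ℂ) : Fin 3 → ℝ :=
  ![(Complex.normSq (v 0) - Complex.normSq (v 1)) / (Complex.normSq (v 0) + Complex.normSq (v 1)),
    2 * (v 1 * (starRingEnd ℂ) (v 0)).re / (Complex.normSq (v 0) + Complex.normSq (v 1)),
    2 * (v 1 * (starRingEnd ℂ) (v 0)).im / (Complex.normSq (v 0) + Complex.normSq (v 1))]

theorem sphereVec_smul (t : ℂ) (ht : t ≠ 0) (v : Fin 2 → ℂ) :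
    sphereVec (t • v) = sphereVec v := by
  have hn : Complex.normSq t ≠ 0 := by simpa using ht
  have h : (t * v 1) * (starRingEnd ℂ) (t * v 0) =
      (Complex.normSq t : ℂ) * (v 1 * (starRingEnd ℂ) (v 0)) := by
    rw [map_mul, Complex.normSq_eq_conj_mul_self]; ring
  unfold sphereVec
  simp only [Pi.smul_apply, smul_eq_mul, h, Complex.re_ofReal_mul, Complex.im_ofReal_mul,
    Complex.normSq_mul, ← mul_add, ← mul_sub, mul_left_comm (2 : ℝ)]
  simp only [mul_div_mul_left _ _ hn]

/-- The identification `(α, β, γ)` of `ℂP¹` with the unit sphere in `ℝ³`. -/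
def sphereCoord (p : CP1) : Fin 3 → ℝ :=
  Projectivization.lift (fun v : { v : Fin 2 → ℂ // v ≠ 0 } => sphereVec v.1)
    (by
      rintro ⟨a, ha⟩ ⟨b, hb⟩ t hab
      have hab' : a = t • b := hab
      have ht : t ≠ 0 := by
        rintro rfl
        exact ha (by simpa using hab')
      simpa [hab'] using sphereVec_smul t ht b) p

/-- In the affine coordinate `ζ`, the identification is the stereographic projection. -/
theorem sphereCoord_mk (ζ : ℂ) (h : (![1, ζ] : Fin 2 → ℂ) ≠ 0) :
    sphereCoord (Projectivization.mk ℂ ![1, ζ] h) =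
      ![(1 - ‖ζ‖ ^ 2) / (1 + ‖ζ‖ ^ 2), (ζ + (starRingEnd ℂ) ζ).re / (1 + ‖ζ‖ ^ 2),
        (Complex.I * ((starRingEnd ℂ) ζ - ζ)).re / (1 + ‖ζ‖ ^ 2)] := by
  rw [sphereCoord, Projectivization.lift_mk]
  simp [sphereVec, Complex.normSq_eq_norm_sq, two_mul]

end Sphere

/-! ### Vanishing spinorial pairs -/

section Spinorial

variable {S : Type*} [TopologicalSpace S] [ChartedSpace ℂ S]

/-- A map to `ℂP¹` is holomorphic if locally it is given by holomorphic homogeneous coordinates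
without common zeros. -/
def IsHolomorphic (φ : S → CP1) : Prop :=
  ∀ s₀ : S, ∃ U : Set S, IsOpen U ∧ s₀ ∈ U ∧ ∃ v : S → Fin 2 → ℂ,
    MDifferentiableOn 𝓘(ℂ) 𝓘(ℂ, Fin 2 → ℂ) v U ∧
      ∀ s ∈ U, ∃ h : v s ≠ 0, φ s = Projectivization.mk ℂ (v s) h

/-- The fibre of `𝒪(2)` at `p`: the bilinear forms on the line `p ⊂ ℂ²`, which is the fibre
at `p` of the tautological bundle `𝒪(-1)`. -/
abbrev O2Fiber (p : CP1) : Type := p.submodule →ₗ[ℂ] p.submodule →ₗ[ℂ] ℂ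

/-- Holomorphic sections over `U` of the line bundle `φ^* 𝒪(2)`: those that take holomorphic values
on all holomorphic local sections of `φ^* 𝒪(-1)`. -/
def IsHolomorphicSectionO2 (φ : S → CP1) (U : Set S) (σ : ∀ s, O2Fiber (φ s)) : Prop :=
  ∀ W : Set S, IsOpen W → W ⊆ U → ∀ v w : ∀ s, (φ s).submodule,
    MDifferentiableOn 𝓘(ℂ) 𝓘(ℂ, Fin 2 → ℂ) (fun s => (v s : Fin 2 → ℂ)) W →
    MDifferentiableOn 𝓘(ℂ) 𝓘(ℂ, Fin 2 → ℂ) (fun s => (w s : Fin 2 → ℂ)) W →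
    MDifferentiableOn 𝓘(ℂ) 𝓘(ℂ) (fun s => σ s (v s) (w s)) W

/-- Holomorphic 1-forms over `U`, that is, holomorphic sections of the canonical bundle over `U`:
in every preferred chart the coefficient of `dz` is holomorphic. -/
def IsHolomorphicOneForm (U : Set S) (μ : ∀ s : S, TangentSpace 𝓘(ℂ) s →L[ℂ] ℂ) : Prop :=
  ∀ s₀ : S, DifferentiableOn ℂ
    (fun z : ℂ => μ ((extChartAt 𝓘(ℂ) s₀).symm z)
      (mfderiv 𝓘(ℂ) 𝓘(ℂ) (extChartAt 𝓘(ℂ) s₀).symm z (1 : ℂ)))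
    ((extChartAt 𝓘(ℂ) s₀).target ∩ (extChartAt 𝓘(ℂ) s₀).symm ⁻¹' U)

/-- `φ^* 𝒪(2) ≅ K` as holomorphic line bundles: there are linear isomorphisms of the fibres under
which holomorphic local sections correspond to each other. -/
def PullbackIsoCanonical (φ : S → CP1) : Prop :=
  ∃ Φ : ∀ s : S, O2Fiber (φ s) ≃ₗ[ℂ] (TangentSpace 𝓘(ℂ) s →L[ℂ] ℂ),
    ∀ U : Set S, IsOpen U → ∀ σ : (∀ s, O2Fiber (φ s)),
      IsHolomorphicSectionO2 φ U σ ↔ IsHolomorphicOneForm U (fun s => Φ s (σ s))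

/-- `(S, φ)` is a vanishing spinorial pair. -/
structure IsVanishingSpinorialPair (φ : S → CP1) : Prop where
  holomorphic : IsHolomorphic φ
  nonconstant : ¬ ∃ c : CP1, ∀ s : S, φ s = c
  pullback : PullbackIsoCanonical φ

end Spinorial

/-! ### Generalized Calabi–Gray manifolds -/

section Total

variable {S : Type*} [TopologicalSpace S] [ChartedSpace ℂ S]
  {M : Type*} [TopologicalSpace M] [ChartedSpace R4 M] [IsManifold (𝓡 4) ∞ M]

/-- The real model of the product of a Riemann surface and a real 4-manifold. -/
abbrev modelX : ModelWithCorners ℝ (ℂ × R4) (ModelProd ℂ R4) := 𝓘(ℝ, ℂ).prod (𝓡 4)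

/-- Multiplication by `i` on `ℂ`. As the preferred charts of a Riemann surface are holomorphic, this
is the complex structure of each of its tangent spaces. -/
def mulI : ℂ →L[ℝ] ℂ := (Complex.I • ContinuousLinearMap.id ℂ ℂ).restrictScalars ℝ

/-- The complex structure `α I + β J + γ K` at `x`, where `(α, β, γ)` is the point of the sphere
belonging to `p`. -/
def twistorStructure (h : Hyperkahler M) (p : CP1) (x : M) :
    TangentSpace (𝓡 4) x →L[ℝ] TangentSpace (𝓡 4) x :=
  sphereCoord p 0 • h.I x + sphereCoord p 1 • h.J x + sphereCoord p 2 • h.K x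

/-- The complex structure of the generalized Calabi–Gray manifold `S × M`: at `(s, x)` it is
`j ⊕ (α I + β J + γ K)` with `(α, β, γ) = φ s`. -/
def complexStructure (φ : S → CP1) (h : Hyperkahler M) : EndField modelX (S × M) := fun y =>
  ContinuousLinearMap.prodMap (M₁ := ℂ) (M₂ := ℂ) (M₃ := R4) (M₄ := R4)
    mulI (twistorStructure h (φ y.1) y.2)

end Total

end CalabiGray

end

/-!
Suppose that `η` is a pluriclosed metric on `S × M`. Write `a : S → ℝ³` for the map to the unit
sphere given by `φ`, so that the complex structure of the fibre over `s` is
`A = a₁ I + a₂ J + a₃ K`.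

For a `2`-form `q` on a fibre, let `σ(q) ∈ ℝ³` consist of the coefficients of the products of `q`
with the three fundamental forms (`sdPart`, `Hyperkahler.sd`); up to a constant this is the
self-dual part of `q`. Complex structures act on `σ` by rotations: pull-back under `A` is the
rotation by `π` about `a` (`IsHyperTriple.sdPart_combo_combo`), and `A` acts as a derivation by
`-2 a ×` (`IsHyperTriple.sdPart_derivation`). Hence `σ(q)` is a multiple of `a` if `q` is of type
`(1, 1)`, a positive one if `q` is positive, and orthogonal to `a` if `q` is `A`-antiinvariant.

The integrals of `σ(η)` over the fibres are therefore `F a` with a positive function `F` on `S`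
(`totalMass`, and `fibreMass` in a chart of `S`). Since the fundamental forms are closed, the
integral of `σ(db)` vanishes for every `1`-form `b` (`Hyperkahler.integral_sd_d`), so Cartan's
formula expresses the fibre integrals of contractions of exterior derivatives with vectors of the
base as derivatives of fibre integrals (`Hyperkahler.integralSd_contract_d`,
`Hyperkahler.integralSd_contract_contract_d`). Apply this to `η`, and then to the real form
`Im ∂̄ η`, which is an explicit expression in `dη` (`im_typePart_three_one`). As `φ` is holomorphic,
`∂_{iu} a = a × ∂_u a`, and the first step shows that the fibre integral `T_u` of `σ` of the
contraction of `Im ∂̄ η` with `u` satisfies `2 T_u = (∂_{iu} F) a - F ∂_{iu} a`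
(`IsHermitianMetric.two_smul_fibreIntegralDelbar`). By the pluriclosed condition, the contraction
of `d (Im ∂̄ η)` with `1` and `i` is `A`-antiinvariant on the fibres, so the second step gives
`a · (∂_1 T_i - ∂_i T_1) = 0`. Together these amount to the equation `ΔF = -F |da|²`
(`IsPluriclosed.laplacian_fibreMass`).

So `F` is superharmonic on the compact surface `S`. At a minimum of `F`, either `φ` is locally
constant or its critical points are isolated (`IsHolomorphic.eventually_const_or`); the latter is
excluded by a strong minimum principle (`HasPartials.not_isLocalMin`). By the identity theorem
(`IsHolomorphic.eq_of_eventually_eq`) `φ` is constant, which is a contradiction.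
-/

open scoped Manifold ContDiff Bundle LinearAlgebra.Projectivization

noncomputable section

namespace CalabiGray

set_option synthInstance.maxHeartbeats 200000
set_option linter.unusedSimpArgs false
set_option linter.unusedSectionVars false

/-! ### Smooth families of alternating forms -/

section AlternatingCalculus

variable {E : Type*} [NormedAddCommGroup E] [NormedSpace ℝ E]
  {G : Type*} [NormedAddCommGroup G] [NormedSpace ℝ G]
  {F : Type*} [NormedAddCommGroup F] [NormedSpace ℝ F]

theorem contDiff_curryLeft {n : ℕ∞ω} {k : ℕ} :
    ContDiff ℝ n (fun η : E [⋀^Fin (k + 1)]→L[ℝ] F => η.curryLeft) := by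
  refine IsBoundedLinearMap.contDiff ⟨⟨fun _ _ => rfl, fun _ _ => rfl⟩, 1, one_pos, fun η => ?_⟩
  rw [ContinuousAlternatingMap.norm_curryLeft, one_mul]

theorem contDiffOn_alternating_apply {n : ℕ∞ω} {k : ℕ} {s : Set G}
    {f : G → E [⋀^Fin k]→L[ℝ] F} {v : Fin k → G → E} (hf : ContDiffOn ℝ n f s)
    (hv : ∀ i, ContDiffOn ℝ n (v i) s) : ContDiffOn ℝ n (fun x => f x (fun i => v i x)) s := by
  induction k with
  | zero =>
    have h : (fun x => f x (fun i => v i x)) =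
        fun x => ContinuousAlternatingMap.apply ℝ E F (0 : Fin 0 → E) (f x) := by
      funext x
      rw [ContinuousAlternatingMap.apply_apply]
      congr 1
      exact Subsingleton.elim _ _
    rw [h]
    exact (ContinuousAlternatingMap.apply ℝ E F (0 : Fin 0 → E)).contDiff.comp_contDiffOn hf
  | succ k ih =>
    have h1 : ContDiffOn ℝ n (fun x => (f x).curryLeft (v 0 x)) s :=
      (contDiff_curryLeft.comp_contDiffOn hf).clm_apply (hv 0)
    refine (ih h1 (fun i => hv i.succ)).congr fun x _ => ?_
    rw [ContinuousAlternatingMap.curryLeft_apply_apply]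
    congr 1
    funext i
    refine Fin.cases ?_ (fun j => ?_) i <;> simp

/-- In finite dimensions, smoothness of a family of alternating forms may be tested on
constant vectors. -/
theorem contDiffOn_alternating_iff [FiniteDimensional ℝ E] [FiniteDimensional ℝ F] {n : ℕ∞ω}
    {k : ℕ} {s : Set G} {f : G → E [⋀^Fin k]→L[ℝ] F} :
    ContDiffOn ℝ n f s ↔ ∀ v : Fin k → E, ContDiffOn ℝ n (fun x => f x v) s := by
  refine ⟨fun h v => contDiffOn_alternating_apply h (fun i => contDiffOn_const), fun h => ?_⟩
  set b := Module.finBasis ℝ E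
  let ev : (E [⋀^Fin k]→L[ℝ] F) →ₗ[ℝ] ((Fin k → Fin (Module.finrank ℝ E)) → F) :=
    { toFun := fun η r => η (fun i => b (r i))
      map_add' := fun _ _ => rfl
      map_smul' := fun _ _ => rfl }
  have hinj : Function.Injective ev := by
    intro η θ hηθ
    apply ContinuousAlternatingMap.toAlternatingMap_injective
    apply AlternatingMap.coe_multilinearMap_injective
    refine Module.Basis.ext_multilinear (fun _ => b) fun r => ?_
    exact congr_fun hηθ r
  have : FiniteDimensional ℝ (E [⋀^Fin k]→L[ℝ] F) := FiniteDimensional.of_injective ev hinj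
  obtain ⟨L, hL⟩ := LinearMap.exists_leftInverse_of_injective ev (LinearMap.ker_eq_bot.2 hinj)
  have h1 : ContDiffOn ℝ n (fun x => ev (f x)) s := contDiffOn_pi.2 fun r => h _
  have h2 := (LinearMap.toContinuousLinearMap L).contDiff.comp_contDiffOn (n := n) h1
  refine h2.congr fun x _ => ?_
  exact (LinearMap.congr_fun hL (f x)).symm

theorem contDiffOn_compContinuousLinearMap [FiniteDimensional ℝ E] [FiniteDimensional ℝ F]
    {E' : Type*} [NormedAddCommGroup E'] [NormedSpace ℝ E'] {n : ℕ∞ω} {k : ℕ} {s : Set G}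
    {f : G → E' [⋀^Fin k]→L[ℝ] F} {g : G → E →L[ℝ] E'} (hf : ContDiffOn ℝ n f s)
    (hg : ContDiffOn ℝ n g s) :
    ContDiffOn ℝ n (fun x => (f x).compContinuousLinearMap (g x)) s :=
  contDiffOn_alternating_iff.2 fun v =>
    contDiffOn_alternating_apply (v := fun i x => g x (v i)) hf
      fun _ => hg.clm_apply contDiffOn_const

theorem contDiffOn_extDeriv {k : ℕ} {s : Set E} (hs : IsOpen s) {f : E → E [⋀^Fin k]→L[ℝ] F}
    (hf : ContDiffOn ℝ ∞ f s) : ContDiffOn ℝ ∞ (extDeriv f) s :=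
  (ContinuousAlternatingMap.alternatizeUncurryFinCLM ℝ E F).contDiff.comp_contDiffOn
    (hf.fderiv_of_isOpen hs (by simp))

/-- Cartan's formula for the contraction of an exterior derivative with a constant vector field. -/
theorem curryLeft_extDeriv {k : ℕ} {w : E → E [⋀^Fin (k + 1)]→L[ℝ] F} {p : E}
    (hw : DifferentiableAt ℝ w p) (u : E) :
    (extDeriv w p).curryLeft u = fderiv ℝ w p u - extDeriv (fun q => (w q).curryLeft u) p := by
  have hw' : DifferentiableAt ℝ (fun q => (w q).curryLeft u) p :=
    (((contDiff_curryLeft (n := 1)).differentiable one_ne_zero (w p)).comp p hw).clm_apply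
      (differentiableAt_const u)
  ext v
  rw [ContinuousAlternatingMap.curryLeft_apply_apply, extDeriv_apply hw, Fin.sum_univ_succ,
    ContinuousAlternatingMap.sub_apply, extDeriv_apply hw', sub_eq_add_neg,
    ← Finset.sum_neg_distrib]
  congr 1
  · simp [fderiv_continuousAlternatingMap_apply_const_apply hw]
  · refine Finset.sum_congr rfl fun i _ => ?_
    have h1 : ∀ q, ((w q).curryLeft u) (i.removeNth v) =
        w q ((i.succ).removeNth (Matrix.vecCons u v)) := by
      intro q
      rw [ContinuousAlternatingMap.curryLeft_apply_apply]
      congr 1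
      funext j
      refine Fin.cases ?_ (fun j' => ?_) j
      · simp [Fin.removeNth]
      · simp [Fin.removeNth]
    simp [h1, pow_succ]

/-- Exterior derivatives commute with restriction to the slices `{z} × V`. -/
theorem extDeriv_comp_inr {V : Type*} [NormedAddCommGroup V] [NormedSpace ℝ V] {k : ℕ}
    {w : G × V → (G × V) [⋀^Fin k]→L[ℝ] F} {z : G} {y : V} (hw : DifferentiableAt ℝ w (z, y)) :
    (extDeriv w (z, y)).compContinuousLinearMap (ContinuousLinearMap.inr ℝ G V) =
      extDeriv (fun y' => (w (z, y')).compContinuousLinearMap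
        (ContinuousLinearMap.inr ℝ G V)) y := by
  have hd : ∀ y' : V, fderiv ℝ (fun y'' : V => (z, y'')) y' = ContinuousLinearMap.inr ℝ G V :=
    fun y' => (hasFDerivAt_prodMk_right z y').fderiv
  have h := extDeriv_pullback (r := ω) (f := fun y'' : V => (z, y'')) (x := y) hw
    (contDiff_prodMk_right z).contDiffAt (by simp)
  simp only [hd] at h
  exact h.symm

end AlternatingCalculus

/-! ### Differential forms in charts -/

section FormsInCharts

variable {E : Type*} [NormedAddCommGroup E] [NormedSpace ℝ E]
  {H : Type*} [TopologicalSpace H] {I : ModelWithCorners ℝ E H}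
  {X : Type*} [TopologicalSpace X] [ChartedSpace H X]
  {F : Type*} [NormedAddCommGroup F] [NormedSpace ℝ F] {k : ℕ}

/-- The value of a form at a point, with the tangent space identified with the model space. -/
def DiffForm.at (η : DiffForm I X F k) (x : X) : E [⋀^Fin k]→L[ℝ] F := η x

variable (I) in
/-- The derivative at `x` of the preferred chart around `x₀`, as an endomorphism of the model
space. -/
def chartMap (x₀ x : X) : E →L[ℝ] E := mfderiv I 𝓘(ℝ, E) (extChartAt I x₀) x

variable (I) in
/-- The derivative at `y` of the inverse of the preferred chart around `x₀`, as an endomorphism of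
the model space. -/
def chartInv (x₀ : X) (y : E) : E →L[ℝ] E := mfderiv 𝓘(ℝ, E) I (extChartAt I x₀).symm y

theorem inChart_eq (η : DiffForm I X F k) (x₀ : X) (y : E) :
    DiffForm.inChart η x₀ y =
      (η.at ((extChartAt I x₀).symm y)).compContinuousLinearMap (chartInv I x₀ y) := rfl

theorem d_at (η : DiffForm I X F k) (x : X) :
    (DiffForm.d η).at x = (extDeriv (DiffForm.inChart η x)
      (extChartAt I x x)).compContinuousLinearMap (chartMap I x x) := rfl

/-- Post-composition of a form with a linear map of the coefficients. -/
def DiffForm.postcomp {F' : Type*} [NormedAddCommGroup F'] [NormedSpace ℝ F'] (L : F →L[ℝ] F')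
    (η : DiffForm I X F k) : DiffForm I X F' k := fun x => L.compContinuousAlternatingMap (η x)

theorem inChart_postcomp {F' : Type*} [NormedAddCommGroup F'] [NormedSpace ℝ F']
    (L : F →L[ℝ] F') (η : DiffForm I X F k) (x₀ : X) (y : E) :
    (η.postcomp L).inChart x₀ y = L.compContinuousAlternatingMap (η.inChart x₀ y) := rfl

theorem DiffForm.IsSmooth.postcomp {F' : Type*} [NormedAddCommGroup F'] [NormedSpace ℝ F']
    {L : F →L[ℝ] F'} {η : DiffForm I X F k} (hη : η.IsSmooth) : (η.postcomp L).IsSmooth := by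
  intro x₀
  have h := (ContinuousLinearMap.compContinuousAlternatingMapCLM ℝ E F F' (Fin k)
    L).contDiff.comp_contDiffOn (n := ∞) (hη x₀)
  exact h

variable [I.Boundaryless]

theorem transition_mem_nhds (x₀ x₁ : X) {y : E} (hy : y ∈ (extChartAt I x₀).target)
    (hy₁ : (extChartAt I x₀).symm y ∈ (extChartAt I x₁).source) :
    ∀ᶠ y' in nhds y, y' ∈ (extChartAt I x₀).target ∧
      (extChartAt I x₀).symm y' ∈ (extChartAt I x₁).source :=
  Filter.Eventually.and (extChartAt_target_mem_nhds' hy)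
    ((continuousAt_extChartAt_symm'' hy).eventually ((isOpen_extChartAt_source x₁).mem_nhds hy₁))

theorem DiffForm.IsSmooth.contDiffAt {η : DiffForm I X F k} (hη : η.IsSmooth) (x₀ : X) {y : E}
    (hy : y ∈ (extChartAt I x₀).target) : ContDiffAt ℝ ∞ (η.inChart x₀) y :=
  (hη x₀ _ hy).contDiffAt (extChartAt_target_mem_nhds' hy)

theorem DiffForm.IsSmooth.differentiableAt {η : DiffForm I X F k} (hη : η.IsSmooth) (x₀ : X) {y : E}
    (hy : y ∈ (extChartAt I x₀).target) : DifferentiableAt ℝ (η.inChart x₀) y :=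
  (hη.contDiffAt x₀ hy).differentiableAt (by simp)

theorem d_postcomp {F' : Type*} [NormedAddCommGroup F'] [NormedSpace ℝ F']
    (L : F →L[ℝ] F') {η : DiffForm I X F k} (hη : η.IsSmooth) (x : X) :
    (DiffForm.d (η.postcomp L)).at x = L.compContinuousAlternatingMap ((DiffForm.d η).at x) := by
  have h := hη.differentiableAt x (mem_extChartAt_target x)
  have h' := hη.postcomp (L := L) |>.differentiableAt x (mem_extChartAt_target x)
  rw [d_at, d_at]
  ext v
  simp only [ContinuousAlternatingMap.compContinuousLinearMap_apply,
    ContinuousLinearMap.compContinuousAlternatingMap_coe, Function.comp_apply,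
    extDeriv_apply h, extDeriv_apply h', map_sum, inChart_postcomp]
  refine Finset.sum_congr rfl fun i _ => ?_
  rw [map_zsmul, fderiv_fun_comp _ L.differentiableAt]
  · simp
  · exact h.continuousAlternatingMap_apply fun _ => differentiableAt_const _

variable [IsManifold I ∞ X]

/-- `chartInv` is a left inverse of `chartMap`. -/
theorem chartInv_chartMap (x₁ : X) {x : X} (hx : x ∈ (extChartAt I x₁).source) (u : E) :
    chartInv I x₁ (extChartAt I x₁ x) (chartMap I x₁ x u) = u := by
  have : IsManifold I 1 X := IsManifold.of_le (n := ∞) (by simp)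
  have h := mfderivWithin_extChartAt_symm_comp_mfderiv_extChartAt' (I := I) hx
  rw [I.range_eq_univ, mfderivWithin_univ] at h
  exact congrArg (fun L => L u) h

theorem chartMap_chartInv (x₁ : X) {y : E} (hy : y ∈ (extChartAt I x₁).target) (u : E) :
    chartMap I x₁ ((extChartAt I x₁).symm y) (chartInv I x₁ y u) = u := by
  have : IsManifold I 1 X := IsManifold.of_le (n := ∞) (by simp)
  have h := mfderiv_extChartAt_comp_mfderivWithin_extChartAt_symm (I := I) hy
  rw [I.range_eq_univ, mfderivWithin_univ] at h
  exact congrArg (fun L => L u) h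

theorem mdifferentiableAt_extChartAt_symm (x₁ : X) {y : E} (hy : y ∈ (extChartAt I x₁).target) :
    MDifferentiableAt 𝓘(ℝ, E) I (extChartAt I x₁).symm y := by
  have : IsManifold I 1 X := IsManifold.of_le (n := ∞) (by simp)
  have h := mdifferentiableWithinAt_extChartAt_symm (I := I) hy
  rwa [I.range_eq_univ, mdifferentiableWithinAt_univ] at h

/-- The derivative of a transition map. -/
theorem fderiv_transition (x₀ x₁ : X) {y : E} (hy : y ∈ (extChartAt I x₀).target)
    (hy₁ : (extChartAt I x₀).symm y ∈ (extChartAt I x₁).source) :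
    fderiv ℝ (extChartAt I x₁ ∘ (extChartAt I x₀).symm) y =
      (chartMap I x₁ ((extChartAt I x₀).symm y)).comp (chartInv I x₀ y) := by
  have : IsManifold I 1 X := IsManifold.of_le (n := ∞) (by simp)
  rw [← mfderiv_eq_fderiv]
  refine mfderiv_comp y (mdifferentiableAt_extChartAt ?_) (mdifferentiableAt_extChartAt_symm x₀ hy)
  rwa [← extChartAt_source I]

theorem contDiffAt_transition (x₀ x₁ : X) {y : E} (hy : y ∈ (extChartAt I x₀).target)
    (hy₁ : (extChartAt I x₀).symm y ∈ (extChartAt I x₁).source) :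
    ContDiffAt ℝ ∞ (extChartAt I x₁ ∘ (extChartAt I x₀).symm) y := by
  have h := contDiffWithinAt_ext_coord_change (I := I) (n := ∞) x₁ x₀ (y := y)
    (by rw [PartialEquiv.trans_source]; exact ⟨hy, hy₁⟩)
  rwa [I.range_eq_univ, contDiffWithinAt_univ] at h

/-- The coordinate expressions of a form are pull-backs of each other under transition maps. -/
theorem inChart_eq_pullback (η : DiffForm I X F k) (x₀ x₁ : X) {y : E}
    (hy : y ∈ (extChartAt I x₀).target)
    (hy₁ : (extChartAt I x₀).symm y ∈ (extChartAt I x₁).source) :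
    DiffForm.inChart η x₀ y =
      (DiffForm.inChart η x₁ ((extChartAt I x₁ ∘ (extChartAt I x₀).symm) y)).compContinuousLinearMap
        (fderiv ℝ (extChartAt I x₁ ∘ (extChartAt I x₀).symm) y) := by
  rw [fderiv_transition x₀ x₁ hy hy₁, inChart_eq, inChart_eq, Function.comp_apply,
    (extChartAt I x₁).left_inv hy₁]
  ext v
  simp only [ContinuousAlternatingMap.compContinuousLinearMap_apply]
  congr 1
  funext i
  exact (chartInv_chartMap x₁ hy₁ _).symm

theorem two_le_infty : (2 : ℕ∞ω) ≤ ∞ :=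
  WithTop.coe_le_coe.2 (le_top : (2 : ℕ∞) ≤ ⊤)

/-- The exterior derivative may be computed in any chart. -/
theorem inChart_d {η : DiffForm I X F k} (hη : η.IsSmooth) (x₀ : X) {y : E}
    (hy : y ∈ (extChartAt I x₀).target) :
    DiffForm.inChart (DiffForm.d η) x₀ y = extDeriv (DiffForm.inChart η x₀) y := by
  set x := (extChartAt I x₀).symm y with hx
  have hxs : (extChartAt I x₀).symm y ∈ (extChartAt I x).source := mem_extChartAt_source x
  have h1 : DiffForm.inChart η x₀ =ᶠ[nhds y] fun y' =>
      (DiffForm.inChart η x ((extChartAt I x ∘ (extChartAt I x₀).symm) y')).compContinuousLinearMap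
        (fderiv ℝ (extChartAt I x ∘ (extChartAt I x₀).symm) y') := by
    filter_upwards [transition_mem_nhds x₀ x hy hxs] with y' hy'
    exact inChart_eq_pullback η x₀ x hy'.1 hy'.2
  rw [h1.extDeriv_eq, extDeriv_pullback (r := ∞) _ (contDiffAt_transition x₀ x hy hxs)
    (by simpa using two_le_infty),
    fderiv_transition x₀ x hy hxs]
  · rfl
  · exact hη.differentiableAt x (mem_extChartAt_target x)

theorem DiffForm.IsSmooth.d {η : DiffForm I X F k} (hη : η.IsSmooth) :
    (DiffForm.d η).IsSmooth := fun x₀ =>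
  (contDiffOn_extDeriv (isOpen_extChartAt_target x₀) (hη x₀)).congr fun _ hy => inChart_d hη x₀ hy

/-- A form is determined by its coordinate expressions. -/
theorem at_eq_inChart (η : DiffForm I X F k) (x₀ : X) {x : X} (hx : x ∈ (extChartAt I x₀).source) :
    η.at x = (η.inChart x₀ (extChartAt I x₀ x)).compContinuousLinearMap (chartMap I x₀ x) := by
  rw [inChart_eq, (extChartAt I x₀).left_inv hx]
  ext v
  simp only [ContinuousAlternatingMap.compContinuousLinearMap_apply]
  congr 1
  funext i
  exact (chartInv_chartMap x₀ hx _).symm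

end FormsInCharts

/-! ### Components of type `(p, q)` of forms of low degree -/

section LowDegree

variable {V : Type*} [AddCommGroup V] [Module ℝ V] [TopologicalSpace V]

theorem typePart_apply {k : ℕ} (J : V →L[ℝ] V) (p : ℕ) (η : V [⋀^Fin k]→L[ℝ] ℂ) (v : Fin k → V) :
    typePart J p η v = ∑ T : Finset (Fin k), (1 / 2 : ℂ) ^ k *
      (∑ P ∈ (Finset.univ : Finset (Fin k)).powersetCard p,
        ∏ l ∈ T, (if l ∈ P then -Complex.I else Complex.I)) *
        η (fun l => if l ∈ T then J (v l) else v l) := by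
  have h : typePart J p η v = ∑ P ∈ (Finset.univ : Finset (Fin k)).powersetCard p,
      ∑ T : Finset (Fin k), typeTerm J η P T v := by
    change (∑ P ∈ (Finset.univ : Finset (Fin k)).powersetCard p,
      ∑ T : Finset (Fin k), typeTerm J η P T) v = _
    simp only [_root_.sum_apply]
  rw [h, Finset.sum_comm]
  refine Finset.sum_congr rfl fun T _ => ?_
  simp only [typeTerm_apply, Finset.mul_sum, Finset.sum_mul]

theorem sum_finset_fin_two (f : Finset (Fin 2) → ℂ) :
    ∑ T, f T = f ∅ + (f {0} + (f {1} + f {0, 1})) := by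
  have h : (Finset.univ : Finset (Finset (Fin 2))) = {∅, {0}, {1}, {0, 1}} := by decide
  rw [h]
  repeat rw [Finset.sum_insert (by decide)]
  rw [Finset.sum_singleton]

theorem sum_finset_fin_three (f : Finset (Fin 3) → ℂ) :
    ∑ T, f T = f ∅ + (f {0} + (f {1} + (f {2} + (f {0, 1} + (f {0, 2} + (f {1, 2} +
      f {0, 1, 2})))))) := by
  have h : (Finset.univ : Finset (Finset (Fin 3))) =
    {∅, {0}, {1}, {2}, {0, 1}, {0, 2}, {1, 2}, {0, 1, 2}} := by decide
  rw [h]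
  repeat rw [Finset.sum_insert (by decide)]
  rw [Finset.sum_singleton]

theorem sum_finset_fin_four (f : Finset (Fin 4) → ℂ) :
    ∑ T, f T = f ∅ + (f {0} + (f {1} + (f {2} + (f {3} + (f {0, 1} + (f {0, 2} + (f {0, 3} +
      (f {1, 2} + (f {1, 3} + (f {2, 3} + (f {0, 1, 2} + (f {0, 1, 3} + (f {0, 2, 3} +
      (f {1, 2, 3} + f {0, 1, 2, 3})))))))))))))) := by
  have h : (Finset.univ : Finset (Finset (Fin 4))) =
    {∅, {0}, {1}, {2}, {3}, {0, 1}, {0, 2}, {0, 3}, {1, 2}, {1, 3}, {2, 3},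
      {0, 1, 2}, {0, 1, 3}, {0, 2, 3}, {1, 2, 3}, {0, 1, 2, 3}} := by decide
  rw [h]
  repeat rw [Finset.sum_insert (by decide)]
  rw [Finset.sum_singleton]

theorem sum_powersetCard_three_two (f : Finset (Fin 3) → ℂ) :
    ∑ P ∈ (Finset.univ : Finset (Fin 3)).powersetCard 2, f P =
      f {0, 1} + (f {0, 2} + f {1, 2}) := by
  have h : (Finset.univ : Finset (Fin 3)).powersetCard 2 = {{0, 1}, {0, 2}, {1, 2}} := by decide
  rw [h]
  repeat rw [Finset.sum_insert (by decide)]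
  rw [Finset.sum_singleton]

theorem sum_powersetCard_four_two (f : Finset (Fin 4) → ℂ) :
    ∑ P ∈ (Finset.univ : Finset (Fin 4)).powersetCard 2, f P =
      f {0, 1} + (f {0, 2} + (f {0, 3} + (f {1, 2} + (f {1, 3} + f {2, 3})))) := by
  have h : (Finset.univ : Finset (Fin 4)).powersetCard 2 =
    {{0, 1}, {0, 2}, {0, 3}, {1, 2}, {1, 3}, {2, 3}} := by decide
  rw [h]
  repeat rw [Finset.sum_insert (by decide)]
  rw [Finset.sum_singleton]

theorem ite_mem_two (J : V →L[ℝ] V) (T : Finset (Fin 2)) (a b : V) :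
    (fun l => if l ∈ T then J (![a, b] l) else ![a, b] l) =
      ![if 0 ∈ T then J a else a, if 1 ∈ T then J b else b] := by
  funext l
  fin_cases l <;> rfl

theorem ite_mem_three (J : V →L[ℝ] V) (T : Finset (Fin 3)) (a b c : V) :
    (fun l => if l ∈ T then J (![a, b, c] l) else ![a, b, c] l) =
      ![if 0 ∈ T then J a else a, if 1 ∈ T then J b else b, if 2 ∈ T then J c else c] := by
  funext l
  fin_cases l <;> rfl

theorem ite_mem_four (J : V →L[ℝ] V) (T : Finset (Fin 4)) (a b c d : V) :
    (fun l => if l ∈ T then J (![a, b, c, d] l) else ![a, b, c, d] l) =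
      ![if 0 ∈ T then J a else a, if 1 ∈ T then J b else b, if 2 ∈ T then J c else c,
        if 3 ∈ T then J d else d] := by
  funext l
  fin_cases l <;> rfl

section TwoForms

variable (J : V →L[ℝ] V) (η : V [⋀^Fin 2]→L[ℝ] ℂ) (a b : V)

theorem typePart_two_zero : typePart J 0 η ![a, b] = (1 / 4) * (η ![a, b] +
    Complex.I * (η ![J a, b] + η ![a, J b]) - η ![J a, J b]) := by
  have h2 : (Finset.univ : Finset (Fin 2)).powersetCard 0 = {∅} := by decide
  rw [typePart_apply, h2, sum_finset_fin_two]
  simp only [ite_mem_two]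
  simp
  ring

theorem typePart_two_one : typePart J 1 η ![a, b] = (1 / 2) * (η ![a, b] + η ![J a, J b]) := by
  have h2 : (Finset.univ : Finset (Fin 2)).powersetCard 1 = {{0}, {1}} := by decide
  rw [typePart_apply, h2, sum_finset_fin_two]
  simp only [ite_mem_two]
  simp
  ring

theorem typePart_two_two : typePart J 2 η ![a, b] = (1 / 4) * (η ![a, b] -
    Complex.I * (η ![J a, b] + η ![a, J b]) - η ![J a, J b]) := by
  have h2 : (Finset.univ : Finset (Fin 2)).powersetCard 2 = {{0, 1}} := by decide
  rw [typePart_apply, h2, sum_finset_fin_two]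
  simp only [ite_mem_two]
  simp
  ring

end TwoForms

section ThreeForms

variable (J : V →L[ℝ] V) (η : V [⋀^Fin 3]→L[ℝ] ℂ) (a b c : V)

theorem typePart_three_zero : typePart J 0 η ![a, b, c] = (1 / 8) * (η ![a, b, c] +
    Complex.I * (η ![J a, b, c] + η ![a, J b, c] + η ![a, b, J c]) -
    (η ![J a, J b, c] + η ![J a, b, J c] + η ![a, J b, J c]) -
    Complex.I * η ![J a, J b, J c]) := by
  have h2 : (Finset.univ : Finset (Fin 3)).powersetCard 0 = {∅} := by decide
  rw [typePart_apply, h2, sum_finset_fin_three]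
  simp only [ite_mem_three]
  simp
  ring

theorem typePart_three_one : typePart J 1 η ![a, b, c] = (1 / 8) * (3 * η ![a, b, c] +
    Complex.I * (η ![J a, b, c] + η ![a, J b, c] + η ![a, b, J c]) +
    (η ![J a, J b, c] + η ![J a, b, J c] + η ![a, J b, J c]) +
    3 * Complex.I * η ![J a, J b, J c]) := by
  have h2 : (Finset.univ : Finset (Fin 3)).powersetCard 1 = {{0}, {1}, {2}} := by decide
  rw [typePart_apply, h2, sum_finset_fin_three]
  simp only [ite_mem_three]
  simp
  ring

theorem typePart_three_two : typePart J 2 η ![a, b, c] = (1 / 8) * (3 * η ![a, b, c] -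
    Complex.I * (η ![J a, b, c] + η ![a, J b, c] + η ![a, b, J c]) +
    (η ![J a, J b, c] + η ![J a, b, J c] + η ![a, J b, J c]) -
    3 * Complex.I * η ![J a, J b, J c]) := by
  simp only [typePart_apply, sum_powersetCard_three_two]
  rw [sum_finset_fin_three]
  simp only [ite_mem_three]
  simp
  ring

theorem typePart_three_three : typePart J 3 η ![a, b, c] = (1 / 8) * (η ![a, b, c] -
    Complex.I * (η ![J a, b, c] + η ![a, J b, c] + η ![a, b, J c]) -
    (η ![J a, J b, c] + η ![J a, b, J c] + η ![a, J b, J c]) +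
    Complex.I * η ![J a, J b, J c]) := by
  have h2 : (Finset.univ : Finset (Fin 3)).powersetCard 3 = {{0, 1, 2}} := by decide
  rw [typePart_apply, h2, sum_finset_fin_three]
  simp only [ite_mem_three]
  simp
  ring

end ThreeForms

section FourForms

variable (J : V →L[ℝ] V) (η : V [⋀^Fin 4]→L[ℝ] ℂ) (a b c d : V)

theorem typePart_four_two : typePart J 2 η ![a, b, c, d] = (1 / 8) * (3 * η ![a, b, c, d] +
    (η ![J a, J b, c, d] + η ![J a, b, J c, d] + η ![J a, b, c, J d] + η ![a, J b, J c, d] +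
      η ![a, J b, c, J d] + η ![a, b, J c, J d]) +
    3 * η ![J a, J b, J c, J d]) := by
  simp only [typePart_apply, sum_powersetCard_four_two]
  rw [sum_finset_fin_four]
  simp only [ite_mem_four]
  simp
  ring

end FourForms

theorem map_neg_two_zero {F : Type*} [AddCommGroup F] [Module ℝ F] [TopologicalSpace F]
    (η : V [⋀^Fin 2]→L[ℝ] F) (a b : V) :
    η ![-a, b] = -η ![a, b] := by
  have h := η.map_update_neg ![a, b] 0 a
  rw [show Function.update ![a, b] 0 (-a) = ![-a, b] by
    funext l; fin_cases l <;> rfl] at h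
  refine h.trans (congrArg Neg.neg (congrArg η ?_))
  funext l; fin_cases l <;> rfl

theorem map_neg_two_one {F : Type*} [AddCommGroup F] [Module ℝ F] [TopologicalSpace F]
    (η : V [⋀^Fin 2]→L[ℝ] F) (a b : V) :
    η ![a, -b] = -η ![a, b] := by
  have h := η.map_update_neg ![a, b] 1 b
  rw [show Function.update ![a, b] 1 (-b) = ![a, -b] by
    funext l; fin_cases l <;> rfl] at h
  refine h.trans (congrArg Neg.neg (congrArg η ?_))
  funext l; fin_cases l <;> rfl

theorem map_neg_three_zero {F : Type*} [AddCommGroup F] [Module ℝ F] [TopologicalSpace F]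
    (η : V [⋀^Fin 3]→L[ℝ] F) (a b c : V) :
    η ![-a, b, c] = -η ![a, b, c] := by
  have h := η.map_update_neg ![a, b, c] 0 a
  rw [show Function.update ![a, b, c] 0 (-a) = ![-a, b, c] by
    funext l; fin_cases l <;> rfl] at h
  refine h.trans (congrArg Neg.neg (congrArg η ?_))
  funext l; fin_cases l <;> rfl

theorem map_neg_three_one {F : Type*} [AddCommGroup F] [Module ℝ F] [TopologicalSpace F]
    (η : V [⋀^Fin 3]→L[ℝ] F) (a b c : V) :
    η ![a, -b, c] = -η ![a, b, c] := by
  have h := η.map_update_neg ![a, b, c] 1 b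
  rw [show Function.update ![a, b, c] 1 (-b) = ![a, -b, c] by
    funext l; fin_cases l <;> rfl] at h
  refine h.trans (congrArg Neg.neg (congrArg η ?_))
  funext l; fin_cases l <;> rfl

theorem map_neg_three_two {F : Type*} [AddCommGroup F] [Module ℝ F] [TopologicalSpace F]
    (η : V [⋀^Fin 3]→L[ℝ] F) (a b c : V) :
    η ![a, b, -c] = -η ![a, b, c] := by
  have h := η.map_update_neg ![a, b, c] 2 c
  rw [show Function.update ![a, b, c] 2 (-c) = ![a, b, -c] by
    funext l; fin_cases l <;> rfl] at h
  refine h.trans (congrArg Neg.neg (congrArg η ?_))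
  funext l; fin_cases l <;> rfl

theorem alternating_zero_apply {k : ℕ} (v : Fin k → V) :
    (0 : V [⋀^Fin k]→L[ℝ] ℂ) v = 0 := rfl

/-- A form of type `(1, 2)` has no other components. -/
theorem typePart_typePart_three (J : V →L[ℝ] V) (hJ : ∀ v, J (J v) = -v)
    (η : V [⋀^Fin 3]→L[ℝ] ℂ) :
    typePart J 1 (typePart J 1 η) = typePart J 1 η ∧ typePart J 0 (typePart J 1 η) = 0 ∧
      typePart J 2 (typePart J 1 η) = 0 ∧ typePart J 3 (typePart J 1 η) = 0 := by
  have ext3 : ∀ θ θ' : V [⋀^Fin 3]→L[ℝ] ℂ, (∀ a b c, θ ![a, b, c] = θ' ![a, b, c]) → θ = θ' := by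
    intro θ θ' h
    ext v
    have hv : v = ![v 0, v 1, v 2] := by
      funext i
      fin_cases i <;> rfl
    rw [hv]
    exact h _ _ _
  refine ⟨?_, ?_, ?_, ?_⟩ <;> apply ext3 <;> intro a b c <;>
    simp only [typePart_three_zero, typePart_three_one, typePart_three_two, typePart_three_three,
      hJ, map_neg_three_zero, map_neg_three_one, map_neg_three_two,
      alternating_zero_apply] <;> ring_nf <;>
    (try simp only [Complex.I_sq]) <;> (try ring)

theorem typePart_two_of_invariant (J : V →L[ℝ] V) (hJ : ∀ v, J (J v) = -v)
    (η : V [⋀^Fin 2]→L[ℝ] ℂ) (h : ∀ u v, η ![J u, J v] = η ![u, v]) :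
    typePart J 1 η = η ∧ typePart J 0 η = 0 ∧ typePart J 2 η = 0 := by
  have ext2 : ∀ θ θ' : V [⋀^Fin 2]→L[ℝ] ℂ, (∀ a b, θ ![a, b] = θ' ![a, b]) → θ = θ' := by
    intro θ θ' h
    ext v
    have hv : v = ![v 0, v 1] := by
      funext i
      fin_cases i <;> rfl
    rw [hv]
    exact h _ _
  have h' : ∀ u v, η ![J u, v] = -η ![u, J v] := by
    intro u v
    rw [← h u (J v), hJ, map_neg_two_one, neg_neg]
  refine ⟨?_, ?_, ?_⟩ <;> apply ext2 <;> intro a b <;>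
    simp only [typePart_two_zero, typePart_two_one, typePart_two_two, h, h',
      alternating_zero_apply] <;> ring

/-- The imaginary part of the component of type `(1, 2)` of a real `3`-form. -/
theorem im_typePart_three_one (J : V →L[ℝ] V) (η : V [⋀^Fin 3]→L[ℝ] ℝ) (a b c : V) :
    (typePart J 1 (Complex.ofRealCLM.compContinuousAlternatingMap η) ![a, b, c]).im =
      (1 / 8) * (η ![J a, b, c] + η ![a, J b, c] + η ![a, b, J c] +
        3 * η ![J a, J b, J c]) := by
  rw [typePart_three_one]
  simp only [ContinuousLinearMap.compContinuousAlternatingMap_coe, Function.comp_apply,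
    Complex.ofRealCLM_apply]
  rw [show (1 / 8 : ℂ) = ((1 / 8 : ℝ) : ℂ) by norm_num, Complex.im_ofReal_mul]
  simp

/-- If the component of type `(2, 2)` of a `4`-form vanishes, then so does the `J`-invariant part
of its contraction with `u` and `J u`. -/
theorem add_map_of_typePart_four_two (J : V →L[ℝ] V) (hJ : ∀ v, J (J v) = -v)
    (η : V [⋀^Fin 4]→L[ℝ] ℂ) (h : typePart J 2 η = 0) (u v w : V) :
    η ![u, J u, v, w] + η ![u, J u, J v, J w] = 0 := by
  have h1 : typePart J 2 η ![u, J u, v, w] = 0 := by rw [h]; rfl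
  have e : ∀ (a c : V) (x : Fin 4 → V), x 0 = a → x 1 = a → η x = 0 := fun a c x h0 h1 =>
    η.map_eq_zero_of_eq x (h0.trans h1.symm) (by decide)
  have e' : ∀ x y : V, η ![J u, -u, x, y] = η ![u, J u, x, y] := by
    intro x y
    have s1 := η.toAlternatingMap.map_update_neg ![J u, u, x, y] 1 u
    have s2 := η.toAlternatingMap.map_swap ![u, J u, x, y] (i := 0) (j := 1) (by decide)
    rw [show Function.update ![J u, u, x, y] 1 (-u) = ![J u, -u, x, y] by
        funext l; fin_cases l <;> rfl,
      show Function.update ![J u, u, x, y] 1 u = ![u, J u, x, y] ∘ Equiv.swap 0 1 by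
        funext l; fin_cases l <;> rfl, s2, neg_neg] at s1
    exact s1
  have e'' : ∀ x y : V, η ![u, -u, x, y] = 0 := by
    intro x y
    have s1 := η.toAlternatingMap.map_update_neg ![u, u, x, y] 1 u
    rw [show Function.update ![u, u, x, y] 1 (-u) = ![u, -u, x, y] by
        funext l; fin_cases l <;> rfl,
      show Function.update ![u, u, x, y] 1 u = ![u, u, x, y] by
        funext l; fin_cases l <;> rfl] at s1
    refine s1.trans ?_
    rw [neg_eq_zero]
    exact e u u _ rfl rfl
  rw [typePart_four_two] at h1
  simp only [hJ, e', e'', e _ 0 ![J u, J u, _, _] rfl rfl] at h1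
  linear_combination 2 * h1

end LowDegree

theorem contDiffOn_typePart {E : Type*} [NormedAddCommGroup E] [NormedSpace ℝ E]
    [FiniteDimensional ℝ E] {G : Type*} [NormedAddCommGroup G] [NormedSpace ℝ G] {n : ℕ∞ω} {k : ℕ}
    {s : Set G} {J : G → E →L[ℝ] E} {η : G → E [⋀^Fin k]→L[ℝ] ℂ} (hJ : ContDiffOn ℝ n J s)
    (hη : ContDiffOn ℝ n η s) (p : ℕ) : ContDiffOn ℝ n (fun x => typePart (J x) p (η x)) s := by
  refine contDiffOn_alternating_iff.2 fun v => ?_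
  simp only [typePart_apply]
  refine ContDiffOn.sum fun T _ => ContDiffOn.mul contDiffOn_const ?_
  refine contDiffOn_alternating_apply (v := fun l x => if l ∈ T then J x (v l) else v l) hη
    fun l => ?_
  by_cases hl : l ∈ T
  · simpa only [hl, if_true] using hJ.clm_apply contDiffOn_const
  · simpa only [hl, if_false] using contDiffOn_const

/-- Components of type `(p, q)` are compatible with pull-back under complex linear maps. -/
theorem typePart_compContinuousLinearMap {V W : Type*} [AddCommGroup V] [Module ℝ V]
    [TopologicalSpace V] [AddCommGroup W] [Module ℝ W] [TopologicalSpace W] {k : ℕ}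
    (J : V →L[ℝ] V) (J' : W →L[ℝ] W) (f : W →L[ℝ] V) (hf : ∀ w, f (J' w) = J (f w)) (p : ℕ)
    (η : V [⋀^Fin k]→L[ℝ] ℂ) :
    (typePart J p η).compContinuousLinearMap f =
      typePart J' p (η.compContinuousLinearMap f) := by
  ext v
  rw [ContinuousAlternatingMap.compContinuousLinearMap_apply, typePart_apply, typePart_apply]
  refine Finset.sum_congr rfl fun T _ => ?_
  rw [ContinuousAlternatingMap.compContinuousLinearMap_apply]
  congr 2
  funext l
  simp only [Function.comp_apply]
  split_ifs
  · exact (hf _).symm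
  · rfl

/-! ### The wedge product of two `2`-forms -/

section Wedge

variable {V : Type*} [AddCommGroup V] [Module ℝ V] [TopologicalSpace V]

section Bilinear

variable (q : V [⋀^Fin 2]→L[ℝ] ℝ) (a b c : V) (t : ℝ)

theorem two_add_left : q ![a + b, c] = q ![a, c] + q ![b, c] := q.vecCons_add ![c] a b

theorem two_smul_left : q ![t • a, c] = t * q ![a, c] := q.vecCons_smul ![c] t a

theorem two_swap : q ![b, a] = -q ![a, b] := by
  have h := q.toAlternatingMap.map_swap ![a, b] (i := 0) (j := 1) (by decide)
  rw [show ![a, b] ∘ Equiv.swap 0 1 = ![b, a] by funext l; fin_cases l <;> rfl] at h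
  exact h

theorem two_self : q ![a, a] = 0 := by
  have h := two_swap q a a
  linarith

theorem two_add_right : q ![a, b + c] = q ![a, b] + q ![a, c] := by
  rw [two_swap, two_add_left, two_swap q a b, two_swap q a c]; ring

theorem two_smul_right : q ![a, t • c] = t * q ![a, c] := by
  rw [two_swap, two_smul_left, two_swap q a c]; ring

end Bilinear

/-- The wedge product of two `2`-forms, as a sum over shuffles. -/
def wedge (q r : V [⋀^Fin 2]→L[ℝ] ℝ) : V [⋀^Fin 4]→ₗ[ℝ] ℝ where
  toFun v := q ![v 0, v 1] * r ![v 2, v 3] - q ![v 0, v 2] * r ![v 1, v 3] +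
    q ![v 0, v 3] * r ![v 1, v 2] + q ![v 1, v 2] * r ![v 0, v 3] -
    q ![v 1, v 3] * r ![v 0, v 2] + q ![v 2, v 3] * r ![v 0, v 1]
  map_update_add' := by
    intro hd v i a b
    obtain rfl : hd = instDecidableEqFin 4 := Subsingleton.elim _ _
    fin_cases i <;> simp [Function.update, two_add_left, two_add_right] <;> ring
  map_update_smul' := by
    intro hd v i t a
    obtain rfl : hd = instDecidableEqFin 4 := Subsingleton.elim _ _
    fin_cases i <;> simp [Function.update, two_smul_left, two_smul_right] <;> ring
  map_eq_zero_of_eq' := by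
    intro v i j hv hij
    fin_cases i <;> fin_cases j <;> first
      | exact absurd rfl hij
      | (simp only [Fin.mk_zero, Fin.mk_one, Fin.reduceFinMk] at hv
         simp only [hv, two_self, two_swap q (v 1) (v 0), two_swap q (v 2) (v 0),
          two_swap q (v 3) (v 0), two_swap q (v 2) (v 1), two_swap q (v 3) (v 1),
          two_swap q (v 3) (v 2), two_swap r (v 1) (v 0), two_swap r (v 2) (v 0),
          two_swap r (v 3) (v 0), two_swap r (v 2) (v 1), two_swap r (v 3) (v 1),
          two_swap r (v 3) (v 2)]
         ring)

theorem wedge_apply (q r : V [⋀^Fin 2]→L[ℝ] ℝ) (v : Fin 4 → V) :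
    wedge q r v = q ![v 0, v 1] * r ![v 2, v 3] - q ![v 0, v 2] * r ![v 1, v 3] +
    q ![v 0, v 3] * r ![v 1, v 2] + q ![v 1, v 2] * r ![v 0, v 3] -
    q ![v 1, v 3] * r ![v 0, v 2] + q ![v 2, v 3] * r ![v 0, v 1] := rfl

end Wedge

/-- The standard basis of the model space. -/
def stdBasis : Module.Basis (Fin 4) ℝ R4 := (EuclideanSpace.basisFun (Fin 4) ℝ).toBasis

theorem alternating_eq_mul_det (f : R4 [⋀^Fin 4]→ₗ[ℝ] ℝ) (v : Fin 4 → R4) :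
    f v = f stdBasis * stdBasis.det v := by
  conv_lhs => rw [f.eq_smul_basis_det stdBasis]
  rfl

theorem comp_vec_two {V W : Type*} (f : V → W) (a b : V) : f ∘ ![a, b] = ![f a, f b] := by
  funext l
  fin_cases l <;> rfl

theorem wedge_comp (q r : R4 [⋀^Fin 2]→L[ℝ] ℝ) (f : R4 →L[ℝ] R4) :
    wedge (q.compContinuousLinearMap f) (r.compContinuousLinearMap f) stdBasis =
      f.toLinearMap.det * wedge q r stdBasis := by
  have h : wedge (q.compContinuousLinearMap f) (r.compContinuousLinearMap f) stdBasis =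
      wedge q r (f.toLinearMap ∘ stdBasis) := by
    simp only [wedge_apply, ContinuousAlternatingMap.compContinuousLinearMap_apply, comp_vec_two]
    rfl
  rw [h, alternating_eq_mul_det, Module.Basis.det_comp, Module.Basis.det_self]
  ring

/-- The coefficients of the wedge products of the `2`-form `q` with the three `2`-forms `w i`,
relative to the volume form `w 0 ∧ w 0`. If `w` consists of the fundamental forms of a hyperkähler
structure, this is the self-dual part of `q`, up to a constant. -/
def sdPart (w : Fin 3 → R4 [⋀^Fin 2]→L[ℝ] ℝ) (q : R4 [⋀^Fin 2]→L[ℝ] ℝ) : Fin 3 → ℝ :=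
  fun i => wedge q (w i) stdBasis / wedge (w 0) (w 0) stdBasis

/-- The ratios `sdPart` do not depend on the choice of a basis. -/
theorem sdPart_comp (w : Fin 3 → R4 [⋀^Fin 2]→L[ℝ] ℝ) (q : R4 [⋀^Fin 2]→L[ℝ] ℝ)
    (f : R4 →L[ℝ] R4) (hf : f.toLinearMap.det ≠ 0) :
    sdPart (fun i => (w i).compContinuousLinearMap f) (q.compContinuousLinearMap f) =
      sdPart w q := by
  funext i
  simp only [sdPart, wedge_comp]
  exact mul_div_mul_left _ _ hf

theorem sdPart_add (w : Fin 3 → R4 [⋀^Fin 2]→L[ℝ] ℝ) (q r : R4 [⋀^Fin 2]→L[ℝ] ℝ) :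
    sdPart w (q + r) = sdPart w q + sdPart w r := by
  have e : ∀ v, (q + r) v = q v + r v := fun _ => rfl
  funext i
  simp only [sdPart, wedge_apply, e, Pi.add_apply]
  ring

theorem sdPart_smul (w : Fin 3 → R4 [⋀^Fin 2]→L[ℝ] ℝ) (t : ℝ) (q : R4 [⋀^Fin 2]→L[ℝ] ℝ) :
    sdPart w (t • q) = t • sdPart w q := by
  have e : ∀ v, (t • q) v = t * q v := fun _ => rfl
  funext i
  simp only [sdPart, wedge_apply, e, Pi.smul_apply, smul_eq_mul]
  ring

theorem sdPart_eq_of_ne_zero (w : Fin 3 → R4 [⋀^Fin 2]→L[ℝ] ℝ) (q : R4 [⋀^Fin 2]→L[ℝ] ℝ)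
    (v : Fin 4 → R4) (hv : wedge (w 0) (w 0) v ≠ 0) (i : Fin 3) :
    sdPart w q i = wedge q (w i) v / wedge (w 0) (w 0) v := by
  rw [alternating_eq_mul_det] at hv
  rw [alternating_eq_mul_det, alternating_eq_mul_det (wedge (w 0) (w 0)) v, sdPart,
    mul_div_mul_right _ _ (right_ne_zero_of_mul hv)]

/-! ### Linear algebra of a hyperkähler structure -/

/-- A hyperkähler structure on the vector space `R4`: a scalar product and three orthogonal complex
structures satisfying the quaternion relations, with their fundamental forms. Bilinearity of `g`
is required only as far as it is needed for the algebra below. -/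
structure IsHyperTriple (g : R4 → R4 → ℝ) (I J K : R4 →L[ℝ] R4)
    (w : Fin 3 → R4 [⋀^Fin 2]→L[ℝ] ℝ) : Prop where
  symm : ∀ u v, g u v = g v u
  neg : ∀ u v, g (-u) v = -g u v
  pos : ∀ v, v ≠ 0 → 0 < g v v
  sqI : ∀ v, I (I v) = -v
  sqJ : ∀ v, J (J v) = -v
  sqK : ∀ v, K (K v) = -v
  mul_mul : ∀ v, I (J (K v)) = -v
  orthI : ∀ u v, g (I u) (I v) = g u v
  orthJ : ∀ u v, g (J u) (J v) = g u v
  orthK : ∀ u v, g (K u) (K v) = g u v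
  formI : ∀ u v, w 0 ![u, v] = g (I u) v
  formJ : ∀ u v, w 1 ![u, v] = g (J u) v
  formK : ∀ u v, w 2 ![u, v] = g (K u) v

namespace IsHyperTriple

variable {g : R4 → R4 → ℝ} {I J K : R4 →L[ℝ] R4} {w : Fin 3 → R4 [⋀^Fin 2]→L[ℝ] ℝ}

theorem IJ (h : IsHyperTriple g I J K w) (v : R4) : I (J v) = K v := by
  have := h.mul_mul (K v)
  rw [h.sqK, map_neg, map_neg, neg_inj] at this
  exact this

theorem JK (h : IsHyperTriple g I J K w) (v : R4) : J (K v) = I v := by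
  have := congrArg I (h.mul_mul v)
  rw [h.sqI, map_neg, neg_inj] at this
  exact this

theorem JI (h : IsHyperTriple g I J K w) (v : R4) : J (I v) = -K v := by rw [← h.JK, h.sqJ]

theorem KJ (h : IsHyperTriple g I J K w) (v : R4) : K (J v) = -I v := by rw [← h.IJ, h.sqJ, map_neg]

theorem IK (h : IsHyperTriple g I J K w) (v : R4) : I (K v) = -J v := by rw [← h.IJ, h.sqI]

theorem KI (h : IsHyperTriple g I J K w) (v : R4) : K (I v) = J v := by
  rw [← h.JK, h.KJ, h.IK, neg_neg]

theorem neg_right (h : IsHyperTriple g I J K w) (u v : R4) : g u (-v) = -g u v := by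
  rw [h.symm, h.neg, h.symm]

theorem I_self (h : IsHyperTriple g I J K w) (v : R4) : g (I v) v = 0 := by
  have h1 := h.orthI v (I v)
  rw [h.sqI, h.neg_right, h.symm v] at h1
  linarith

theorem J_self (h : IsHyperTriple g I J K w) (v : R4) : g (J v) v = 0 := by
  have h1 := h.orthJ v (J v)
  rw [h.sqJ, h.neg_right, h.symm v] at h1
  linarith

theorem K_self (h : IsHyperTriple g I J K w) (v : R4) : g (K v) v = 0 := by
  have h1 := h.orthK v (K v)
  rw [h.sqK, h.neg_right, h.symm v] at h1
  linarith

theorem I_J (h : IsHyperTriple g I J K w) (v : R4) : g (I v) (J v) = 0 := by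
  rw [← h.orthI, h.sqI, h.IJ, h.neg, h.symm, h.K_self, neg_zero]

theorem I_K (h : IsHyperTriple g I J K w) (v : R4) : g (I v) (K v) = 0 := by
  rw [← h.orthI, h.sqI, h.IK, h.neg, h.neg_right, h.symm, h.J_self, neg_zero, neg_zero]

theorem J_K (h : IsHyperTriple g I J K w) (v : R4) : g (J v) (K v) = 0 := by
  rw [← h.orthJ, h.sqJ, h.JK, h.neg, h.symm, h.I_self, neg_zero]

/-- The frame `v, I v, J v, K v`. -/
def frame (I J K : R4 →L[ℝ] R4) (v : R4) : Fin 4 → R4 := ![v, I v, J v, K v]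

theorem wedge_zero (h : IsHyperTriple g I J K w) (q : R4 [⋀^Fin 2]→L[ℝ] ℝ) (v : R4) :
    wedge q (w 0) (frame I J K v) = g v v * (q ![v, I v] + q ![J v, K v]) := by
  simp [wedge_apply, frame, h.formI, h.sqI, h.IJ, h.IK, h.neg, h.symm v, h.I_self, h.J_self,
    h.K_self, h.I_J, h.I_K, h.J_K, h.orthI, h.orthJ, h.orthK]
  ring

theorem wedge_one (h : IsHyperTriple g I J K w) (q : R4 [⋀^Fin 2]→L[ℝ] ℝ) (v : R4) :
    wedge q (w 1) (frame I J K v) = g v v * (q ![v, J v] - q ![I v, K v]) := by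
  simp [wedge_apply, frame, h.formJ, h.sqJ, h.JI, h.JK, h.neg, h.symm v, h.I_self, h.J_self,
    h.K_self, h.I_J, h.I_K, h.J_K, h.orthI, h.orthJ, h.orthK, h.symm (J v) (I v),
    h.symm (K v) (I v), h.symm (K v) (J v)]
  ring

theorem wedge_two (h : IsHyperTriple g I J K w) (q : R4 [⋀^Fin 2]→L[ℝ] ℝ) (v : R4) :
    wedge q (w 2) (frame I J K v) = g v v * (q ![v, K v] + q ![I v, J v]) := by
  simp [wedge_apply, frame, h.formK, h.sqK, h.KI, h.KJ, h.neg, h.symm v, h.I_self, h.J_self,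
    h.K_self, h.I_J, h.I_K, h.J_K, h.orthI, h.orthJ, h.orthK, h.symm (J v) (I v),
    h.symm (K v) (I v), h.symm (K v) (J v)]
  ring

theorem wedge_self (h : IsHyperTriple g I J K w) (v : R4) :
    wedge (w 0) (w 0) (frame I J K v) = 2 * g v v ^ 2 := by
  rw [h.wedge_zero, h.formI, h.formI, h.orthI, h.IJ, h.orthK]
  ring

/-- The map `sdPart` in the adapted frame `v, I v, J v, K v`. -/
theorem sdPart_eq (h : IsHyperTriple g I J K w) (q : R4 [⋀^Fin 2]→L[ℝ] ℝ) {v : R4} (hv : v ≠ 0) :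
    sdPart w q = ![(q ![v, I v] + q ![J v, K v]) / (2 * g v v),
      (q ![v, J v] - q ![I v, K v]) / (2 * g v v),
      (q ![v, K v] + q ![I v, J v]) / (2 * g v v)] := by
  have hn := (h.pos v hv).ne'
  have h0 : wedge (w 0) (w 0) (frame I J K v) ≠ 0 := by
    rw [h.wedge_self]; positivity
  funext i
  rw [sdPart_eq_of_ne_zero w q _ h0, h.wedge_self]
  fin_cases i
  · simp only [Fin.zero_eta, h.wedge_zero, Matrix.cons_val_zero]
    field_simp
  · simp only [Fin.mk_one, h.wedge_one, Matrix.cons_val_one, Matrix.cons_val_zero]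
    field_simp
  · simp only [Fin.reduceFinMk, h.wedge_two, Matrix.cons_val]
    field_simp

theorem wedge_self_ne_zero (h : IsHyperTriple g I J K w) :
    wedge (w 0) (w 0) stdBasis ≠ 0 := by
  intro h0
  have hv : (stdBasis 0 : R4) ≠ 0 := stdBasis.ne_zero 0
  have h1 := h.wedge_self (stdBasis 0)
  rw [alternating_eq_mul_det, h0, zero_mul] at h1
  have h2 := h.pos _ hv
  have : 0 < 2 * g (stdBasis 0) (stdBasis 0) ^ 2 := by positivity
  linarith

/-- The complex structure `α I + β J + γ K`. -/
def combo (I J K : R4 →L[ℝ] R4) (a : Fin 3 → ℝ) : R4 →L[ℝ] R4 := a 0 • I + a 1 • J + a 2 • K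

theorem combo_apply (a : Fin 3 → ℝ) (v : R4) :
    combo I J K a v = a 0 • I v + a 1 • J v + a 2 • K v := rfl

theorem combo_combo (h : IsHyperTriple g I J K w) {a : Fin 3 → ℝ} (ha : a ⬝ᵥ a = 1) (v : R4) :
    combo I J K a (combo I J K a v) = -v := by
  simp only [combo_apply, map_add, map_smul, h.sqI, h.sqJ, h.sqK, h.IJ, h.JI, h.IK, h.KI, h.JK,
    h.KJ]
  rw [dotProduct, Fin.sum_univ_three] at ha
  have : v = (a 0 * a 0 + a 1 * a 1 + a 2 * a 2) • v := by rw [ha, one_smul]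
  conv_rhs => rw [this]
  module

/-- Pull-back under the complex structure `α I + β J + γ K` acts on self-dual parts as the rotation
by `π` about `(α, β, γ)`. -/
theorem sdPart_combo_combo (h : IsHyperTriple g I J K w) {a : Fin 3 → ℝ} (ha : a ⬝ᵥ a = 1)
    (q r : R4 [⋀^Fin 2]→L[ℝ] ℝ)
    (hr : ∀ u v, r ![u, v] = q ![combo I J K a u, combo I J K a v]) :
    sdPart w r = (2 * (a ⬝ᵥ sdPart w q)) • a - sdPart w q := by
  have hv : (stdBasis 0 : R4) ≠ 0 := stdBasis.ne_zero 0
  set v := (stdBasis 0 : R4)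
  have hn := (h.pos v hv).ne'
  rw [dotProduct, Fin.sum_univ_three] at ha
  rw [h.sdPart_eq q hv, h.sdPart_eq r hv]
  simp only [hr, combo_apply, h.sqI, h.sqJ, h.sqK, h.IJ, h.JI, h.IK, h.KI, h.JK, h.KJ,
    two_add_left, two_add_right, two_smul_left, two_smul_right, map_neg_two_zero, map_neg_two_one,
    two_self, smul_neg,
    two_swap q v (I v), two_swap q v (J v), two_swap q v (K v), two_swap q (I v) (J v),
    two_swap q (I v) (K v), two_swap q (J v) (K v)]
  funext i
  fin_cases i <;> simp [dotProduct, Fin.sum_univ_three] <;> field_simp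
  · linear_combination (-(q ![v, I v] + q ![J v, K v])) * ha
  · linear_combination (-(q ![v, J v] - q ![I v, K v])) * ha
  · linear_combination (-(q ![v, K v] + q ![I v, J v])) * ha

/-- The complex structure `α I + β J + γ K`, acting on `2`-forms as a derivation, acts on self-dual
parts as an infinitesimal rotation about `(α, β, γ)`. -/
theorem sdPart_derivation (h : IsHyperTriple g I J K w) (a : Fin 3 → ℝ)
    (q r : R4 [⋀^Fin 2]→L[ℝ] ℝ)
    (hr : ∀ u v, r ![u, v] = q ![combo I J K a u, v] + q ![u, combo I J K a v]) :
    sdPart w r = (-2 : ℝ) • crossProduct a (sdPart w q) := by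
  have hv : (stdBasis 0 : R4) ≠ 0 := stdBasis.ne_zero 0
  set v := (stdBasis 0 : R4)
  have hn := (h.pos v hv).ne'
  rw [h.sdPart_eq q hv, h.sdPart_eq r hv]
  simp only [hr, combo_apply, h.sqI, h.sqJ, h.sqK, h.IJ, h.JI, h.IK, h.KI, h.JK, h.KJ,
    two_add_left, two_add_right, two_smul_left, two_smul_right, map_neg_two_zero, map_neg_two_one,
    two_self, smul_neg,
    two_swap q v (I v), two_swap q v (J v), two_swap q v (K v), two_swap q (I v) (J v),
    two_swap q (I v) (K v), two_swap q (J v) (K v)]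
  funext i
  fin_cases i <;> simp [cross_apply] <;> field_simp <;> ring

/-- The self-dual part of a contraction of the component of type `(1, 2)` of a `3`-form. -/
theorem sdPart_typePart (h : IsHyperTriple g I J K w) {a : Fin 3 → ℝ} (ha : a ⬝ᵥ a = 1)
    (p q r : R4 [⋀^Fin 2]→L[ℝ] ℝ)
    (hr : ∀ u v, r ![u, v] = (1 / 8) * (q ![u, v] + (p ![combo I J K a u, v] +
      p ![u, combo I J K a v]) + 3 * q ![combo I J K a u, combo I J K a v])) :
    sdPart w r = (1 / 8 : ℝ) • (sdPart w q + (-2 : ℝ) • crossProduct a (sdPart w p) +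
      (3 : ℝ) • ((2 * (a ⬝ᵥ sdPart w q)) • a - sdPart w q)) := by
  set q' := q.compContinuousLinearMap (combo I J K a) with hq'
  have e : ∀ u v, q' ![u, v] = q ![combo I J K a u, combo I J K a v] := fun u v => by
    rw [hq', ContinuousAlternatingMap.compContinuousLinearMap_apply, comp_vec_two]
  have h1 := h.sdPart_combo_combo ha q q' e
  have h2 := h.sdPart_derivation a p ((8 : ℝ) • r + ((-1 : ℝ) • q + (-3 : ℝ) • q')) fun u v => by
    change 8 * r ![u, v] + (-1 * q ![u, v] + -3 * q' ![u, v]) = _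
    rw [hr, e]
    ring
  have h3 : r = (1 / 8 : ℝ) • (q + ((8 : ℝ) • r + ((-1 : ℝ) • q + (-3 : ℝ) • q')) +
      (3 : ℝ) • q') := by module
  rw [h3, sdPart_smul, sdPart_add, sdPart_add, h2, sdPart_smul, h1]

/-- The self-dual part of a positive form of type `(1, 1)`. -/
theorem dotProduct_sdPart_pos (h : IsHyperTriple g I J K w) (a : Fin 3 → ℝ)
    (q : R4 [⋀^Fin 2]→L[ℝ] ℝ) (hq : ∀ v, v ≠ 0 → 0 < q ![v, combo I J K a v]) :
    0 < a ⬝ᵥ sdPart w q := by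
  have hv : (stdBasis 0 : R4) ≠ 0 := stdBasis.ne_zero 0
  set v := (stdBasis 0 : R4)
  have hn := (h.pos v hv).ne'
  have hI : I v ≠ 0 := fun h0 => hv (by simpa [h0] using h.sqI v)
  have hJ : J v ≠ 0 := fun h0 => hv (by simpa [h0] using h.sqJ v)
  have hK : K v ≠ 0 := fun h0 => hv (by simpa [h0] using h.sqK v)
  have h0 := hq v hv
  have h1 := hq _ hI
  have h2 := hq _ hJ
  have h3 := hq _ hK
  -- the trace of `q` with respect to the complex structure, in the frame `v, I v, J v, K v`
  have key : 4 * g v v * (a ⬝ᵥ sdPart w q) = q ![v, combo I J K a v] +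
      q ![I v, combo I J K a (I v)] + q ![J v, combo I J K a (J v)] +
      q ![K v, combo I J K a (K v)] := by
    rw [h.sdPart_eq q hv]
    simp only [combo_apply, h.sqI, h.sqJ, h.sqK, h.IJ, h.JI, h.IK, h.KI, h.JK, h.KJ,
      two_add_left, two_add_right, two_smul_left, two_smul_right, map_neg_two_zero,
      map_neg_two_one, two_self, smul_neg,
      two_swap q v (I v), two_swap q v (J v), two_swap q v (K v), two_swap q (I v) (J v),
    two_swap q (I v) (K v), two_swap q (J v) (K v)]
    simp [dotProduct, Fin.sum_univ_three]
    field_simp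
    ring
  have hpos := h.pos v hv
  by_contra hneg
  have : 4 * g v v * (a ⬝ᵥ sdPart w q) ≤ 0 :=
    mul_nonpos_of_nonneg_of_nonpos (by positivity) (not_lt.1 hneg)
  linarith

/-- The self-dual part of a form of type `(1, 1)` is a multiple of the fundamental form. -/
theorem sdPart_of_invariant (h : IsHyperTriple g I J K w) {a : Fin 3 → ℝ} (ha : a ⬝ᵥ a = 1)
    (q : R4 [⋀^Fin 2]→L[ℝ] ℝ)
    (hq : ∀ u v, q ![combo I J K a u, combo I J K a v] = q ![u, v]) :
    sdPart w q = (a ⬝ᵥ sdPart w q) • a := by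
  have h1 := h.sdPart_combo_combo ha q q fun u v => (hq u v).symm
  funext i
  have h2 := congrFun h1 i
  simp only [Pi.sub_apply, Pi.smul_apply, smul_eq_mul] at h2 ⊢
  linarith

/-- The self-dual part of a form of type `(2, 0) + (0, 2)` is orthogonal to the fundamental form. -/
theorem dotProduct_sdPart_of_antiinvariant (h : IsHyperTriple g I J K w) {a : Fin 3 → ℝ}
    (ha : a ⬝ᵥ a = 1) (q : R4 [⋀^Fin 2]→L[ℝ] ℝ)
    (hq : ∀ u v, q ![u, v] + q ![combo I J K a u, combo I J K a v] = 0) :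
    a ⬝ᵥ sdPart w q = 0 := by
  have h1 := h.sdPart_combo_combo ha q (-q) fun u v => by
    change -(q ![u, v]) = _
    linarith [hq u v]
  rw [← neg_one_smul ℝ q, sdPart_smul, neg_one_smul] at h1
  have h3 := congrArg (a ⬝ᵥ ·) h1
  simp only [dotProduct_neg, dotProduct_sub, dotProduct_smul, ha, smul_eq_mul] at h3
  linarith

end IsHyperTriple

/-! ### Hyperkähler structures in charts -/

section HyperkahlerCharts

variable {M : Type*} [TopologicalSpace M] [ChartedSpace R4 M] [IsManifold (𝓡 4) ∞ M]

theorem symm_trivializationAt (x₀ : M) {x : M} (hx : x ∈ (extChartAt (𝓡 4) x₀).source) (c : R4) :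
    (trivializationAt R4 (TangentSpace (𝓡 4) : M → Type _) x₀).symm x c =
      chartInv (𝓡 4) x₀ (extChartAt (𝓡 4) x₀ x) c := by
  have : IsManifold (𝓡 4) 1 M := IsManifold.of_le (n := ∞) (by simp)
  rw [extChartAt_source] at hx
  have h := TangentBundle.symmL_trivializationAt (I := 𝓡 4) hx
  rw [(𝓡 4).range_eq_univ, mfderivWithin_univ] at h
  refine Eq.trans ?_ (congrArg (fun L => L c) h)
  rw [Bundle.Trivialization.symmL_apply]
  simpa using hx

theorem trivializationAt_apply (x₀ : M) {x : M} (hx : x ∈ (extChartAt (𝓡 4) x₀).source)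
    (v : TangentSpace (𝓡 4) x) :
    (trivializationAt R4 (TangentSpace (𝓡 4) : M → Type _) x₀ ⟨x, v⟩).2 =
      chartMap (𝓡 4) x₀ x v := by
  have : IsManifold (𝓡 4) 1 M := IsManifold.of_le (n := ∞) (by simp)
  have hx' := hx
  rw [extChartAt_source] at hx
  have h := TangentBundle.continuousLinearMapAt_trivializationAt (I := 𝓡 4) hx
  have h2 := congrArg (fun L => L v) h
  rw [← Bundle.Trivialization.continuousLinearMapAt_apply_of_mem (R := ℝ)]
  · exact h2
  · simpa using hx

/-- Vector fields with constant coefficients in a chart are smooth on its domain. -/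
theorem contMDiffOn_coordField (x₀ : M) (c : R4) :
    ContMDiffOn (𝓡 4) (𝓡 4).tangent ∞ (fun x => Bundle.TotalSpace.mk' R4
      (E := (TangentSpace (𝓡 4) : M → Type _)) x
      ((trivializationAt R4 (TangentSpace (𝓡 4) : M → Type _) x₀).symm x c))
      (extChartAt (𝓡 4) x₀).source := by
  have hs : (extChartAt (𝓡 4) x₀).source ⊆
      (trivializationAt R4 (TangentSpace (𝓡 4) : M → Type _) x₀).baseSet := by
    rw [extChartAt_source]; exact subset_of_eq (by simp)
  refine (Bundle.Trivialization.contMDiffOn_section_iff _ (isOpen_extChartAt_source x₀) hs).2 ?_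
  refine (contMDiffOn_const (c := c)).congr fun x hx => ?_
  rw [Bundle.Trivialization.apply_mk_symm _ (hs hx)]

/-- The coordinate expression of a field of endomorphisms of the tangent spaces. -/
def endInChart (A : EndField (𝓡 4) M) (x₀ : M) (y : R4) : R4 →L[ℝ] R4 :=
  (chartMap (𝓡 4) x₀ ((extChartAt (𝓡 4) x₀).symm y)).comp
    ((A ((extChartAt (𝓡 4) x₀).symm y) : R4 →L[ℝ] R4).comp (chartInv (𝓡 4) x₀ y))

theorem contDiffOn_endInChart {g : Metric M} {A : EndField (𝓡 4) M} (h : IsCompatible g A)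
    (x₀ : M) : ContDiffOn ℝ ∞ (endInChart A x₀) (extChartAt (𝓡 4) x₀).target := by
  refine contDiffOn_clm_apply.2 fun c => ?_
  have h1 := ContMDiffOn.clm_bundle_apply (n := ∞) (F₁ := R4) (F₂ := R4)
    (h.smooth.contMDiffOn (s := (extChartAt (𝓡 4) x₀).source)) (contMDiffOn_coordField x₀ c)
  have hs : (extChartAt (𝓡 4) x₀).source ⊆
      (trivializationAt R4 (TangentSpace (𝓡 4) : M → Type _) x₀).baseSet := by
    rw [extChartAt_source]; exact subset_of_eq (by simp)
  have h2 := (Bundle.Trivialization.contMDiffOn_section_iff _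
    (isOpen_extChartAt_source x₀) hs).1 h1
  have h3 := (h2.comp (contMDiffOn_extChartAt_symm x₀) fun y hy =>
    (extChartAt (𝓡 4) x₀).map_target hy).contDiffOn
  refine h3.congr fun y hy => ?_
  have hx := (extChartAt (𝓡 4) x₀).map_target hy
  rw [Function.comp_apply, trivializationAt_apply x₀ hx, symm_trivializationAt x₀ hx,
    (extChartAt (𝓡 4) x₀).right_inv hy]
  rfl

theorem isSmooth_fundamentalForm {g : Metric M} {A : EndField (𝓡 4) M} (h : IsCompatible g A) :
    (fundamentalForm g A h).IsSmooth := by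
  intro x₀
  refine contDiffOn_alternating_iff.2 fun v => ?_
  have h1 := ContMDiffOn.clm_bundle_apply (n := ∞) (F₁ := R4) (F₂ := R4)
    (h.smooth.contMDiffOn (s := (extChartAt (𝓡 4) x₀).source)) (contMDiffOn_coordField x₀ (v 0))
  have h2 := ContMDiffOn.clm_bundle_apply₂ (n := ∞) (F₁ := R4) (F₂ := R4) (F₃ := ℝ)
    (E₃ := Bundle.Trivial M ℝ)
    (g.contMDiff.contMDiffOn (s := (extChartAt (𝓡 4) x₀).source)) h1
    (contMDiffOn_coordField x₀ (v 1))
  have h3 : ContMDiffOn (𝓡 4) 𝓘(ℝ, ℝ) ∞ (fun x => g.inner x (A x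
      ((trivializationAt R4 (TangentSpace (𝓡 4) : M → Type _) x₀).symm x (v 0)))
      ((trivializationAt R4 (TangentSpace (𝓡 4) : M → Type _) x₀).symm x (v 1)))
      (extChartAt (𝓡 4) x₀).source := by
    intro x hx
    have h4 := h2 x hx
    simp only [Bundle.contMDiffWithinAt_totalSpace] at h4
    exact h4.2
  have h4 := (h3.comp (contMDiffOn_extChartAt_symm x₀) fun y hy =>
    (extChartAt (𝓡 4) x₀).map_target hy).contDiffOn
  refine h4.congr fun y hy => ?_
  have hx := (extChartAt (𝓡 4) x₀).map_target hy
  rw [Function.comp_apply, symm_trivializationAt x₀ hx, symm_trivializationAt x₀ hx,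
    (extChartAt (𝓡 4) x₀).right_inv hy]
  rfl

/-- The fundamental forms of the three complex structures. -/
def Hyperkahler.form (h : Hyperkahler M) : Fin 3 → DiffForm (𝓡 4) M ℝ 2 :=
  ![fundamentalForm h.g h.I h.kahler_I.compatible, fundamentalForm h.g h.J h.kahler_J.compatible,
    fundamentalForm h.g h.K h.kahler_K.compatible]

theorem Hyperkahler.form_isSmooth (h : Hyperkahler M) (i : Fin 3) : (h.form i).IsSmooth := by
  fin_cases i
  exacts [isSmooth_fundamentalForm h.kahler_I.compatible,
    isSmooth_fundamentalForm h.kahler_J.compatible, isSmooth_fundamentalForm h.kahler_K.compatible]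

theorem Hyperkahler.d_form (h : Hyperkahler M) (i : Fin 3) (x : M) :
    DiffForm.d (h.form i) x = 0 := by
  fin_cases i
  exacts [h.kahler_I.closed x, h.kahler_J.closed x, h.kahler_K.closed x]

theorem Hyperkahler.isHyperTriple (h : Hyperkahler M) (x : M) :
    IsHyperTriple (fun u v => h.g.inner x u v) (h.I x) (h.J x) (h.K x)
      (fun i => (h.form i).at x) where
  symm u v := h.g.symm x u v
  neg u v := by
    change h.g.inner x (-(show TangentSpace (𝓡 4) x from u)) v = _
    rw [map_neg]; rfl
  pos v hv := h.g.pos x v hv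
  sqI := h.kahler_I.compatible.sq x
  sqJ := h.kahler_J.compatible.sq x
  sqK := h.kahler_K.compatible.sq x
  mul_mul := h.mul_mul x
  orthI := h.kahler_I.compatible.orthogonal x
  orthJ := h.kahler_J.compatible.orthogonal x
  orthK := h.kahler_K.compatible.orthogonal x
  formI _ _ := rfl
  formJ _ _ := rfl
  formK _ _ := rfl

/-- The map `sdPart` at a point of a hyperkähler manifold. -/
def Hyperkahler.sd (h : Hyperkahler M) (x : M) (q : R4 [⋀^Fin 2]→L[ℝ] ℝ) : Fin 3 → ℝ :=
  sdPart (fun i => (h.form i).at x) q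

/-- The map `sdPart` in a chart. -/
def Hyperkahler.sdInChart (h : Hyperkahler M) (x₀ : M) (y : R4) (q : R4 [⋀^Fin 2]→L[ℝ] ℝ) :
    Fin 3 → ℝ :=
  sdPart (fun i => (h.form i).inChart x₀ y) q

theorem det_chartInv_ne_zero (x₀ : M) {y : R4} (hy : y ∈ (extChartAt (𝓡 4) x₀).target) :
    (chartInv (𝓡 4) x₀ y).toLinearMap.det ≠ 0 := by
  have h : (chartMap (𝓡 4) x₀ ((extChartAt (𝓡 4) x₀).symm y)).toLinearMap ∘ₗ
      (chartInv (𝓡 4) x₀ y).toLinearMap = LinearMap.id :=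
    LinearMap.ext fun u => chartMap_chartInv x₀ hy u
  have h2 := congrArg LinearMap.det h
  rw [LinearMap.det_comp, LinearMap.det_id] at h2
  exact right_ne_zero_of_mul (h2 ▸ one_ne_zero)

/-- The map `sdPart` may be computed in any chart. -/
theorem Hyperkahler.sdInChart_eq (h : Hyperkahler M) (x₀ : M) {y : R4}
    (hy : y ∈ (extChartAt (𝓡 4) x₀).target) (q : R4 [⋀^Fin 2]→L[ℝ] ℝ) :
    h.sdInChart x₀ y (q.compContinuousLinearMap (chartInv (𝓡 4) x₀ y)) =
      h.sd ((extChartAt (𝓡 4) x₀).symm y) q :=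
  sdPart_comp _ _ _ (det_chartInv_ne_zero x₀ hy)

/-- The density of the volume form in a chart. -/
def Hyperkahler.vol (h : Hyperkahler M) (x₀ : M) (y : R4) : ℝ :=
  wedge ((h.form 0).inChart x₀ y) ((h.form 0).inChart x₀ y) stdBasis

theorem Hyperkahler.vol_ne_zero (h : Hyperkahler M) (x₀ : M) {y : R4}
    (hy : y ∈ (extChartAt (𝓡 4) x₀).target) : h.vol x₀ y ≠ 0 := by
  have h1 := (h.isHyperTriple ((extChartAt (𝓡 4) x₀).symm y)).wedge_self_ne_zero
  rw [vol, inChart_eq, wedge_comp]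
  exact mul_ne_zero (det_chartInv_ne_zero x₀ hy) h1

theorem contDiffOn_wedge {G : Type*} [NormedAddCommGroup G] [NormedSpace ℝ G] {n : ℕ∞ω}
    {s : Set G} {q r : G → R4 [⋀^Fin 2]→L[ℝ] ℝ} (hq : ContDiffOn ℝ n q s)
    (hr : ContDiffOn ℝ n r s) (v : Fin 4 → R4) :
    ContDiffOn ℝ n (fun x => wedge (q x) (r x) v) s := by
  have e := fun u => contDiffOn_alternating_iff.1 hq u
  have e' := fun u => contDiffOn_alternating_iff.1 hr u
  simp only [wedge_apply]
  exact ((((((e _).mul (e' _)).sub ((e _).mul (e' _))).add ((e _).mul (e' _))).add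
    ((e _).mul (e' _))).sub ((e _).mul (e' _))).add ((e _).mul (e' _))

theorem Hyperkahler.contDiffOn_vol (h : Hyperkahler M) (x₀ : M) :
    ContDiffOn ℝ ∞ (h.vol x₀) (extChartAt (𝓡 4) x₀).target :=
  contDiffOn_wedge (h.form_isSmooth 0 x₀) (h.form_isSmooth 0 x₀) _

/-- The density of the volume form transforms with the Jacobian determinant. -/
theorem Hyperkahler.vol_transition (h : Hyperkahler M) (x₀ x₁ : M) {y : R4}
    (hy : y ∈ (extChartAt (𝓡 4) x₀).target)
    (hy₁ : (extChartAt (𝓡 4) x₀).symm y ∈ (extChartAt (𝓡 4) x₁).source) :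
    h.vol x₀ y = (fderiv ℝ (extChartAt (𝓡 4) x₁ ∘ (extChartAt (𝓡 4) x₀).symm) y).det *
      h.vol x₁ ((extChartAt (𝓡 4) x₁ ∘ (extChartAt (𝓡 4) x₀).symm) y) := by
  rw [vol, inChart_eq_pullback _ x₀ x₁ hy hy₁, wedge_comp]
  rfl

theorem Hyperkahler.contDiffOn_sdInChart (h : Hyperkahler M) (x₀ : M) {G : Type*}
    [NormedAddCommGroup G] [NormedSpace ℝ G] {s : Set G} {f : G → R4}
    {q : G → R4 [⋀^Fin 2]→L[ℝ] ℝ} (hf : ContDiffOn ℝ ∞ f s)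
    (hfs : ∀ x ∈ s, f x ∈ (extChartAt (𝓡 4) x₀).target) (hq : ContDiffOn ℝ ∞ q s) :
    ContDiffOn ℝ ∞ (fun x => h.sdInChart x₀ (f x) (q x)) s := by
  refine contDiffOn_pi.2 fun i => ?_
  refine ContDiffOn.div (contDiffOn_wedge hq ((h.form_isSmooth i x₀).comp hf hfs) _)
    ((h.contDiffOn_vol x₀).comp hf hfs) fun x hx => h.vol_ne_zero x₀ (hfs x hx)

end HyperkahlerCharts

/-! ### The Riemannian measure -/

section

open MeasureTheory Set

section ChartMeasure

variable {M : Type*} [TopologicalSpace M] [ChartedSpace R4 M] [IsManifold (𝓡 4) ∞ M]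
  [MeasurableSpace M]

/-- The volume measure on the domain of the preferred chart around `x₀`. -/
def Hyperkahler.chartMeasure (h : Hyperkahler M) (x₀ : M) : Measure M :=
  Measure.map (extChartAt (𝓡 4) x₀).symm
    ((volume.restrict (extChartAt (𝓡 4) x₀).target).withDensity
      fun y => ENNReal.ofReal |h.vol x₀ y|)

theorem measurableSet_target (x₀ : M) : MeasurableSet (extChartAt (𝓡 4) x₀).target :=
  (isOpen_extChartAt_target x₀).measurableSet

variable [BorelSpace M]

theorem measurableSet_source (x₀ : M) : MeasurableSet (extChartAt (𝓡 4) x₀).source :=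
  (isOpen_extChartAt_source x₀).measurableSet

theorem aemeasurable_extChartAt_symm (x₀ : M) : AEMeasurable (extChartAt (𝓡 4) x₀).symm
    (volume.restrict (extChartAt (𝓡 4) x₀).target) :=
  (continuousOn_extChartAt_symm x₀).aemeasurable (measurableSet_target x₀)

theorem Hyperkahler.aemeasurable_vol (h : Hyperkahler M) (x₀ : M) :
    AEMeasurable (fun y => ENNReal.ofReal |h.vol x₀ y|)
      (volume.restrict (extChartAt (𝓡 4) x₀).target) :=
  ((h.contDiffOn_vol x₀).continuousOn.abs.aemeasurable (measurableSet_target x₀)).ennreal_ofReal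

theorem Hyperkahler.chartMeasure_apply (h : Hyperkahler M) (x₀ : M) {A : Set M}
    (hA : MeasurableSet A) : h.chartMeasure x₀ A =
      ∫⁻ y in (extChartAt (𝓡 4) x₀).symm ⁻¹' A ∩ (extChartAt (𝓡 4) x₀).target,
        ENNReal.ofReal |h.vol x₀ y| := by
  rw [chartMeasure, Measure.map_apply_of_aemeasurable _ hA, withDensity_apply',
    Measure.restrict_restrict' (measurableSet_target x₀)]
  exact (aemeasurable_extChartAt_symm x₀).mono_ac (withDensity_absolutelyContinuous _ _)

theorem measurableSet_symm_preimage (x₀ : M) {A : Set M} (hA : MeasurableSet A) :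
    MeasurableSet ((extChartAt (𝓡 4) x₀).symm ⁻¹' A ∩ (extChartAt (𝓡 4) x₀).target) := by
  have h1 : Measurable ((extChartAt (𝓡 4) x₀).target.domRestrict (extChartAt (𝓡 4) x₀).symm) :=
    (continuousOn_iff_continuous_domRestrict.1 (continuousOn_extChartAt_symm x₀)).measurable
  have h2 := (measurableSet_target x₀).subtype_image (h1 hA)
  refine (congrArg MeasurableSet ?_).mpr h2
  ext y
  constructor
  · rintro ⟨hy, hyt⟩
    exact ⟨⟨y, hyt⟩, hy, rfl⟩
  · rintro ⟨⟨z, hz⟩, hy, rfl⟩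
    exact ⟨hy, hz⟩

/-- The volume measures of two charts agree on the intersection of the domains, by the change of
variables formula. -/
theorem Hyperkahler.chartMeasure_apply_eq (h : Hyperkahler M) (x₀ x₁ : M) {A : Set M}
    (hA : MeasurableSet A) (h₀ : A ⊆ (extChartAt (𝓡 4) x₀).source)
    (h₁ : A ⊆ (extChartAt (𝓡 4) x₁).source) : h.chartMeasure x₀ A = h.chartMeasure x₁ A := by
  rw [h.chartMeasure_apply x₀ hA, h.chartMeasure_apply x₁ hA]
  set B := (extChartAt (𝓡 4) x₀).symm ⁻¹' A ∩ (extChartAt (𝓡 4) x₀).target with hB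
  set τ := extChartAt (𝓡 4) x₁ ∘ (extChartAt (𝓡 4) x₀).symm with hτ
  have himg : (extChartAt (𝓡 4) x₁).symm ⁻¹' A ∩ (extChartAt (𝓡 4) x₁).target = τ '' B := by
    ext y
    constructor
    · rintro ⟨hy, hyt⟩
      refine ⟨extChartAt (𝓡 4) x₀ ((extChartAt (𝓡 4) x₁).symm y),
        ⟨?_, (extChartAt (𝓡 4) x₀).map_source (h₀ hy)⟩, ?_⟩
      · rw [mem_preimage, (extChartAt (𝓡 4) x₀).left_inv (h₀ hy)]; exact hy
      · rw [hτ, Function.comp_apply, (extChartAt (𝓡 4) x₀).left_inv (h₀ hy),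
          (extChartAt (𝓡 4) x₁).right_inv hyt]
    · rintro ⟨z, ⟨hz, hzt⟩, rfl⟩
      refine ⟨?_, (extChartAt (𝓡 4) x₁).map_source (h₁ hz)⟩
      rw [mem_preimage, hτ, Function.comp_apply, (extChartAt (𝓡 4) x₁).left_inv (h₁ hz)]
      exact hz
  have hinj : InjOn τ B := by
    intro y hy y' hy' e
    have e1 := (extChartAt (𝓡 4) x₁).injOn (h₁ hy.1) (h₁ hy'.1) e
    exact (extChartAt (𝓡 4) x₀).symm.injOn hy.2 hy'.2 e1
  have hd : ∀ y ∈ B, HasFDerivWithinAt τ (fderiv ℝ τ y) B y := fun y hy =>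
    ((contDiffAt_transition x₀ x₁ hy.2 (h₁ hy.1)).differentiableAt
      (by simp)).hasFDerivAt.hasFDerivWithinAt
  have hBm : MeasurableSet B := measurableSet_symm_preimage x₀ hA
  rw [himg, lintegral_image_eq_lintegral_abs_det_fderiv_mul volume hBm hd hinj]
  refine setLIntegral_congr_fun hBm fun y hy => ?_
  rw [← ENNReal.ofReal_mul (abs_nonneg _), ← abs_mul, h.vol_transition x₀ x₁ hy.2 (h₁ hy.1)]

theorem Hyperkahler.chartMeasure_source_compl (h : Hyperkahler M) (x₀ : M) :
    h.chartMeasure x₀ (extChartAt (𝓡 4) x₀).sourceᶜ = 0 := by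
  rw [h.chartMeasure_apply x₀ (measurableSet_source x₀).compl]
  have : (extChartAt (𝓡 4) x₀).symm ⁻¹' (extChartAt (𝓡 4) x₀).sourceᶜ ∩
      (extChartAt (𝓡 4) x₀).target = ∅ := by
    ext y
    simp only [mem_inter_iff, mem_preimage, mem_compl_iff, mem_empty_iff_false, iff_false, not_and]
    exact fun hy hyt => hy ((extChartAt (𝓡 4) x₀).map_target hyt)
  rw [this, Measure.restrict_empty, lintegral_zero_measure]

theorem Hyperkahler.chartMeasure_restrict_source (h : Hyperkahler M) (x₀ : M) :
    (h.chartMeasure x₀).restrict (extChartAt (𝓡 4) x₀).source = h.chartMeasure x₀ :=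
  Measure.restrict_eq_self_of_ae_mem (by
    rw [ae_iff]; exact h.chartMeasure_source_compl x₀)

theorem Hyperkahler.chartMeasure_restrict (h : Hyperkahler M) (x₀ x₁ : M) :
    (h.chartMeasure x₀).restrict (extChartAt (𝓡 4) x₁).source =
      (h.chartMeasure x₁).restrict (extChartAt (𝓡 4) x₀).source := by
  rw [← h.chartMeasure_restrict_source x₀, ← h.chartMeasure_restrict_source x₁,
    Measure.restrict_restrict (measurableSet_source x₁),
    Measure.restrict_restrict (measurableSet_source x₀)]
  have hm := (measurableSet_source x₀).inter (measurableSet_source x₁)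
  rw [inter_comm]
  ext A hA
  rw [Measure.restrict_apply hA, Measure.restrict_apply hA]
  exact h.chartMeasure_apply_eq x₀ x₁ (hA.inter hm) (fun _ hx => hx.2.1) (fun _ hx => hx.2.2)

/-- Finitely many of the chart measures can be glued: a further chart contributes its measure on
the complement of the domains already covered. -/
theorem Hyperkahler.exists_measure_finset (h : Hyperkahler M) (t : Finset M) :
    ∃ μ : Measure M, ∀ x₀ : M, μ.restrict (extChartAt (𝓡 4) x₀).source =
      (h.chartMeasure x₀).restrict (⋃ i ∈ t, (extChartAt (𝓡 4) i).source) := by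
  classical
  induction t using Finset.induction_on with
  | empty => exact ⟨0, fun x₀ => by simp⟩
  | insert a t _ ih =>
    obtain ⟨μ, hμ⟩ := ih
    set U := ⋃ i ∈ t, (extChartAt (𝓡 4) i).source with hU
    have hUm : MeasurableSet U :=
      (isOpen_biUnion fun i _ => isOpen_extChartAt_source i).measurableSet
    refine ⟨μ + (h.chartMeasure a).restrict Uᶜ, fun x₀ => ?_⟩
    have hdis : Disjoint U (Uᶜ ∩ (extChartAt (𝓡 4) a).source) :=
      disjoint_left.2 fun _ hx hx' => hx'.1 hx
    rw [Measure.restrict_add, hμ, Measure.restrict_restrict (measurableSet_source x₀),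
      inter_comm, ← Measure.restrict_restrict hUm.compl, h.chartMeasure_restrict a x₀,
      Measure.restrict_restrict hUm.compl,
      ← Measure.restrict_union hdis (hUm.compl.inter (measurableSet_source a))]
    congr 1
    rw [Finset.set_biUnion_insert, union_comm]
    ext x
    simp only [mem_union, mem_inter_iff, mem_compl_iff]
    tauto

variable [CompactSpace M]

/-- The Riemannian volume measure, glued from the volume measures of the charts. -/
theorem Hyperkahler.exists_measure (h : Hyperkahler M) :
    ∃ μ : Measure M, ∀ x₀ : M, μ.restrict (extChartAt (𝓡 4) x₀).source = h.chartMeasure x₀ := by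
  obtain ⟨t, ht⟩ := isCompact_univ.elim_finite_subcover
    (fun i : M => (extChartAt (𝓡 4) i).source) (fun i => isOpen_extChartAt_source i)
    fun x _ => mem_iUnion.2 ⟨x, mem_extChartAt_source x⟩
  obtain ⟨μ, hμ⟩ := h.exists_measure_finset t
  exact ⟨μ, fun x₀ => by rw [hμ, univ_subset_iff.1 ht, Measure.restrict_univ]⟩

/-- The Riemannian volume measure. It is determined by its restrictions to the domains of the
charts. -/
def Hyperkahler.measure (h : Hyperkahler M) : Measure M := h.exists_measure.choose

theorem Hyperkahler.measure_restrict (h : Hyperkahler M) (x₀ : M) :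
    h.measure.restrict (extChartAt (𝓡 4) x₀).source = h.chartMeasure x₀ :=
  h.exists_measure.choose_spec x₀

theorem Hyperkahler.measure_apply (h : Hyperkahler M) (x₀ : M) {A : Set M} (hA : MeasurableSet A)
    (hs : A ⊆ (extChartAt (𝓡 4) x₀).source) : h.measure A =
      ∫⁻ y in (extChartAt (𝓡 4) x₀).symm ⁻¹' A ∩ (extChartAt (𝓡 4) x₀).target,
        ENNReal.ofReal |h.vol x₀ y| := by
  rw [← h.chartMeasure_apply x₀ hA, ← h.measure_restrict, Measure.restrict_apply hA,
    inter_eq_left.2 hs]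

instance Hyperkahler.isFiniteMeasure [T2Space M] (h : Hyperkahler M) :
    IsFiniteMeasure h.measure := by
  refine ⟨?_⟩
  refine (isCompact_univ (X := M)).measure_lt_top_of_nhdsWithin fun x _ => ?_
  have : LocallyCompactSpace M := Manifold.locallyCompact_of_finiteDimensional (𝓡 4)
  obtain ⟨K, hK, hKx, hKs⟩ := exists_compact_subset (isOpen_extChartAt_source (I := 𝓡 4) x)
    (mem_extChartAt_source x)
  refine ⟨K, ?_, ?_⟩
  · rw [nhdsWithin_univ]; exact mem_interior_iff_mem_nhds.1 hKx
  rw [h.measure_apply x hK.isClosed.measurableSet hKs]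
  have himg : (extChartAt (𝓡 4) x).symm ⁻¹' K ∩ (extChartAt (𝓡 4) x).target =
      extChartAt (𝓡 4) x '' K := by
    ext y
    constructor
    · rintro ⟨hy, hyt⟩
      exact ⟨_, hy, (extChartAt (𝓡 4) x).right_inv hyt⟩
    · rintro ⟨z, hz, rfl⟩
      refine ⟨?_, (extChartAt (𝓡 4) x).map_source (hKs hz)⟩
      rw [mem_preimage, (extChartAt (𝓡 4) x).left_inv (hKs hz)]
      exact hz
  rw [himg]
  have hc : IsCompact (extChartAt (𝓡 4) x '' K) :=
    hK.image_of_continuousOn ((continuousOn_extChartAt x).mono hKs)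
  have hi : IntegrableOn (h.vol x) (extChartAt (𝓡 4) x '' K) :=
    ((h.contDiffOn_vol x).continuousOn.mono (by
      rintro _ ⟨z, hz, rfl⟩
      exact (extChartAt (𝓡 4) x).map_source (hKs hz))).integrableOn_compact hc
  have h2 := hi.2
  rw [HasFiniteIntegral] at h2
  simpa only [← Real.enorm_eq_ofReal_abs] using h2

theorem Hyperkahler.measure_ne_zero [Nonempty M] (h : Hyperkahler M) : h.measure ≠ 0 := by
  intro h0
  obtain ⟨x⟩ := ‹Nonempty M›
  have h1 := h.measure_apply x (measurableSet_source x) subset_rfl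
  have h2 : (extChartAt (𝓡 4) x).symm ⁻¹' (extChartAt (𝓡 4) x).source ∩
      (extChartAt (𝓡 4) x).target = (extChartAt (𝓡 4) x).target :=
    inter_eq_right.2 fun y hy => (extChartAt (𝓡 4) x).map_target hy
  rw [h0, h2] at h1
  have h3 := h1.symm
  rw [Measure.coe_zero, Pi.zero_apply, lintegral_eq_zero_iff' (h.aemeasurable_vol x)] at h3
  have h4 : ∀ᵐ y ∂volume.restrict (extChartAt (𝓡 4) x).target, False := by
    filter_upwards [h3, ae_restrict_mem (measurableSet_target x)] with y hy hyt
    exact h.vol_ne_zero x hyt (by simpa using hy)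
  have h5 : volume (extChartAt (𝓡 4) x).target = 0 := by
    simpa [ae_iff] using h4
  exact ((isOpen_extChartAt_target x).measure_pos volume ⟨_, mem_extChartAt_target x⟩).ne' h5

theorem Hyperkahler.integral_pos [T2Space M] [Nonempty M] (h : Hyperkahler M) {f : M → ℝ}
    (hf : Continuous f) (hpos : ∀ x, 0 < f x) : 0 < ∫ x, f x ∂h.measure := by
  have hi : Integrable f h.measure :=
    hf.integrable_of_hasCompactSupport (HasCompactSupport.of_compactSpace f)
  rw [integral_pos_iff_support_of_nonneg (fun x => (hpos x).le) hi]
  have : Function.support f = univ := by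
    ext x; simpa using (hpos x).ne'
  rw [this]
  exact pos_iff_ne_zero.2 fun h0 => h.measure_ne_zero (Measure.measure_univ_eq_zero.1 h0)

theorem Hyperkahler.integral_eq_chart (h : Hyperkahler M) (x₀ : M) {f : M → ℝ}
    (hf : Measurable f) (hs : ∀ x ∉ (extChartAt (𝓡 4) x₀).source, f x = 0) :
    ∫ x, f x ∂h.measure = ∫ y in (extChartAt (𝓡 4) x₀).target,
      |h.vol x₀ y| * f ((extChartAt (𝓡 4) x₀).symm y) := by
  rw [← setIntegral_eq_integral_of_forall_compl_eq_zero hs, h.measure_restrict, chartMeasure,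
    integral_map, integral_withDensity_eq_integral_toReal_smul₀ (h.aemeasurable_vol x₀)]
  · refine integral_congr_ae (Filter.Eventually.of_forall fun y => ?_)
    simp [ENNReal.toReal_ofReal (abs_nonneg _)]
  · exact Filter.Eventually.of_forall fun y => ENNReal.ofReal_lt_top
  · exact (aemeasurable_extChartAt_symm x₀).mono_ac (withDensity_absolutelyContinuous _ _)
  · exact hf.aestronglyMeasurable

end ChartMeasure

end

/-! ### Stokes' theorem -/

section

open MeasureTheory Set

section Divergence

variable {V : Type*} [NormedAddCommGroup V] [NormedSpace ℝ V]

theorem extDeriv_one_apply {b : V → V [⋀^Fin 1]→L[ℝ] ℝ} {y : V} (hb : DifferentiableAt ℝ b y)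
    (u v : V) : extDeriv b y ![u, v] =
      fderiv ℝ (fun y => b y ![v]) y u - fderiv ℝ (fun y => b y ![u]) y v := by
  have e0 : (0 : Fin 2).removeNth ![u, v] = ![v] := by
    funext i; fin_cases i; rfl
  have e1 : (1 : Fin 2).removeNth ![u, v] = ![u] := by
    funext i; fin_cases i; rfl
  rw [extDeriv_apply hb, Fin.sum_univ_two, e0, e1]
  simp [sub_eq_add_neg]

theorem extDeriv_two_apply {w : V → V [⋀^Fin 2]→L[ℝ] ℝ} {y : V} (hw : DifferentiableAt ℝ w y)
    (u v x : V) : extDeriv w y ![u, v, x] =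
      fderiv ℝ (fun y => w y ![v, x]) y u - fderiv ℝ (fun y => w y ![u, x]) y v +
        fderiv ℝ (fun y => w y ![u, v]) y x := by
  have e0 : (0 : Fin 3).removeNth ![u, v, x] = ![v, x] := by
    funext i; fin_cases i <;> rfl
  have e1 : (1 : Fin 3).removeNth ![u, v, x] = ![u, x] := by
    funext i; fin_cases i <;> rfl
  have e2 : (2 : Fin 3).removeNth ![u, v, x] = ![u, v] := by
    funext i; fin_cases i <;> rfl
  rw [extDeriv_apply hw, Fin.sum_univ_three, e0, e1, e2]
  simp [sub_eq_add_neg]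

/-- The coefficients of the `3`-form `b ∧ w`, with signs and order such that its exterior
derivative is the divergence of this vector field. -/
def wedgeField (b : R4 [⋀^Fin 1]→L[ℝ] ℝ) (w : R4 [⋀^Fin 2]→L[ℝ] ℝ) : Fin 4 → ℝ :=
  let β := fun i => b ![stdBasis i]
  let q := fun i j => w ![stdBasis i, stdBasis j]
  ![β 1 * q 2 3 - β 2 * q 1 3 + β 3 * q 1 2, -(β 0 * q 2 3 - β 2 * q 0 3 + β 3 * q 0 2),
    β 0 * q 1 3 - β 1 * q 0 3 + β 3 * q 0 1, -(β 0 * q 1 2 - β 1 * q 0 2 + β 2 * q 0 1)]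

/-- If `dw = 0`, then `db ∧ w = d (b ∧ w)` is a divergence. -/
theorem wedge_extDeriv {b : R4 → R4 [⋀^Fin 1]→L[ℝ] ℝ} {w : R4 → R4 [⋀^Fin 2]→L[ℝ] ℝ} {y : R4}
    (hb : DifferentiableAt ℝ b y) (hw : DifferentiableAt ℝ w y) (hdw : extDeriv w y = 0) :
    wedge (extDeriv b y) (w y) stdBasis =
      ∑ k, fderiv ℝ (fun y => wedgeField (b y) (w y) k) y (stdBasis k) := by
  have hb' : ∀ u, DifferentiableAt ℝ (fun y => b y u) y := fun u =>
    hb.continuousAlternatingMap_apply fun _ => differentiableAt_const _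
  have hw' : ∀ u, DifferentiableAt ℝ (fun y => w y u) y := fun u =>
    hw.continuousAlternatingMap_apply fun _ => differentiableAt_const _
  have hz : ∀ u v x : R4, fderiv ℝ (fun y => w y ![v, x]) y u - fderiv ℝ (fun y => w y ![u, x]) y v
      + fderiv ℝ (fun y => w y ![u, v]) y x = 0 := fun u v x => by
    rw [← extDeriv_two_apply hw, hdw]; rfl
  have hm : ∀ u v, DifferentiableAt ℝ (fun y => b y u * w y v) y := fun u v => (hb' u).mul (hw' v)
  have hmul : ∀ u v x, fderiv ℝ (fun y => b y u * w y v) y x =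
      b y u * fderiv ℝ (fun y => w y v) y x + w y v * fderiv ℝ (fun y => b y u) y x := by
    intro u v x
    rw [fderiv_fun_mul (hb' u) (hw' v)]; rfl
  have h3 : ∀ u v u' v' u'' v'' x, fderiv ℝ (fun y => b y u * w y v - b y u' * w y v' +
      b y u'' * w y v'') y x = fderiv ℝ (fun y => b y u * w y v) y x -
      fderiv ℝ (fun y => b y u' * w y v') y x + fderiv ℝ (fun y => b y u'' * w y v'') y x := by
    intro u v u' v' u'' v'' x
    rw [fderiv_fun_add ((hm _ _).fun_sub (hm _ _)) (hm _ _), fderiv_fun_sub (hm _ _) (hm _ _)]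
    rfl
  have h3n : ∀ u v u' v' u'' v'' x, fderiv ℝ (fun y => -(b y u * w y v - b y u' * w y v' +
      b y u'' * w y v'')) y x = -(fderiv ℝ (fun y => b y u * w y v) y x -
      fderiv ℝ (fun y => b y u' * w y v') y x + fderiv ℝ (fun y => b y u'' * w y v'') y x) := by
    intro u v u' v' u'' v'' x
    rw [fderiv_fun_neg, ← h3]
    rfl
  rw [Fin.sum_univ_four]
  simp only [wedgeField, wedge_apply, extDeriv_one_apply hb, Matrix.cons_val, h3, h3n, hmul]
  linear_combination b y ![stdBasis 0] * hz (stdBasis 1) (stdBasis 2) (stdBasis 3) -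
    b y ![stdBasis 1] * hz (stdBasis 0) (stdBasis 2) (stdBasis 3) +
    b y ![stdBasis 2] * hz (stdBasis 0) (stdBasis 1) (stdBasis 3) -
    b y ![stdBasis 3] * hz (stdBasis 0) (stdBasis 1) (stdBasis 2)

theorem contDiffOn_wedgeField {s : Set R4} {b : R4 → R4 [⋀^Fin 1]→L[ℝ] ℝ}
    {w : R4 → R4 [⋀^Fin 2]→L[ℝ] ℝ} (hb : ContDiffOn ℝ ∞ b s) (hw : ContDiffOn ℝ ∞ w s) (k : Fin 4) :
    ContDiffOn ℝ ∞ (fun y => wedgeField (b y) (w y) k) s := by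
  have hb' := fun u => contDiffOn_alternating_iff.1 hb u
  have hw' := fun u => contDiffOn_alternating_iff.1 hw u
  have hm : ∀ u v, ContDiffOn ℝ ∞ (fun y => b y u * w y v) s := fun u v => (hb' u).mul (hw' v)
  fin_cases k
  exacts [((hm _ _).sub (hm _ _)).add (hm _ _), (((hm _ _).sub (hm _ _)).add (hm _ _)).neg,
    ((hm _ _).sub (hm _ _)).add (hm _ _), (((hm _ _).sub (hm _ _)).add (hm _ _)).neg]

theorem wedgeField_zero (w : R4 [⋀^Fin 2]→L[ℝ] ℝ) (k : Fin 4) :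
    wedgeField 0 w k = 0 := by
  have e : ∀ v, (0 : R4 [⋀^Fin 1]→L[ℝ] ℝ) v = 0 := fun _ => rfl
  fin_cases k <;> simp [wedgeField, e]

theorem integral_fderiv_eq_zero {f : R4 → ℝ} (hf : ContDiff ℝ 1 f) (hc : HasCompactSupport f)
    (v : R4) : ∫ y, fderiv ℝ f y v = 0 := by
  have h := integral_mul_fderiv_eq_neg_fderiv_mul_of_integrable (μ := volume)
    (f := fun _ : R4 => (1 : ℝ)) (g := f) (v := v) (by simp) ?_ ?_ ?_ ?_
  · simpa using h
  · have h1 : Continuous fun y => fderiv ℝ f y v :=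
      (hf.continuous_fderiv one_ne_zero).clm_apply continuous_const
    simpa using h1.integrable_of_hasCompactSupport (hc.fderiv_apply ℝ v)
  · simpa using hf.continuous.integrable_of_hasCompactSupport hc
  · exact fun x _ => differentiableAt_const _
  · exact fun x _ => hf.differentiable one_ne_zero x

end Divergence

section Stokes

variable {M : Type*} [TopologicalSpace M] [ChartedSpace R4 M] [IsManifold (𝓡 4) ∞ M]

/-- On the domain of a chart, the integrand of Stokes' theorem is a divergence, up to a sign that
records the orientation of the chart and is locally constant. -/
theorem Hyperkahler.abs_vol_mul_sd (h : Hyperkahler M) (x₀ : M) {b : DiffForm (𝓡 4) M ℝ 1}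
    (hb : b.IsSmooth) (i : Fin 3) {y : R4} (hy : y ∈ (extChartAt (𝓡 4) x₀).target) :
    |h.vol x₀ y| * h.sd ((extChartAt (𝓡 4) x₀).symm y)
        ((DiffForm.d b).at ((extChartAt (𝓡 4) x₀).symm y)) i =
      SignType.sign (h.vol x₀ y) * ∑ k, fderiv ℝ (fun y => wedgeField (b.inChart x₀ y)
        ((h.form i).inChart x₀ y) k) y (stdBasis k) := by
  rw [← wedge_extDeriv (hb.differentiableAt x₀ hy) ((h.form_isSmooth i).differentiableAt x₀ hy),
    ← h.sdInChart_eq x₀ hy, ← inChart_eq, inChart_d hb x₀ hy]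
  · have hv := h.vol_ne_zero x₀ hy
    change |h.vol x₀ y| * (_ / h.vol x₀ y) = _
    rw [← sign_mul_self (h.vol x₀ y), mul_assoc, mul_div_cancel₀ _ hv]
  · rw [← inChart_d (h.form_isSmooth i) x₀ hy, inChart_eq]
    have h0 : (DiffForm.d (h.form i)).at ((extChartAt (𝓡 4) x₀).symm y) = 0 := h.d_form i _
    rw [h0]; rfl

theorem Hyperkahler.sd_zero (h : Hyperkahler M) (x : M) : h.sd x 0 = 0 := by
  have e : ∀ v, (0 : R4 [⋀^Fin 2]→L[ℝ] ℝ) v = 0 := fun _ => rfl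
  funext i
  change wedge 0 _ _ / _ = 0
  simp [wedge_apply, e]

theorem Hyperkahler.sd_sum (h : Hyperkahler M) (x : M) {ι : Type*} (t : Finset ι)
    (q : ι → R4 [⋀^Fin 2]→L[ℝ] ℝ) : h.sd x (∑ j ∈ t, q j) = ∑ j ∈ t, h.sd x (q j) := by
  classical
  induction t using Finset.induction_on with
  | empty => exact h.sd_zero x
  | insert a t ha ih =>
    rw [Finset.sum_insert ha, Finset.sum_insert ha, ← ih]
    exact sdPart_add _ _ _

theorem continuous_of_extChartAt {f : M → ℝ}
    (hf : ∀ x₀ : M, ContinuousOn (fun y => f ((extChartAt (𝓡 4) x₀).symm y))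
      (extChartAt (𝓡 4) x₀).target) : Continuous f := by
  refine continuous_iff_continuousAt.2 fun x => ?_
  have h1 := ((hf x).continuousAt (extChartAt_target_mem_nhds x)).comp
    (continuousAt_extChartAt (I := 𝓡 4) x)
  refine h1.congr ?_
  filter_upwards [extChartAt_source_mem_nhds (I := 𝓡 4) x] with x' hx'
  rw [Function.comp_apply, (extChartAt (𝓡 4) x).left_inv hx']

theorem Hyperkahler.continuous_sd (h : Hyperkahler M) {q : DiffForm (𝓡 4) M ℝ 2}
    (hq : q.IsSmooth) (i : Fin 3) : Continuous fun x => h.sd x (q.at x) i := by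
  refine continuous_of_extChartAt fun x₀ => ?_
  have h1 := (contDiffOn_pi.1 (h.contDiffOn_sdInChart x₀ contDiffOn_id (fun _ hy => hy) (hq x₀))
    i).continuousOn
  refine h1.congr fun y hy => ?_
  rw [← h.sdInChart_eq x₀ hy, ← inChart_eq]
  rfl

variable [MeasurableSpace M] [BorelSpace M] [CompactSpace M]

/-- Stokes' theorem for a `1`-form supported in the domain of a chart. -/
theorem Hyperkahler.integral_sd_d_of_support [T2Space M] (h : Hyperkahler M) (x₀ : M)
    {b : DiffForm (𝓡 4) M ℝ 1} (hb : b.IsSmooth) {K : Set M} (hK : IsCompact K)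
    (hKs : K ⊆ (extChartAt (𝓡 4) x₀).source) (hbK : ∀ x ∉ K, b.at x = 0) (i : Fin 3) :
    ∫ x, h.sd x ((DiffForm.d b).at x) i ∂h.measure = 0 := by
  set T := (extChartAt (𝓡 4) x₀).target with hT
  have hTo : IsOpen T := isOpen_extChartAt_target x₀
  set c : Fin 4 → R4 → ℝ := fun k y => wedgeField (b.inChart x₀ y) ((h.form i).inChart x₀ y) k
    with hc
  set C : Fin 4 → R4 → ℝ := fun k => T.indicator fun y => SignType.sign (h.vol x₀ y) * c k y with hC
  set K' := extChartAt (𝓡 4) x₀ '' K with hK'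
  have hK'c : IsCompact K' := hK.image_of_continuousOn ((continuousOn_extChartAt x₀).mono hKs)
  have hK'T : K' ⊆ T := by
    rintro _ ⟨z, hz, rfl⟩; exact (extChartAt (𝓡 4) x₀).map_source (hKs hz)
  have hCK : ∀ k, ∀ y ∉ K', C k y = 0 := by
    intro k y hy
    by_cases hyT : y ∈ T
    · have h1 : (extChartAt (𝓡 4) x₀).symm y ∉ K := fun h1 =>
        hy ⟨_, h1, (extChartAt (𝓡 4) x₀).right_inv hyT⟩
      have h2 : b.inChart x₀ y = 0 := by rw [inChart_eq, hbK _ h1]; rfl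
      simp only [hC, indicator_of_mem hyT, hc, h2, wedgeField_zero, mul_zero]
    · simp only [hC, indicator_of_notMem hyT]
  have hloc : ∀ k, ∀ y ∈ T, C k =ᶠ[nhds y] fun y' => SignType.sign (h.vol x₀ y) * c k y' := by
    intro k y hy
    have hcont := (h.contDiffOn_vol x₀).continuousOn.continuousAt (hTo.mem_nhds hy)
    have h1 : ∀ᶠ y' in nhds y, SignType.sign (h.vol x₀ y') = SignType.sign (h.vol x₀ y) := by
      rcases lt_or_gt_of_ne (h.vol_ne_zero x₀ hy) with h0 | h0
      · filter_upwards [hcont.eventually (gt_mem_nhds h0)] with y' hy'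
        rw [sign_neg h0, sign_neg hy']
      · filter_upwards [hcont.eventually (lt_mem_nhds h0)] with y' hy'
        rw [sign_pos h0, sign_pos hy']
    filter_upwards [h1, hTo.mem_nhds hy] with y' hy' hy'T
    simp only [hC, indicator_of_mem hy'T, hy']
  have hoff : ∀ k, ∀ y ∉ K', C k =ᶠ[nhds y] fun _ => 0 := fun k y hy => by
    filter_upwards [hK'c.isClosed.isOpen_compl.mem_nhds hy] with y' hy' using hCK k y' hy'
  have hsm : ∀ k, ContDiff ℝ 1 (C k) := by
    intro k
    refine contDiff_iff_contDiffAt.2 fun y => ?_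
    by_cases hy : y ∈ K'
    · have h1 : ContDiffAt ℝ ∞ (c k) y := (contDiffOn_wedgeField (hb x₀) (h.form_isSmooth i x₀) k
        y (hK'T hy)).contDiffAt (hTo.mem_nhds (hK'T hy))
      exact ((contDiffAt_const.mul h1).congr_of_eventuallyEq (hloc k y (hK'T hy))).of_le (by simp)
    · exact contDiffAt_const.congr_of_eventuallyEq (hoff k y hy)
  have hcs : ∀ k, HasCompactSupport (C k) := fun k => HasCompactSupport.intro hK'c (hCK k)
  have hout : ∀ x ∉ (extChartAt (𝓡 4) x₀).source, h.sd x ((DiffForm.d b).at x) i = 0 := by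
    intro x hx
    have h1 : b.inChart x =ᶠ[nhds (extChartAt (𝓡 4) x x)] fun _ => 0 := by
      have h2 : ∀ᶠ x' in nhds ((extChartAt (𝓡 4) x).symm (extChartAt (𝓡 4) x x)), x' ∉ K := by
        rw [extChartAt_to_inv]
        exact hK.isClosed.isOpen_compl.mem_nhds fun h3 => hx (hKs h3)
      filter_upwards [(continuousAt_extChartAt_symm x).eventually h2] with y hy
      rw [inChart_eq, hbK _ hy]; rfl
    have h2 : (DiffForm.d b).at x = 0 := by
      rw [d_at, h1.extDeriv_eq]
      ext v
      rw [ContinuousAlternatingMap.compContinuousLinearMap_apply,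
        extDeriv_apply (differentiableAt_const _)]
      simp
    rw [h2, h.sd_zero]
    rfl
  rw [h.integral_eq_chart x₀ (h.continuous_sd hb.d i).measurable hout]
  have hpt : ∀ y ∈ T, |h.vol x₀ y| * h.sd ((extChartAt (𝓡 4) x₀).symm y)
      ((DiffForm.d b).at ((extChartAt (𝓡 4) x₀).symm y)) i =
      ∑ k, fderiv ℝ (C k) y (stdBasis k) := by
    intro y hy
    rw [h.abs_vol_mul_sd x₀ hb i hy, Finset.mul_sum]
    refine Finset.sum_congr rfl fun k _ => ?_
    have h1 : DifferentiableAt ℝ (c k) y := ((contDiffOn_wedgeField (hb x₀) (h.form_isSmooth i x₀) k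
        y hy).contDiffAt (hTo.mem_nhds hy)).differentiableAt (by simp)
    rw [(hloc k y hy).fderiv_eq, fderiv_const_mul h1]
    rfl
  rw [setIntegral_congr_fun (measurableSet_target x₀) hpt,
    setIntegral_eq_integral_of_forall_compl_eq_zero, integral_finsetSum]
  · exact Finset.sum_eq_zero fun k _ => integral_fderiv_eq_zero (hsm k) (hcs k) _
  · intro k _
    have h1 : Continuous fun y => fderiv ℝ (C k) y (stdBasis k) :=
      ((hsm k).continuous_fderiv one_ne_zero).clm_apply continuous_const
    exact h1.integrable_of_hasCompactSupport ((hcs k).fderiv_apply ℝ _)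
  · intro y hy
    refine Finset.sum_eq_zero fun k _ => ?_
    rw [(hoff k y fun h1 => hy (hK'T h1)).fderiv_eq]
    simp

/-- The product of a function and a form. -/
def DiffForm.smulFun {k : ℕ} (ρ : M → ℝ) (b : DiffForm (𝓡 4) M ℝ k) : DiffForm (𝓡 4) M ℝ k :=
  fun x => (ρ x • b.at x : R4 [⋀^Fin k]→L[ℝ] ℝ)

theorem inChart_smulFun {k : ℕ} (ρ : M → ℝ) (b : DiffForm (𝓡 4) M ℝ k) (x₀ : M) (y : R4) :
    (DiffForm.smulFun ρ b).inChart x₀ y = ρ ((extChartAt (𝓡 4) x₀).symm y) • b.inChart x₀ y := rfl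

theorem DiffForm.IsSmooth.smulFun {k : ℕ} {ρ : M → ℝ} (hρ : ContMDiff (𝓡 4) 𝓘(ℝ, ℝ) ∞ ρ)
    {b : DiffForm (𝓡 4) M ℝ k} (hb : b.IsSmooth) : (DiffForm.smulFun ρ b).IsSmooth := by
  intro x₀
  have h1 := (hρ.comp_contMDiffOn (contMDiffOn_extChartAt_symm x₀)).contDiffOn
  exact h1.smul (hb x₀)

/-- **Stokes' theorem**: as the forms `ω_i` are closed, the integral of `db ∧ ω_i` vanishes. -/
theorem Hyperkahler.integral_sd_d [T2Space M] (h : Hyperkahler M)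
    {b : DiffForm (𝓡 4) M ℝ 1} (hb : b.IsSmooth) (i : Fin 3) :
    ∫ x, h.sd x ((DiffForm.d b).at x) i ∂h.measure = 0 := by
  obtain ⟨ρ, hρ⟩ := SmoothPartitionOfUnity.exists_isSubordinate_chartAt_source (𝓡 4) M
  have hfin : {j | (Function.support (ρ j)).Nonempty}.Finite :=
    ρ.locallyFinite.finite_nonempty_of_compact
  set t := hfin.toFinset with ht
  have hsum : ∀ x, ∑ j ∈ t, ρ j x = 1 := by
    intro x
    rw [← ρ.sum_eq_one (mem_univ x), finsum_eq_sum_of_support_subset]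
    intro j hj
    simp only [ht, Finite.coe_toFinset, mem_ofPred_eq]
    exact ⟨x, hj⟩
  have hbs : ∀ j, (DiffForm.smulFun (ρ j) b).IsSmooth := fun j => hb.smulFun (ρ j).contMDiff
  have hd : ∀ x, (DiffForm.d b).at x = ∑ j ∈ t, (DiffForm.d (DiffForm.smulFun (ρ j) b)).at x := by
    intro x
    have h1 : b.inChart x = fun y => ∑ j ∈ t, (DiffForm.smulFun (ρ j) b).inChart x y := by
      funext y
      simp only [inChart_smulFun]
      rw [← Finset.sum_smul, hsum, one_smul]
    simp only [d_at]
    rw [h1, extDeriv,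
      fderiv_fun_sum fun j _ => (hbs j).differentiableAt x (mem_extChartAt_target x)]
    have h2 := map_sum (ContinuousAlternatingMap.alternatizeUncurryFinCLM ℝ R4 ℝ (n := 1))
      (fun j => fderiv ℝ ((DiffForm.smulFun (ρ j) b).inChart x) (extChartAt (𝓡 4) x x)) t
    have h3 := congrArg (fun q => q.compContinuousLinearMap (chartMap (𝓡 4) x x)) h2
    refine h3.trans ?_
    ext v
    simp only [ContinuousAlternatingMap.compContinuousLinearMap_apply,
      ContinuousAlternatingMap.sum_apply]
    rfl
  have hsd : ∀ x, h.sd x ((DiffForm.d b).at x) i =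
      ∑ j ∈ t, h.sd x ((DiffForm.d (DiffForm.smulFun (ρ j) b)).at x) i := by
    intro x
    rw [hd, h.sd_sum, Finset.sum_apply]
  simp only [hsd]
  rw [integral_finsetSum]
  · refine Finset.sum_eq_zero fun j _ => ?_
    refine h.integral_sd_d_of_support j (hbs j) (isClosed_tsupport (ρ j)).isCompact ?_ ?_ i
    · rw [extChartAt_source]; exact hρ j
    · intro x hx
      change ρ j x • b.at x = 0
      rw [image_eq_zero_of_notMem_tsupport hx, zero_smul]
  · intro j _
    exact (h.continuous_sd (hbs j).d i).integrable_of_hasCompactSupport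
      (HasCompactSupport.of_compactSpace _)

end Stokes

end

/-! ### Integrals depending on a parameter -/

section

open MeasureTheory Set

section Parameter

variable {M : Type*} [TopologicalSpace M] [ChartedSpace R4 M] [IsManifold (𝓡 4) ∞ M]

theorem one_le_infty : (1 : ℕ∞ω) ≤ ∞ :=
  WithTop.coe_le_coe.2 (le_top : (1 : ℕ∞) ≤ ⊤)

theorem prod_mem_nhds_target {U : Set ℂ} (hU : IsOpen U) (x₀ : M) {p : ℂ × R4}
    (hp : p ∈ U ×ˢ (extChartAt (𝓡 4) x₀).target) :
    U ×ˢ (extChartAt (𝓡 4) x₀).target ∈ nhds p :=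
  (hU.prod (isOpen_extChartAt_target x₀)).mem_nhds hp

section

variable {U : Set ℂ} (hU : IsOpen U) {H : ℂ → M → ℝ}
  (hH : ∀ x₀ : M, ContDiffOn ℝ 1 (fun p : ℂ × R4 => H p.1 ((extChartAt (𝓡 4) x₀).symm p.2))
    (U ×ˢ (extChartAt (𝓡 4) x₀).target))

include hU hH

theorem hasFDerivAt_left_of_chart (x₀ : M) {z : ℂ} (hz : z ∈ U) {y : R4}
    (hy : y ∈ (extChartAt (𝓡 4) x₀).target) :
    HasFDerivAt (fun z => H z ((extChartAt (𝓡 4) x₀).symm y))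
      ((fderiv ℝ (fun p : ℂ × R4 => H p.1 ((extChartAt (𝓡 4) x₀).symm p.2)) (z, y)).comp
        (ContinuousLinearMap.inl ℝ ℂ R4)) z := by
  have h1 := (((hH x₀) (z, y) ⟨hz, hy⟩).contDiffAt
    (prod_mem_nhds_target hU x₀ ⟨hz, hy⟩)).differentiableAt one_ne_zero
  exact HasFDerivAt.comp (f := fun z => (z, y)) z h1.hasFDerivAt (hasFDerivAt_prodMk_left z y)

theorem hasFDerivAt_left {z : ℂ} (hz : z ∈ U) (x : M) :
    HasFDerivAt (fun z => H z x) (fderiv ℝ (fun z => H z x) z) z := by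
  have h1 := hasFDerivAt_left_of_chart hU hH x hz (mem_extChartAt_target x)
  rw [extChartAt_to_inv] at h1
  exact h1.differentiableAt.hasFDerivAt

theorem continuousOn_fderiv_left :
    ContinuousOn (fun p : ℂ × M => fderiv ℝ (fun z => H z p.2) p.1) (U ×ˢ univ) := by
  rintro ⟨z, x⟩ ⟨hz, -⟩
  refine ContinuousAt.continuousWithinAt ?_
  have h1 : ContinuousAt (fun p : ℂ × R4 => (fderiv ℝ (fun p : ℂ × R4 =>
      H p.1 ((extChartAt (𝓡 4) x).symm p.2)) p).comp (ContinuousLinearMap.inl ℝ ℂ R4))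
      (z, extChartAt (𝓡 4) x x) :=
    (((hH x).continuousOn_fderiv_of_isOpen (hU.prod (isOpen_extChartAt_target x))
      le_rfl).continuousAt
      (prod_mem_nhds_target hU x ⟨hz, mem_extChartAt_target x⟩)).clm_comp continuousAt_const
  have h2 : ContinuousAt (fun p : ℂ × M => (p.1, extChartAt (𝓡 4) x p.2)) (z, x) :=
    continuousAt_fst.prodMk
      (ContinuousAt.comp (x := (z, x)) (f := Prod.snd) (continuousAt_extChartAt (I := 𝓡 4) x)
        continuousAt_snd)
  refine (ContinuousAt.comp (f := fun p : ℂ × M => (p.1, extChartAt (𝓡 4) x p.2)) h1 h2).congr ?_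
  have h3 : U ×ˢ (extChartAt (𝓡 4) x).source ∈ nhds (z, x) :=
    (hU.prod (isOpen_extChartAt_source x)).mem_nhds ⟨hz, mem_extChartAt_source x⟩
  filter_upwards [h3] with p hp
  have h4 := hasFDerivAt_left_of_chart hU hH x hp.1 ((extChartAt (𝓡 4) x).map_source hp.2)
  rw [(extChartAt (𝓡 4) x).left_inv hp.2] at h4
  exact h4.fderiv.symm

theorem continuous_right {z : ℂ} (hz : z ∈ U) : Continuous (H z) :=
  continuous_of_extChartAt fun x₀ =>
    (hH x₀).continuousOn.comp (continuousOn_const.prodMk continuousOn_id) fun _ hy => ⟨hz, hy⟩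

variable [MeasurableSpace M] [BorelSpace M] [CompactSpace M] (μ : Measure M) [IsFiniteMeasure μ]

/-- Differentiation under the integral sign. -/
theorem hasFDerivAt_integral {z : ℂ} (hz : z ∈ U) :
    HasFDerivAt (fun z => ∫ x, H z x ∂μ) (∫ x, fderiv ℝ (fun z => H z x) z ∂μ) z ∧
      Integrable (fun x => fderiv ℝ (fun z => H z x) z) μ := by
  obtain ⟨r, hr, hrU⟩ := Metric.nhds_basis_closedBall.mem_iff.1 (hU.mem_nhds hz)
  have hc := continuousOn_fderiv_left hU hH
  obtain ⟨C, hC⟩ := ((isCompact_closedBall z r).prod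
    (isCompact_univ (X := M))).exists_bound_of_continuousOn (hc.mono (prod_mono hrU subset_rfl))
  have hcont : Continuous fun x => fderiv ℝ (fun z => H z x) z :=
    continuousOn_univ.1 (hc.comp (continuousOn_const.prodMk continuousOn_id) fun x _ =>
      ⟨hz, trivial⟩)
  have hint := hcont.integrable_of_hasCompactSupport (μ := μ) (HasCompactSupport.of_compactSpace _)
  refine ⟨?_, hint⟩
  refine hasFDerivAt_integral_of_dominated_of_fderiv_le (bound := fun _ => C)
    (F' := fun z x => fderiv ℝ (fun z => H z x) z)
    (Metric.closedBall_mem_nhds z hr) ?_ ?_ hint.aestronglyMeasurable ?_ (integrable_const C) ?_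
  · filter_upwards [hU.mem_nhds hz] with z' hz'
    exact (continuous_right hU hH hz').measurable.aestronglyMeasurable
  · exact (continuous_right hU hH hz).integrable_of_hasCompactSupport
      (HasCompactSupport.of_compactSpace _)
  · exact Filter.Eventually.of_forall fun x z' hz' => hC (z', x) ⟨hz', trivial⟩
  · exact Filter.Eventually.of_forall fun x z' hz' => hasFDerivAt_left hU hH (hrU hz') x

end

/-- A family of forms depending smoothly on a parameter in `U`. -/
def IsSmoothFamily {k : ℕ} (U : Set ℂ) (W : ℂ → DiffForm (𝓡 4) M ℝ k) : Prop :=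
  ∀ x₀ : M, ContDiffOn ℝ ∞ (fun p : ℂ × R4 => (W p.1).inChart x₀ p.2)
    (U ×ˢ (extChartAt (𝓡 4) x₀).target)

theorem IsSmoothFamily.isSmooth {k : ℕ} {U : Set ℂ} {W : ℂ → DiffForm (𝓡 4) M ℝ k}
    (hW : IsSmoothFamily U W) {z : ℂ} (hz : z ∈ U) : (W z).IsSmooth := fun x₀ =>
  (hW x₀).comp (contDiff_prodMk_right z).contDiffOn fun _ hy => ⟨hz, hy⟩

theorem IsSmoothFamily.contDiffOn_sd {U : Set ℂ} {W : ℂ → DiffForm (𝓡 4) M ℝ 2}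
    (hW : IsSmoothFamily U W) (h : Hyperkahler M) (i : Fin 3) (x₀ : M) :
    ContDiffOn ℝ ∞ (fun p : ℂ × R4 => h.sd ((extChartAt (𝓡 4) x₀).symm p.2)
      ((W p.1).at ((extChartAt (𝓡 4) x₀).symm p.2)) i) (U ×ˢ (extChartAt (𝓡 4) x₀).target) := by
  have h1 := contDiffOn_pi.1 (h.contDiffOn_sdInChart x₀ contDiffOn_snd (fun _ hp => hp.2) (hW x₀)) i
  refine h1.congr fun p hp => ?_
  rw [← h.sdInChart_eq x₀ hp.2, ← inChart_eq]

theorem IsSmoothFamily.differentiableAt {k : ℕ} {U : Set ℂ} (hU : IsOpen U)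
    {W : ℂ → DiffForm (𝓡 4) M ℝ k} (hW : IsSmoothFamily U W) {z : ℂ} (hz : z ∈ U) (x : M) :
    DifferentiableAt ℝ (fun z => (W z).inChart x (extChartAt (𝓡 4) x x)) z := by
  have h1 := (((hW x) (z, extChartAt (𝓡 4) x x) ⟨hz, mem_extChartAt_target x⟩).contDiffAt
    (prod_mem_nhds_target hU x ⟨hz, mem_extChartAt_target x⟩)).differentiableAt (by simp)
  exact DifferentiableAt.comp (f := fun z => (z, extChartAt (𝓡 4) x x)) z h1
    (hasFDerivAt_prodMk_left z _).differentiableAt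

/-- The derivative of a family of forms with respect to the parameter. -/
def paramDeriv {k : ℕ} (W : ℂ → DiffForm (𝓡 4) M ℝ k) (z u : ℂ) (x : M) : R4 [⋀^Fin k]→L[ℝ] ℝ :=
  (fderiv ℝ (fun z => (W z).inChart x (extChartAt (𝓡 4) x x)) z u).compContinuousLinearMap
    (chartMap (𝓡 4) x x)

/-- A component of `h.sd x` as a continuous linear map. -/
def Hyperkahler.sdLin (h : Hyperkahler M) (x : M) (i : Fin 3) :
    (R4 [⋀^Fin 2]→L[ℝ] ℝ) →L[ℝ] ℝ where
  toFun q := h.sd x q i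
  map_add' q r := congrFun (sdPart_add _ q r) i
  map_smul' t q := congrFun (sdPart_smul _ t q) i
  cont := by
    have e : ∀ v, Continuous fun q : R4 [⋀^Fin 2]→L[ℝ] ℝ => q v := fun v =>
      continuous_eval_const v
    refine Continuous.div_const ?_ _
    simp only [wedge_apply]
    exact ((((((e _).mul_const _).sub ((e _).mul_const _)).add ((e _).mul_const _)).add
      ((e _).mul_const _)).sub ((e _).mul_const _)).add ((e _).mul_const _)

theorem IsSmoothFamily.fderiv_sd {U : Set ℂ} (hU : IsOpen U)
    {W : ℂ → DiffForm (𝓡 4) M ℝ 2} (hW : IsSmoothFamily U W) (h : Hyperkahler M) (i : Fin 3)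
    {z : ℂ} (hz : z ∈ U) (x : M) (u : ℂ) :
    fderiv ℝ (fun z => h.sd x ((W z).at x) i) z u = h.sd x (paramDeriv W z u x) i := by
  set L : (R4 [⋀^Fin 2]→L[ℝ] ℝ) →L[ℝ] ℝ :=
    (h.sdLin x i).comp (ContinuousAlternatingMap.compContinuousLinearMapCLM
      (ι := Fin 2) (𝕜 := ℝ) (F := ℝ) (chartMap (𝓡 4) x x)) with hL
  have h1 : (fun z => h.sd x ((W z).at x) i) =
      fun z => L ((W z).inChart x (extChartAt (𝓡 4) x x)) := by
    funext z
    rw [at_eq_inChart (W z) x (mem_extChartAt_source x)]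
    rfl
  rw [h1, fderiv_fun_comp _ L.differentiableAt (hW.differentiableAt hU hz x)]
  rw [ContinuousLinearMap.fderiv]
  rfl

variable [MeasurableSpace M] [BorelSpace M] [CompactSpace M] [T2Space M]

/-- The integral of the wedge products of a family of `2`-forms with the fundamental forms. -/
def Hyperkahler.integralSd (h : Hyperkahler M) (W : ℂ → DiffForm (𝓡 4) M ℝ 2) (z : ℂ) :
    Fin 3 → ℝ := fun i => ∫ x, h.sd x ((W z).at x) i ∂h.measure

/-- Integrals of a smooth family of `2`-forms are differentiated under the integral sign. -/
theorem Hyperkahler.hasFDerivAt_integralSd (h : Hyperkahler M) {U : Set ℂ} (hU : IsOpen U)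
    {W : ℂ → DiffForm (𝓡 4) M ℝ 2} (hW : IsSmoothFamily U W) {z : ℂ} (hz : z ∈ U) :
    DifferentiableAt ℝ (h.integralSd W) z ∧ ∀ u i, fderiv ℝ (h.integralSd W) z u i =
      ∫ x, h.sd x (paramDeriv W z u x) i ∂h.measure ∧
      Integrable (fun x => h.sd x (paramDeriv W z u x) i) h.measure := by
  have h1 := fun i => hasFDerivAt_integral hU (H := fun z x => h.sd x ((W z).at x) i)
    (fun x₀ => (hW.contDiffOn_sd h i x₀).of_le one_le_infty) h.measure hz
  have hd : HasFDerivAt (h.integralSd W) _ z := hasFDerivAt_pi.2 fun i => (h1 i).1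
  refine ⟨hd.differentiableAt, fun u i => ⟨?_, ?_⟩⟩
  swap
  · exact ((h1 i).2.apply_continuousLinearMap u).congr
      (Filter.Eventually.of_forall fun x => hW.fderiv_sd hU h i hz x u)
  rw [hd.fderiv, ContinuousLinearMap.pi_apply, ContinuousLinearMap.integral_apply (h1 i).2]
  exact integral_congr_ae (Filter.Eventually.of_forall fun x => hW.fderiv_sd hU h i hz x u)

end Parameter

end

/-! ### Forms on the product of a domain in the plane and a 4-manifold -/

section

open MeasureTheory Set

section Mixed

variable {M : Type*} [TopologicalSpace M] [ChartedSpace R4 M] [IsManifold (𝓡 4) ∞ M] {k : ℕ}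

variable (M) in
/-- Forms on `ℂ × M`, without regularity. -/
abbrev MixedForm (k : ℕ) : Type _ := ℂ → M → (ℂ × R4) [⋀^Fin k]→L[ℝ] ℝ

/-- The coordinate expression of a form on `ℂ × M` in the chart of `M` around `x₀`. -/
def mixedChart (w : MixedForm M k) (x₀ : M) (p : ℂ × R4) : (ℂ × R4) [⋀^Fin k]→L[ℝ] ℝ :=
  (w p.1 ((extChartAt (𝓡 4) x₀).symm p.2)).compContinuousLinearMap
    ((ContinuousLinearMap.id ℝ ℂ).prodMap (chartInv (𝓡 4) x₀ p.2))

/-- Smoothness on `U × M`. -/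
def IsSmoothMixed (U : Set ℂ) (w : MixedForm M k) : Prop :=
  ∀ x₀ : M, ContDiffOn ℝ ∞ (mixedChart w x₀) (U ×ˢ (extChartAt (𝓡 4) x₀).target)

/-- `w'` is the exterior derivative of `w` over `U × M`. -/
def IsMixedD (U : Set ℂ) (w : MixedForm M k) (w' : MixedForm M (k + 1)) : Prop :=
  ∀ x₀ : M, ∀ p ∈ U ×ˢ (extChartAt (𝓡 4) x₀).target,
    mixedChart w' x₀ p = extDeriv (mixedChart w x₀) p

/-- The restrictions of a form to the slices `{z} × M`. -/
def slice (w : MixedForm M k) (z : ℂ) : DiffForm (𝓡 4) M ℝ k := fun x =>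
  (w z x).compContinuousLinearMap (ContinuousLinearMap.inr ℝ ℂ R4)

/-- The contraction of a form with a constant vector field of `ℂ`. -/
def contract (u : ℂ) (w : MixedForm M (k + 1)) : MixedForm M k := fun z x =>
  (w z x).curryLeft (u, 0)

theorem inChart_slice (w : MixedForm M k) (z : ℂ) (x₀ : M) (y : R4) :
    (slice w z).inChart x₀ y = (mixedChart w x₀ (z, y)).compContinuousLinearMap
      (ContinuousLinearMap.inr ℝ ℂ R4) := by
  ext v
  rw [inChart_eq, mixedChart]
  simp only [ContinuousAlternatingMap.compContinuousLinearMap_apply]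
  change w z _ _ = w z _ _
  congr 1

theorem mixedChart_contract (u : ℂ) (w : MixedForm M (k + 1)) (x₀ : M) (p : ℂ × R4) :
    mixedChart (contract u w) x₀ p = (mixedChart w x₀ p).curryLeft (u, 0) := by
  ext v
  simp only [mixedChart, contract, ContinuousAlternatingMap.compContinuousLinearMap_apply,
    ContinuousAlternatingMap.curryLeft_apply_apply]
  congr 1
  funext i
  refine Fin.cases ?_ (fun j => ?_) i
  · exact Prod.ext rfl (map_zero (chartInv (𝓡 4) x₀ p.2)).symm
  · rfl

theorem IsSmoothMixed.contract {U : Set ℂ} {w : MixedForm M (k + 1)} (hw : IsSmoothMixed U w)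
    (u : ℂ) : IsSmoothMixed U (contract u w) := fun x₀ =>
  (ContDiffOn.clm_apply (contDiff_curryLeft.comp_contDiffOn (hw x₀)) contDiffOn_const).congr
    fun p _ => mixedChart_contract u w x₀ p

theorem IsSmoothMixed.slice {U : Set ℂ} {w : MixedForm M k} (hw : IsSmoothMixed U w) :
    IsSmoothFamily U (slice w) := fun x₀ =>
  (contDiffOn_compContinuousLinearMap (hw x₀) contDiffOn_const).congr
    fun p _ => inChart_slice w p.1 x₀ p.2

theorem IsSmoothMixed.differentiableAt {U : Set ℂ} (hU : IsOpen U) {w : MixedForm M k}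
    (hw : IsSmoothMixed U w) (x₀ : M) {p : ℂ × R4} (hp : p ∈ U ×ˢ (extChartAt (𝓡 4) x₀).target) :
    DifferentiableAt ℝ (mixedChart w x₀) p :=
  ((hw x₀ p hp).contDiffAt (prod_mem_nhds_target hU x₀ hp)).differentiableAt (by simp)

/-- The base point in the chart around `x`. -/
abbrev basePoint (z : ℂ) (x : M) : ℂ × R4 := (z, extChartAt (𝓡 4) x x)

theorem basePoint_mem {U : Set ℂ} {z : ℂ} (hz : z ∈ U) (x : M) :
    basePoint z x ∈ U ×ˢ (extChartAt (𝓡 4) x).target := ⟨hz, mem_extChartAt_target x⟩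

/-- The inclusion of the tangent space of a slice, in coordinates around `x`. -/
def sliceMap (x : M) : R4 →L[ℝ] ℂ × R4 :=
  (ContinuousLinearMap.inr ℝ ℂ R4).comp (chartMap (𝓡 4) x x)

theorem slice_at (w : MixedForm M k) (z : ℂ) (x : M) :
    (slice w z).at x =
      (mixedChart w x (basePoint z x)).compContinuousLinearMap (sliceMap x) := by
  rw [at_eq_inChart _ x (mem_extChartAt_source x), inChart_slice]
  rfl

theorem d_slice_at {U : Set ℂ} (hU : IsOpen U) {w : MixedForm M k}
    (hw : IsSmoothMixed U w) {z : ℂ} (hz : z ∈ U) (x : M) :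
    (DiffForm.d (slice w z)).at x =
      (extDeriv (mixedChart w x) (basePoint z x)).compContinuousLinearMap (sliceMap x) := by
  rw [d_at]
  have h1 : (slice w z).inChart x = fun y => (mixedChart w x (z, y)).compContinuousLinearMap
      (ContinuousLinearMap.inr ℝ ℂ R4) := funext fun y => inChart_slice w z x y
  rw [h1, ← extDeriv_comp_inr (hw.differentiableAt hU x (basePoint_mem hz x))]
  rfl

theorem paramDeriv_slice {U : Set ℂ} (hU : IsOpen U) {w : MixedForm M k}
    (hw : IsSmoothMixed U w) {z : ℂ} (hz : z ∈ U) (x : M) (u : ℂ) :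
    paramDeriv (slice w) z u x = (fderiv ℝ (mixedChart w x) (basePoint z x)
      (u, 0)).compContinuousLinearMap (sliceMap x) := by
  have h1 : (fun z => (slice w z).inChart x (extChartAt (𝓡 4) x x)) = fun z =>
      ContinuousAlternatingMap.compContinuousLinearMapCLM (ι := Fin k) (𝕜 := ℝ) (F := ℝ)
        (ContinuousLinearMap.inr ℝ ℂ R4) (mixedChart w x (basePoint z x)) :=
    funext fun z => inChart_slice w z x _
  have h2 := (hw.differentiableAt hU x (basePoint_mem hz x)).hasFDerivAt
  have h3 := HasFDerivAt.comp (f := fun z => basePoint z x) z h2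
    (hasFDerivAt_prodMk_left z (extChartAt (𝓡 4) x x))
  have h4 := (ContinuousAlternatingMap.compContinuousLinearMapCLM (ι := Fin k) (𝕜 := ℝ) (F := ℝ)
        (ContinuousLinearMap.inr ℝ ℂ R4)).hasFDerivAt.comp z h3
  rw [paramDeriv, h1]
  have h5 := h4.fderiv
  rw [show fderiv ℝ (fun z => ContinuousAlternatingMap.compContinuousLinearMapCLM (ι := Fin k)
    (𝕜 := ℝ) (F := ℝ) (ContinuousLinearMap.inr ℝ ℂ R4) (mixedChart w x (basePoint z x))) z = _
    from h5]
  rfl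

/-- Cartan's formula for the contraction of an exterior derivative with one horizontal vector. -/
theorem slice_contract_d {U : Set ℂ} (hU : IsOpen U) {w : MixedForm M (k + 1)}
    {w' : MixedForm M (k + 2)} (hw : IsSmoothMixed U w) (hw' : IsMixedD U w w') {z : ℂ}
    (hz : z ∈ U) (u : ℂ) (x : M) :
    (slice (contract u w') z).at x =
      paramDeriv (slice w) z u x - (DiffForm.d (slice (contract u w) z)).at x := by
  have hp := basePoint_mem hz x
  rw [slice_at, paramDeriv_slice hU hw hz, d_slice_at hU (hw.contract u) hz, mixedChart_contract,
    hw' x _ hp, curryLeft_extDeriv (hw.differentiableAt hU x hp),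
    show mixedChart (contract u w) x = fun p => (mixedChart w x p).curryLeft (u, 0)
      from funext fun p => mixedChart_contract u w x p]
  rfl

/-- Cartan's formula for the contraction of an exterior derivative with two horizontal vectors. -/
theorem slice_contract_contract_d {U : Set ℂ} (hU : IsOpen U) {w : MixedForm M (k + 2)}
    {w' : MixedForm M (k + 3)} (hw : IsSmoothMixed U w) (hw' : IsMixedD U w w') {z : ℂ}
    (hz : z ∈ U) (u v : ℂ) (x : M) :
    (slice (contract v (contract u w')) z).at x =
      paramDeriv (slice (contract v w)) z u x - paramDeriv (slice (contract u w)) z v x +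
        (DiffForm.d (slice (contract v (contract u w)) z)).at x := by
  have hp := basePoint_mem hz x
  have hd := hw.differentiableAt hU x hp
  have hdu := (hw.contract u).differentiableAt hU x hp
  have hfu : ∀ u, mixedChart (contract u w) x = fun p => (mixedChart w x p).curryLeft (u, 0) :=
    fun u => funext fun p => mixedChart_contract u w x p
  have hfuv : mixedChart (contract v (contract u w)) x =
      fun p => (mixedChart (contract u w) x p).curryLeft (v, 0) :=
    funext fun p => mixedChart_contract v _ x p
  -- derivatives commute with the contraction with a constant vector
  have hder : fderiv ℝ (mixedChart (contract v w) x) (basePoint z x) (u, 0) =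
      (fderiv ℝ (mixedChart w x) (basePoint z x) (u, 0)).curryLeft (v, 0) := by
    rw [hfu v]
    set L : (ℂ × R4) [⋀^Fin (k + 2)]→L[ℝ] ℝ →L[ℝ] (ℂ × R4) [⋀^Fin (k + 1)]→L[ℝ] ℝ :=
      IsBoundedLinearMap.toContinuousLinearMap (f := fun q => q.curryLeft (v, 0))
        ⟨⟨fun _ _ => rfl, fun _ _ => rfl⟩, ‖((v, 0) : ℂ × R4)‖ + 1, by positivity, fun q => by
          refine ((q.curryLeft).le_opNorm _).trans ?_
          rw [ContinuousAlternatingMap.norm_curryLeft, mul_comm]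
          gcongr
          linarith⟩ with hL
    have h1 := (L.hasFDerivAt.comp (basePoint z x) hd.hasFDerivAt).fderiv
    exact congrArg (fun T => T (u, 0)) h1
  rw [slice_at, mixedChart_contract, mixedChart_contract, hw' x _ hp, curryLeft_extDeriv hd,
    ← hfu u, paramDeriv_slice hU (hw.contract v) hz, paramDeriv_slice hU (hw.contract u) hz,
    d_slice_at hU ((hw.contract u).contract v) hz, hfuv, hder]
  have h2 := curryLeft_extDeriv hdu (v, 0)
  have h3 : extDeriv (fun p => (mixedChart (contract u w) x p).curryLeft (v, 0)) (basePoint z x) =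
      fderiv ℝ (mixedChart (contract u w) x) (basePoint z x) (v, 0) -
        (extDeriv (mixedChart (contract u w) x) (basePoint z x)).curryLeft (v, 0) := by
    rw [h2]; abel
  rw [h3]
  ext m
  simp only [ContinuousAlternatingMap.compContinuousLinearMap_apply,
    ContinuousAlternatingMap.add_apply, ContinuousAlternatingMap.sub_apply]
  rw [show ∀ a b : (ℂ × R4) [⋀^Fin (k + 2)]→L[ℝ] ℝ, (a - b).curryLeft (v, 0) =
    a.curryLeft (v, 0) - b.curryLeft (v, 0) from fun _ _ => rfl,
    ContinuousAlternatingMap.sub_apply]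
  ring

variable [MeasurableSpace M] [BorelSpace M] [CompactSpace M] [T2Space M]

theorem IsSmoothFamily.integrable_sd {U : Set ℂ} {W : ℂ → DiffForm (𝓡 4) M ℝ 2}
    (hW : IsSmoothFamily U W) (h : Hyperkahler M) {z : ℂ} (hz : z ∈ U) (i : Fin 3) :
    Integrable (fun x => h.sd x ((W z).at x) i) h.measure :=
  (h.continuous_sd (hW.isSmooth hz) i).integrable_of_hasCompactSupport
    (HasCompactSupport.of_compactSpace _)

theorem DiffForm.IsSmooth.integrable_sd_d {b : DiffForm (𝓡 4) M ℝ 1} (hb : b.IsSmooth)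
    (h : Hyperkahler M) (i : Fin 3) :
    Integrable (fun x => h.sd x ((DiffForm.d b).at x) i) h.measure :=
  (h.continuous_sd hb.d i).integrable_of_hasCompactSupport (HasCompactSupport.of_compactSpace _)

/-- The integrals of the contractions of an exterior derivative with one horizontal vector are
derivatives of integrals. -/
theorem Hyperkahler.integralSd_contract_d (h : Hyperkahler M) {U : Set ℂ} (hU : IsOpen U)
    {w : MixedForm M 2} {w' : MixedForm M 3} (hw : IsSmoothMixed U w) (hw' : IsMixedD U w w')
    {z : ℂ} (hz : z ∈ U) (u : ℂ) :
    h.integralSd (slice (contract u w')) z = fderiv ℝ (h.integralSd (slice w)) z u := by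
  funext i
  have h1 := (h.hasFDerivAt_integralSd hU hw.slice hz).2 u i
  have hb : (slice (contract u w) z).IsSmooth := (hw.contract u).slice.isSmooth hz
  have e : ∀ x, h.sd x ((slice (contract u w') z).at x) i = h.sd x (paramDeriv (slice w) z u x) i -
      h.sd x ((DiffForm.d (slice (contract u w) z)).at x) i := fun x => by
    rw [slice_contract_d hU hw hw' hz]
    exact map_sub (h.sdLin x i) _ _
  rw [h1.1, Hyperkahler.integralSd, integral_congr_ae (Filter.Eventually.of_forall e),
    integral_sub h1.2 (hb.integrable_sd_d h i), h.integral_sd_d hb, sub_zero]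

/-- The integral of the contraction of an exterior derivative with two horizontal vectors. -/
theorem Hyperkahler.integralSd_contract_contract_d (h : Hyperkahler M) {U : Set ℂ} (hU : IsOpen U)
    {w : MixedForm M 3} {w' : MixedForm M 4} (hw : IsSmoothMixed U w) (hw' : IsMixedD U w w')
    {z : ℂ} (hz : z ∈ U) (u v : ℂ) :
    h.integralSd (slice (contract v (contract u w'))) z =
      fderiv ℝ (h.integralSd (slice (contract v w))) z u -
        fderiv ℝ (h.integralSd (slice (contract u w))) z v := by
  funext i
  have h1 := (h.hasFDerivAt_integralSd hU (hw.contract v).slice hz).2 u i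
  have h2 := (h.hasFDerivAt_integralSd hU (hw.contract u).slice hz).2 v i
  have hb : (slice (contract v (contract u w)) z).IsSmooth :=
    ((hw.contract u).contract v).slice.isSmooth hz
  have e : ∀ x, h.sd x ((slice (contract v (contract u w')) z).at x) i =
      h.sd x (paramDeriv (slice (contract v w)) z u x) i -
      h.sd x (paramDeriv (slice (contract u w)) z v x) i +
      h.sd x ((DiffForm.d (slice (contract v (contract u w)) z)).at x) i := fun x => by
    rw [slice_contract_contract_d hU hw hw' hz]
    exact (map_add (h.sdLin x i) _ _).trans (congrArg₂ (· + ·) (map_sub (h.sdLin x i) _ _) rfl)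
  have h12 : Integrable (fun x => h.sd x (paramDeriv (slice (contract v w)) z u x) i -
      h.sd x (paramDeriv (slice (contract u w)) z v x) i) h.measure := h1.2.sub h2.2
  rw [Pi.sub_apply, h1.1, h2.1, Hyperkahler.integralSd,
    integral_congr_ae (Filter.Eventually.of_forall e),
    integral_add h12 (hb.integrable_sd_d h i), integral_sub h1.2 h2.2,
    h.integral_sd_d hb, add_zero]

end Mixed

end

/-! ### Charts of the product of a Riemann surface and a 4-manifold -/

section

open Set

section ProductCharts

theorem chartInv_eq_fderiv {E : Type*} [NormedAddCommGroup E] [NormedSpace ℝ E]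
    {H : Type*} [TopologicalSpace H] {I : ModelWithCorners ℝ E H} [I.Boundaryless]
    {X : Type*} [TopologicalSpace X] [ChartedSpace H X] [IsManifold I ∞ X] (x₀ : X) {y : E}
    (hy : y ∈ (extChartAt I x₀).target) : chartInv I x₀ y =
      fderiv ℝ (extChartAt I ((extChartAt I x₀).symm y) ∘ (extChartAt I x₀).symm) y := by
  have : IsManifold I 1 X := IsManifold.of_le (n := ∞) (by simp)
  have h1 : chartMap I ((extChartAt I x₀).symm y) ((extChartAt I x₀).symm y) =
      ContinuousLinearMap.id ℝ E := mfderiv_extChartAt_self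
  rw [fderiv_transition x₀ _ hy (mem_extChartAt_source _), h1, ContinuousLinearMap.id_comp]

variable {S : Type*} [TopologicalSpace S] [ChartedSpace ℂ S] [IsManifold 𝓘(ℂ) ω S]

/-- A Riemann surface is a smooth real manifold. -/
instance isManifold_real : IsManifold 𝓘(ℝ, ℂ) ∞ S := by
  refine isManifold_of_contDiffOn _ _ _ fun e e' he he' => ?_
  have h1 := (mem_groupoid_of_pregroupoid.1
    (HasGroupoid.compatible (G := contDiffGroupoid ω 𝓘(ℂ)) he he')).1
  exact (ContDiffOn.restrict_scalars ℝ h1).of_le le_top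

/-- As the transition maps of a Riemann surface are holomorphic, the derivatives of its charts are
complex linear. -/
theorem chartInv_mulI (s₀ : S) {z : ℂ} (hz : z ∈ (extChartAt 𝓘(ℝ, ℂ) s₀).target) (u : ℂ) :
    chartInv 𝓘(ℝ, ℂ) s₀ z (mulI u) = mulI (chartInv 𝓘(ℝ, ℂ) s₀ z u) := by
  rw [chartInv_eq_fderiv s₀ hz]
  set s₁ := (extChartAt 𝓘(ℝ, ℂ) s₀).symm z
  have h2 : DifferentiableAt ℂ (extChartAt 𝓘(ℂ) s₁ ∘ (extChartAt 𝓘(ℂ) s₀).symm) z := by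
    have h := contDiffWithinAt_ext_coord_change (I := 𝓘(ℂ)) (n := ω) s₁ s₀ (y := z)
      (by rw [PartialEquiv.trans_source]; exact ⟨hz, mem_extChartAt_source _⟩)
    rw [𝓘(ℂ).range_eq_univ, contDiffWithinAt_univ] at h
    exact h.differentiableAt (by simp)
  have h3 : fderiv ℝ (extChartAt 𝓘(ℝ, ℂ) s₁ ∘ (extChartAt 𝓘(ℝ, ℂ) s₀).symm) z = _ :=
    (h2.hasFDerivAt.restrictScalars ℝ).fderiv
  rw [h3]
  exact (fderiv ℂ (extChartAt 𝓘(ℂ) s₁ ∘ (extChartAt 𝓘(ℂ) s₀).symm) z).map_smul Complex.I u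

variable {M : Type*} [TopologicalSpace M] [ChartedSpace R4 M] [IsManifold (𝓡 4) ∞ M] {k : ℕ}

theorem target_prod (s₀ : S) (x₀ : M) : (extChartAt modelX (s₀, x₀)).target =
    (extChartAt 𝓘(ℝ, ℂ) s₀).target ×ˢ (extChartAt (𝓡 4) x₀).target := by
  rw [extChartAt_prod]; rfl

theorem symm_prod (s₀ : S) (x₀ : M) (p : ℂ × R4) : (extChartAt modelX (s₀, x₀)).symm p =
    ((extChartAt 𝓘(ℝ, ℂ) s₀).symm p.1, (extChartAt (𝓡 4) x₀).symm p.2) := by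
  rw [extChartAt_prod]; rfl

/-- The charts of the product are products of charts. -/
theorem chartInv_prod (s₀ : S) (x₀ : M) {p : ℂ × R4}
    (hp : p ∈ (extChartAt modelX (s₀, x₀)).target) : chartInv modelX (s₀, x₀) p =
      (chartInv 𝓘(ℝ, ℂ) s₀ p.1).prodMap (chartInv (𝓡 4) x₀ p.2) := by
  have hp' := hp
  rw [target_prod] at hp'
  rw [chartInv_eq_fderiv _ hp, chartInv_eq_fderiv s₀ hp'.1, chartInv_eq_fderiv x₀ hp'.2]
  have h1 := ((contDiffAt_transition s₀ _ hp'.1 (mem_extChartAt_source _)).differentiableAt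
    (by simp)).hasFDerivAt
  have h2 := ((contDiffAt_transition x₀ _ hp'.2 (mem_extChartAt_source _)).differentiableAt
    (by simp)).hasFDerivAt
  have h3 := (HasFDerivAt.prodMap p h1 h2).fderiv
  rw [← h3]
  congr 1

/-- A form on `S × M` over the domain of a chart of `S`, regarded as a form on `ℂ × M`. -/
def toMixed (s₀ : S) (η : DiffForm modelX (S × M) ℝ k) : MixedForm M k := fun z x =>
  (η.at ((extChartAt 𝓘(ℝ, ℂ) s₀).symm z, x)).compContinuousLinearMap
    ((chartInv 𝓘(ℝ, ℂ) s₀ z).prodMap (ContinuousLinearMap.id ℝ R4))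

theorem mixedChart_toMixed (s₀ : S) (η : DiffForm modelX (S × M) ℝ k) (x₀ : M) {p : ℂ × R4}
    (hp : p ∈ (extChartAt 𝓘(ℝ, ℂ) s₀).target ×ˢ (extChartAt (𝓡 4) x₀).target) :
    mixedChart (toMixed s₀ η) x₀ p = η.inChart (s₀, x₀) p := by
  rw [inChart_eq, chartInv_prod s₀ x₀ (by rwa [target_prod]), symm_prod]
  rfl

theorem DiffForm.IsSmooth.toMixed {η : DiffForm modelX (S × M) ℝ k} (hη : η.IsSmooth) (s₀ : S) :
    IsSmoothMixed (extChartAt 𝓘(ℝ, ℂ) s₀).target (toMixed s₀ η) := fun x₀ => by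
  have h1 := hη (s₀, x₀)
  rw [target_prod] at h1
  exact h1.congr fun p hp => mixedChart_toMixed s₀ η x₀ hp

theorem isMixedD_toMixed {η : DiffForm modelX (S × M) ℝ k} (hη : η.IsSmooth) (s₀ : S) :
    IsMixedD (extChartAt 𝓘(ℝ, ℂ) s₀).target (toMixed s₀ η) (toMixed s₀ (DiffForm.d η)) := by
  intro x₀ p hp
  rw [mixedChart_toMixed s₀ _ x₀ hp, inChart_d hη (s₀, x₀) (by rwa [target_prod])]
  have h1 : mixedChart (toMixed s₀ η) x₀ =ᶠ[nhds p] η.inChart (s₀, x₀) := by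
    filter_upwards [prod_mem_nhds_target (isOpen_extChartAt_target s₀) x₀ hp] with q hq
    exact mixedChart_toMixed s₀ η x₀ hq
  exact h1.extDeriv_eq.symm

/-- The point of the unit sphere belonging to `φ`, in a chart of `S`. -/
def sphereMap (φ : S → CP1) (s₀ : S) (z : ℂ) : Fin 3 → ℝ :=
  sphereCoord (φ ((extChartAt 𝓘(ℝ, ℂ) s₀).symm z))

/-- The complex structure of `S × M`, in a chart of `S`. -/
def mixedStructure (φ : S → CP1) (h : Hyperkahler M) (s₀ : S) (z : ℂ) (x : M) :
    ℂ × R4 →L[ℝ] ℂ × R4 :=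
  mulI.prodMap (IsHyperTriple.combo (h.I x) (h.J x) (h.K x) (sphereMap φ s₀ z))

theorem mixedStructure_comm (φ : S → CP1) (h : Hyperkahler M) (s₀ : S) {z : ℂ}
    (hz : z ∈ (extChartAt 𝓘(ℝ, ℂ) s₀).target) (x : M) (v : ℂ × R4) :
    (chartInv 𝓘(ℝ, ℂ) s₀ z).prodMap (ContinuousLinearMap.id ℝ R4) (mixedStructure φ h s₀ z x v) =
      complexStructure φ h ((extChartAt 𝓘(ℝ, ℂ) s₀).symm z, x)
        ((chartInv 𝓘(ℝ, ℂ) s₀ z).prodMap (ContinuousLinearMap.id ℝ R4) v) :=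
  Prod.ext (chartInv_mulI s₀ hz v.1) rfl

/-- The complex structure of `S × M` in a chart. -/
def structureInChart (φ : S → CP1) (h : Hyperkahler M) (s₀ : S) (x₀ : M) (p : ℂ × R4) :
    ℂ × R4 →L[ℝ] ℂ × R4 :=
  mulI.prodMap (IsHyperTriple.combo (endInChart h.I x₀ p.2) (endInChart h.J x₀ p.2)
    (endInChart h.K x₀ p.2) (sphereMap φ s₀ p.1))

theorem chartInv_endInChart (A : EndField (𝓡 4) M) (x₀ : M) {y : R4}
    (hy : y ∈ (extChartAt (𝓡 4) x₀).target) (v : R4) :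
    chartInv (𝓡 4) x₀ y (endInChart A x₀ y v) =
      A ((extChartAt (𝓡 4) x₀).symm y) (chartInv (𝓡 4) x₀ y v) := by
  have h1 := chartInv_chartMap x₀ ((extChartAt (𝓡 4) x₀).map_target hy)
    (A ((extChartAt (𝓡 4) x₀).symm y) (chartInv (𝓡 4) x₀ y v))
  rw [(extChartAt (𝓡 4) x₀).right_inv hy] at h1
  exact h1

theorem combo_comm {I J K I' J' K' : R4 →L[ℝ] R4} (f : R4 →L[ℝ] R4)
    (hI : ∀ v, f (I' v) = I (f v)) (hJ : ∀ v, f (J' v) = J (f v)) (hK : ∀ v, f (K' v) = K (f v))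
    (a : Fin 3 → ℝ) (v : R4) :
    f (IsHyperTriple.combo I' J' K' a v) = IsHyperTriple.combo I J K a (f v) := by
  rw [IsHyperTriple.combo_apply, IsHyperTriple.combo_apply, map_add, map_add, map_smul, map_smul,
    map_smul, hI, hJ, hK]

theorem chartInv_combo (h : Hyperkahler M) (x₀ : M) {y : R4}
    (hy : y ∈ (extChartAt (𝓡 4) x₀).target) (a : Fin 3 → ℝ) (v : R4) :
    chartInv (𝓡 4) x₀ y (IsHyperTriple.combo (endInChart h.I x₀ y) (endInChart h.J x₀ y)
      (endInChart h.K x₀ y) a v) =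
    IsHyperTriple.combo (h.I ((extChartAt (𝓡 4) x₀).symm y)) (h.J ((extChartAt (𝓡 4) x₀).symm y))
      (h.K ((extChartAt (𝓡 4) x₀).symm y)) a (chartInv (𝓡 4) x₀ y v) := by
  exact combo_comm _ (chartInv_endInChart h.I x₀ hy) (chartInv_endInChart h.J x₀ hy)
    (chartInv_endInChart h.K x₀ hy) a v

theorem structureInChart_comm (φ : S → CP1) (h : Hyperkahler M) (s₀ : S) (x₀ : M) {p : ℂ × R4}
    (hp : p ∈ (extChartAt modelX (s₀, x₀)).target) (v : ℂ × R4) :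
    chartInv modelX (s₀, x₀) p (structureInChart φ h s₀ x₀ p v) =
      complexStructure φ h ((extChartAt modelX (s₀, x₀)).symm p)
        (chartInv modelX (s₀, x₀) p v) := by
  have hp' := hp
  rw [target_prod] at hp'
  rw [chartInv_prod s₀ x₀ hp, symm_prod]
  exact Prod.ext (chartInv_mulI s₀ hp'.1 v.1) (chartInv_combo h x₀ hp'.2 _ v.2)

theorem contDiffOn_structureInChart {φ : S → CP1} (h : Hyperkahler M) (s₀ : S) (x₀ : M)
    (hφ : ContDiffOn ℝ ∞ (sphereMap φ s₀) (extChartAt 𝓘(ℝ, ℂ) s₀).target) :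
    ContDiffOn ℝ ∞ (structureInChart φ h s₀ x₀) (extChartAt modelX (s₀, x₀)).target := by
  rw [target_prod]
  have ha := fun i => contDiffOn_pi.1 (hφ.comp contDiffOn_fst (fun p hp => hp.1 :
    MapsTo _ ((extChartAt 𝓘(ℝ, ℂ) s₀).target ×ˢ (extChartAt (𝓡 4) x₀).target) _)) i
  have hE : ∀ {A : EndField (𝓡 4) M}, IsCompatible h.g A → ContDiffOn ℝ ∞
      (fun p : ℂ × R4 => endInChart A x₀ p.2)
      ((extChartAt 𝓘(ℝ, ℂ) s₀).target ×ˢ (extChartAt (𝓡 4) x₀).target) := fun hA =>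
    (contDiffOn_endInChart hA x₀).comp contDiffOn_snd fun p hp => hp.2
  have h1 := (((ha 0).smul (hE h.kahler_I.compatible)).add
    ((ha 1).smul (hE h.kahler_J.compatible))).add ((ha 2).smul (hE h.kahler_K.compatible))
  refine contDiffOn_clm_apply.2 fun v => ?_
  exact contDiffOn_const.prodMk (h1.clm_apply contDiffOn_const)

end ProductCharts

end

/-! ### Holomorphic maps to the sphere -/

section

open Set

section SphereCalculus

theorem sphereVec_eq (v : Fin 2 → ℂ) : sphereVec v =
    ![((v 0).re ^ 2 + (v 0).im ^ 2 - ((v 1).re ^ 2 + (v 1).im ^ 2)) /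
        ((v 0).re ^ 2 + (v 0).im ^ 2 + ((v 1).re ^ 2 + (v 1).im ^ 2)),
      2 * ((v 1).re * (v 0).re + (v 1).im * (v 0).im) /
        ((v 0).re ^ 2 + (v 0).im ^ 2 + ((v 1).re ^ 2 + (v 1).im ^ 2)),
      2 * ((v 1).im * (v 0).re - (v 1).re * (v 0).im) /
        ((v 0).re ^ 2 + (v 0).im ^ 2 + ((v 1).re ^ 2 + (v 1).im ^ 2))] := by
  funext i
  fin_cases i <;> simp [sphereVec, Complex.normSq_apply, sq]
  ring

theorem normSq_add_pos {v : Fin 2 → ℂ} (hv : v ≠ 0) :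
    0 < (v 0).re ^ 2 + (v 0).im ^ 2 + ((v 1).re ^ 2 + (v 1).im ^ 2) := by
  by_contra hn
  refine hv (funext fun i => Complex.ext ?_ ?_) <;>
    (fin_cases i <;> simp only [Fin.zero_eta, Fin.mk_one, Pi.zero_apply, Complex.zero_re,
      Complex.zero_im] <;> nlinarith [sq_nonneg (v 0).re, sq_nonneg (v 0).im, sq_nonneg (v 1).re,
      sq_nonneg (v 1).im])

/-- The derivative of `sphereVec` at `v` in the direction `w`. -/
def dSphere (v w : Fin 2 → ℂ) : Fin 3 → ℝ :=
  let N := (v 0).re ^ 2 + (v 0).im ^ 2 + ((v 1).re ^ 2 + (v 1).im ^ 2)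
  let N' := 2 * ((v 0).re * (w 0).re + (v 0).im * (w 0).im +
    ((v 1).re * (w 1).re + (v 1).im * (w 1).im))
  ![(2 * ((v 0).re * (w 0).re + (v 0).im * (w 0).im -
        ((v 1).re * (w 1).re + (v 1).im * (w 1).im)) * N -
      ((v 0).re ^ 2 + (v 0).im ^ 2 - ((v 1).re ^ 2 + (v 1).im ^ 2)) * N') / N ^ 2,
    (2 * ((w 1).re * (v 0).re + (v 1).re * (w 0).re + ((w 1).im * (v 0).im +
        (v 1).im * (w 0).im)) * N -
      2 * ((v 1).re * (v 0).re + (v 1).im * (v 0).im) * N') / N ^ 2,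
    (2 * ((w 1).im * (v 0).re + (v 1).im * (w 0).re - ((w 1).re * (v 0).im +
        (v 1).re * (w 0).im)) * N -
      2 * ((v 1).im * (v 0).re - (v 1).re * (v 0).im) * N') / N ^ 2]

theorem sphereVec_dotProduct_self {v : Fin 2 → ℂ} (hv : v ≠ 0) :
    sphereVec v ⬝ᵥ sphereVec v = 1 := by
  have hN := (normSq_add_pos hv).ne'
  rw [sphereVec_eq, dotProduct, Fin.sum_univ_three]
  simp only [Matrix.cons_val]
  field_simp
  ring

/-- The map `sphereVec` is compatible with the complex structures. -/
theorem dSphere_I_smul {v : Fin 2 → ℂ} (hv : v ≠ 0) (w : Fin 2 → ℂ) :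
    dSphere v (Complex.I • w) = crossProduct (sphereVec v) (dSphere v w) := by
  have hN := (normSq_add_pos hv).ne'
  rw [sphereVec_eq, cross_apply]
  simp only [dSphere, Matrix.cons_val, Pi.smul_apply, smul_eq_mul, Complex.mul_re, Complex.mul_im,
    Complex.I_re, Complex.I_im, zero_mul, one_mul, zero_sub, zero_add]
  funext i
  fin_cases i <;> simp only [Matrix.cons_val, Fin.zero_eta, Fin.mk_one, Fin.reduceFinMk] <;>
    field_simp <;> ring

/-- The differential of `sphereVec` is conformal, and its kernel is described by a Wronskian. -/
theorem dSphere_dotProduct_self {v : Fin 2 → ℂ} (hv : v ≠ 0) (w : Fin 2 → ℂ) :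
    dSphere v w ⬝ᵥ dSphere v w = 4 * Complex.normSq (v 0 * w 1 - v 1 * w 0) /
      ((v 0).re ^ 2 + (v 0).im ^ 2 + ((v 1).re ^ 2 + (v 1).im ^ 2)) ^ 2 := by
  have hN := (normSq_add_pos hv).ne'
  rw [dotProduct, Fin.sum_univ_three]
  simp only [dSphere, Matrix.cons_val, Complex.normSq_apply, Complex.sub_re, Complex.sub_im,
    Complex.mul_re, Complex.mul_im]
  field_simp
  ring

theorem sphereVec_dotProduct_dSphere {v : Fin 2 → ℂ} (hv : v ≠ 0) (w : Fin 2 → ℂ) :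
    sphereVec v ⬝ᵥ dSphere v w = 0 := by
  have hN := (normSq_add_pos hv).ne'
  rw [sphereVec_eq, dotProduct, Fin.sum_univ_three]
  simp only [dSphere, Matrix.cons_val]
  field_simp
  ring

theorem mul_eq_mul_of_sphereVec_eq {v w : Fin 2 → ℂ} (hv : v ≠ 0) (hw : w ≠ 0)
    (h : sphereVec v = sphereVec w) : v 0 * w 1 = v 1 * w 0 := by
  have hN := (normSq_add_pos hv).ne'
  have hN' := (normSq_add_pos hw).ne'
  have h1 : sphereVec v ⬝ᵥ sphereVec w = 1 := by rw [h, sphereVec_dotProduct_self hw]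
  have h2 : Complex.normSq (v 0 * w 1 - v 1 * w 0) = 0 := by
    rw [sphereVec_eq, sphereVec_eq, dotProduct, Fin.sum_univ_three] at h1
    simp only [Matrix.cons_val] at h1
    field_simp at h1
    simp only [Complex.normSq_apply, Complex.sub_re, Complex.sub_im, Complex.mul_re, Complex.mul_im]
    linear_combination (-1 / 2) * h1
  exact sub_eq_zero.1 (Complex.normSq_eq_zero.1 h2)

theorem sphereCoord_mk' (v : Fin 2 → ℂ) (hv : v ≠ 0) :
    sphereCoord (Projectivization.mk ℂ v hv) = sphereVec v := by
  rw [sphereCoord, Projectivization.lift_mk]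

theorem sphereCoord_dotProduct_self (p : CP1) : sphereCoord p ⬝ᵥ sphereCoord p = 1 := by
  induction p using Projectivization.ind with | h v hv => ?_
  rw [sphereCoord_mk', sphereVec_dotProduct_self hv]

theorem sphereCoord_injective : Function.Injective sphereCoord := by
  intro p q
  induction p using Projectivization.ind with | h v hv => ?_
  induction q using Projectivization.ind with | h w hw => ?_
  intro h
  rw [sphereCoord_mk', sphereCoord_mk'] at h
  have h1 := mul_eq_mul_of_sphereVec_eq hv hw h
  rw [Projectivization.mk_eq_mk_iff']
  by_cases h0 : w 0 = 0
  · have hw1 : w 1 ≠ 0 := fun h2 => hw (by funext i; fin_cases i <;> assumption)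
    have hv0 : v 0 = 0 := by
      rw [h0, mul_zero] at h1
      exact (mul_eq_zero.1 h1).resolve_right hw1
    refine ⟨v 1 / w 1, funext fun i => ?_⟩
    fin_cases i
    · simp [h0, hv0]
    · simp [hw1]
  · refine ⟨v 0 / w 0, funext fun i => ?_⟩
    fin_cases i
    · simp [h0]
    · simp only [Fin.mk_one, Pi.smul_apply, smul_eq_mul]
      rw [div_mul_eq_mul_div, h1, mul_div_cancel_right₀ _ h0]

variable {v : ℂ → Fin 2 → ℂ}

theorem contDiffOn_sphereVec {V : Set ℂ} (hV : IsOpen V) (hv : DifferentiableOn ℂ v V)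
    (h0 : ∀ z ∈ V, v z ≠ 0) : ContDiffOn ℝ ∞ (fun z => sphereVec (v z)) V := by
  have h1 : ContDiffOn ℝ ∞ v V := (hv.contDiffOn hV).restrict_scalars ℝ
  have hre : ∀ i, ContDiffOn ℝ ∞ (fun z => (v z i).re) V := fun i =>
    Complex.reCLM.contDiff.comp_contDiffOn (contDiffOn_pi.1 h1 i)
  have him : ∀ i, ContDiffOn ℝ ∞ (fun z => (v z i).im) V := fun i =>
    Complex.imCLM.contDiff.comp_contDiffOn (contDiffOn_pi.1 h1 i)
  simp only [sphereVec_eq]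
  have hN : ContDiffOn ℝ ∞ (fun z => (v z 0).re ^ 2 + (v z 0).im ^ 2 + ((v z 1).re ^ 2 +
      (v z 1).im ^ 2)) V :=
    (((hre 0).pow 2).add ((him 0).pow 2)).add (((hre 1).pow 2).add ((him 1).pow 2))
  have hne : ∀ z ∈ V, (v z 0).re ^ 2 + (v z 0).im ^ 2 + ((v z 1).re ^ 2 +
      (v z 1).im ^ 2) ≠ 0 := fun z hz => (normSq_add_pos (h0 z hz)).ne'
  refine contDiffOn_pi.2 fun i => ?_
  fin_cases i
  · exact ((((hre 0).pow 2).add ((him 0).pow 2)).sub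
      (((hre 1).pow 2).add ((him 1).pow 2))).div hN hne
  · exact (contDiffOn_const.mul (((hre 1).mul (hre 0)).add ((him 1).mul (him 0)))).div hN hne
  · exact (contDiffOn_const.mul (((him 1).mul (hre 0)).sub ((hre 1).mul (him 0)))).div hN hne

theorem fderiv_sphereVec {z : ℂ} (hv : DifferentiableAt ℂ v z) (h0 : v z ≠ 0)
    (hd : DifferentiableAt ℝ (fun z => sphereVec (v z)) z) (u : ℂ) :
    fderiv ℝ (fun z => sphereVec (v z)) z u = dSphere (v z) (u • deriv v z) := by
  -- restrict to the line `t ↦ z + t u`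
  have hl : HasDerivAt (fun t : ℝ => z + t • u) u 0 := by
    simpa using ((hasDerivAt_id (0 : ℝ)).smul_const u).const_add z
  have hl0 : z + (0 : ℝ) • u = z := by simp
  have h1 : HasDerivAt (fun t : ℝ => v (z + t • u)) (u • deriv v z) 0 := by
    have h2 : HasFDerivAt v (fderiv ℂ v z) (z + (0 : ℝ) • u) := by rw [hl0]; exact hv.hasFDerivAt
    have h3 := (h2.restrictScalars ℝ).comp_hasDerivAt (0 : ℝ) hl
    refine h3.congr_deriv ?_
    change fderiv ℂ v z u = u • fderiv ℂ v z 1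
    rw [← map_smul, smul_eq_mul, mul_one]
  have hre : ∀ i, HasDerivAt (fun t : ℝ => (v (z + t • u) i).re) ((u • deriv v z) i).re 0 := by
    intro i
    exact Complex.reCLM.hasFDerivAt.comp_hasDerivAt (0 : ℝ) (hasDerivAt_pi.1 h1 i)
  have him : ∀ i, HasDerivAt (fun t : ℝ => (v (z + t • u) i).im) ((u • deriv v z) i).im 0 := by
    intro i
    exact Complex.imCLM.hasFDerivAt.comp_hasDerivAt (0 : ℝ) (hasDerivAt_pi.1 h1 i)
  have h4 : HasDerivAt (fun t : ℝ => sphereVec (v (z + t • u)))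
      (fderiv ℝ (fun z => sphereVec (v z)) z u) 0 := by
    have h2 : HasFDerivAt (fun z => sphereVec (v z)) (fderiv ℝ (fun z => sphereVec (v z)) z)
      (z + (0 : ℝ) • u) := by rw [hl0]; exact hd.hasFDerivAt
    exact h2.comp_hasDerivAt (0 : ℝ) hl
  refine h4.unique ?_
  have hne := (normSq_add_pos h0).ne'
  set w := u • deriv v z with hw
  simp only [sphereVec_eq]
  have hN := (((hre 0).fun_pow 2).fun_add ((him 0).fun_pow 2)).fun_add
    (((hre 1).fun_pow 2).fun_add ((him 1).fun_pow 2))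
  refine hasDerivAt_pi.2 fun i => ?_
  fin_cases i
  · refine ((((((hre 0).fun_pow 2).fun_add ((him 0).fun_pow 2)).fun_sub
      (((hre 1).fun_pow 2).fun_add ((him 1).fun_pow 2))).fun_div hN (by rwa [hl0]))).congr_deriv ?_
    simp only [hl0, dSphere, Fin.zero_eta, Matrix.cons_val]
    norm_num
    ring
  · refine (((((hre 1).fun_mul (hre 0)).fun_add ((him 1).fun_mul (him 0))).const_mul 2).fun_div
      hN (by rwa [hl0])).congr_deriv ?_
    simp only [hl0, dSphere, Fin.mk_one, Matrix.cons_val]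
    norm_num
    ring
  · refine (((((him 1).fun_mul (hre 0)).fun_sub ((hre 1).fun_mul (him 0))).const_mul 2).fun_div
      hN (by rwa [hl0])).congr_deriv ?_
    simp only [hl0, dSphere, Fin.reduceFinMk, Matrix.cons_val]
    norm_num
    ring

end SphereCalculus

end

/-! ### The map to the sphere on a Riemann surface -/

section

open Set Filter Topology

section SphereMap

variable {S : Type*} [TopologicalSpace S] [ChartedSpace ℂ S] [IsManifold 𝓘(ℂ) ω S]
  {φ : S → CP1}

/-- Local holomorphic homogeneous coordinates of `φ`. -/
theorem IsHolomorphic.exists_lift (hφ : IsHolomorphic φ) (s₀ : S) {z₀ : ℂ}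
    (hz₀ : z₀ ∈ (extChartAt 𝓘(ℝ, ℂ) s₀).target) :
    ∃ r > 0, Metric.ball z₀ r ⊆ (extChartAt 𝓘(ℝ, ℂ) s₀).target ∧ ∃ v : ℂ → Fin 2 → ℂ,
      DifferentiableOn ℂ v (Metric.ball z₀ r) ∧ ∀ z ∈ Metric.ball z₀ r, v z ≠ 0 ∧
        sphereMap φ s₀ z = sphereVec (v z) := by
  obtain ⟨U, hU, hsU, v, hv, hvφ⟩ := hφ ((extChartAt 𝓘(ℝ, ℂ) s₀).symm z₀)
  have h1 : ∀ᶠ z in 𝓝 z₀, z ∈ (extChartAt 𝓘(ℝ, ℂ) s₀).target ∧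
      (extChartAt 𝓘(ℝ, ℂ) s₀).symm z ∈ U :=
    Eventually.and (extChartAt_target_mem_nhds' hz₀)
      ((continuousAt_extChartAt_symm'' hz₀).eventually (hU.mem_nhds hsU))
  obtain ⟨r, hr, hrs⟩ := Metric.eventually_nhds_iff_ball.1 h1
  refine ⟨r, hr, fun z hz => (hrs z hz).1, v ∘ (extChartAt 𝓘(ℂ) s₀).symm, ?_, fun z hz => ?_⟩
  · have : IsManifold 𝓘(ℂ) 1 S := IsManifold.of_le (n := ω) le_top
    rw [← mdifferentiableOn_iff_differentiableOn]
    exact hv.comp ((mdifferentiableOn_extChartAt_symm (I := 𝓘(ℂ)) (x := s₀)).mono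
      fun z hz => (hrs z hz).1) fun z hz => (hrs z hz).2
  · obtain ⟨h0, h2⟩ := hvφ _ (hrs z hz).2
    refine ⟨h0, ?_⟩
    rw [sphereMap, h2, sphereCoord_mk']
    rfl

theorem IsHolomorphic.contDiffOn_sphereMap (hφ : IsHolomorphic φ) (s₀ : S) :
    ContDiffOn ℝ ∞ (sphereMap φ s₀) (extChartAt 𝓘(ℝ, ℂ) s₀).target := by
  intro z₀ hz₀
  obtain ⟨r, hr, -, v, hv, h0⟩ := hφ.exists_lift s₀ hz₀
  have h1 := (contDiffOn_sphereVec Metric.isOpen_ball hv fun z hz => (h0 z hz).1).congr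
    fun z hz => (h0 z hz).2
  exact (h1.contDiffAt (Metric.ball_mem_nhds z₀ hr)).contDiffWithinAt

theorem IsHolomorphic.differentiableAt_sphereMap (hφ : IsHolomorphic φ) (s₀ : S) {z : ℂ}
    (hz : z ∈ (extChartAt 𝓘(ℝ, ℂ) s₀).target) : DifferentiableAt ℝ (sphereMap φ s₀) z :=
  ((hφ.contDiffOn_sphereMap s₀ z hz).contDiffAt (extChartAt_target_mem_nhds' hz)).differentiableAt
    (by simp)

theorem sphereMap_dotProduct_self (φ : S → CP1) (s₀ : S) (z : ℂ) :
    sphereMap φ s₀ z ⬝ᵥ sphereMap φ s₀ z = 1 :=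
  sphereCoord_dotProduct_self _

theorem IsHolomorphic.fderiv_sphereMap (hφ : IsHolomorphic φ) (s₀ : S) {z₀ : ℂ}
    (hz₀ : z₀ ∈ (extChartAt 𝓘(ℝ, ℂ) s₀).target) :
    ∃ r > 0, Metric.ball z₀ r ⊆ (extChartAt 𝓘(ℝ, ℂ) s₀).target ∧ ∃ v : ℂ → Fin 2 → ℂ,
      DifferentiableOn ℂ v (Metric.ball z₀ r) ∧ ∀ z ∈ Metric.ball z₀ r, v z ≠ 0 ∧
        sphereMap φ s₀ z = sphereVec (v z) ∧
        ∀ u, fderiv ℝ (sphereMap φ s₀) z u = dSphere (v z) (u • deriv v z) := by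
  obtain ⟨r, hr, hrt, v, hv, h0⟩ := hφ.exists_lift s₀ hz₀
  refine ⟨r, hr, hrt, v, hv, fun z hz => ⟨(h0 z hz).1, (h0 z hz).2, fun u => ?_⟩⟩
  have hn := Metric.isOpen_ball.mem_nhds hz
  have he : sphereMap φ s₀ =ᶠ[𝓝 z] fun z => sphereVec (v z) := by
    filter_upwards [hn] with z' hz' using (h0 z' hz').2
  have hd := he.differentiableAt_iff.1 (hφ.differentiableAt_sphereMap s₀ (hrt hz))
  rw [he.fderiv_eq, fderiv_sphereVec (hv.differentiableAt hn) (h0 z hz).1 hd]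

/-- The Cauchy–Riemann equations for a holomorphic map to the sphere. -/
theorem IsHolomorphic.fderiv_sphereMap_I (hφ : IsHolomorphic φ) (s₀ : S) {z : ℂ}
    (hz : z ∈ (extChartAt 𝓘(ℝ, ℂ) s₀).target) (u : ℂ) :
    fderiv ℝ (sphereMap φ s₀) z (Complex.I * u) =
      crossProduct (sphereMap φ s₀ z) (fderiv ℝ (sphereMap φ s₀) z u) := by
  obtain ⟨r, hr, -, v, -, h⟩ := hφ.fderiv_sphereMap s₀ hz
  obtain ⟨h0, h1, h2⟩ := h z (Metric.mem_ball_self hr)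
  rw [h2, h2, h1, ← dSphere_I_smul h0, smul_smul]

theorem IsHolomorphic.sphereMap_dotProduct_fderiv (hφ : IsHolomorphic φ) (s₀ : S) {z : ℂ}
    (hz : z ∈ (extChartAt 𝓘(ℝ, ℂ) s₀).target) (u : ℂ) :
    sphereMap φ s₀ z ⬝ᵥ fderiv ℝ (sphereMap φ s₀) z u = 0 := by
  obtain ⟨r, hr, -, v, -, h⟩ := hφ.fderiv_sphereMap s₀ hz
  obtain ⟨h0, h1, h2⟩ := h z (Metric.mem_ball_self hr)
  rw [h2, h1, sphereVec_dotProduct_dSphere h0]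

/-- Near each point, a holomorphic map to the sphere is constant or has isolated critical points. -/
theorem IsHolomorphic.eventually_const_or (hφ : IsHolomorphic φ) (s₀ : S) :
    (∀ᶠ s in 𝓝 s₀, φ s = φ s₀) ∨
      ∀ᶠ z in 𝓝[≠] (extChartAt 𝓘(ℝ, ℂ) s₀ s₀), fderiv ℝ (sphereMap φ s₀) z 1 ≠ 0 := by
  set z₀ := extChartAt 𝓘(ℝ, ℂ) s₀ s₀ with hz₀
  obtain ⟨r, hr, hrt, v, hv, h⟩ := hφ.fderiv_sphereMap s₀ (mem_extChartAt_target s₀)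
  -- the critical points are the zeros of the Wronskian of the homogeneous coordinates
  set W : ℂ → ℂ := fun z => v z 0 * deriv v z 1 - v z 1 * deriv v z 0 with hW
  have hWd : DifferentiableOn ℂ W (Metric.ball z₀ r) := by
    have h1 := differentiableOn_pi.1 hv
    have h2 := differentiableOn_pi.1 (hv.deriv Metric.isOpen_ball)
    exact ((h1 0).mul (h2 1)).sub ((h1 1).mul (h2 0))
  have hWa : AnalyticAt ℂ W z₀ := hWd.analyticAt (Metric.ball_mem_nhds z₀ hr)
  have hsq : ∀ z ∈ Metric.ball z₀ r, ∀ u, fderiv ℝ (sphereMap φ s₀) z u = 0 ↔ u * W z = 0 := by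
    intro z hz u
    obtain ⟨h0, -, h2⟩ := h z hz
    rw [h2, ← dotProduct_self_eq_zero, dSphere_dotProduct_self h0,
      div_eq_zero_iff, or_iff_left (pow_ne_zero 2 (normSq_add_pos h0).ne'), mul_eq_zero,
      or_iff_right (by norm_num), Complex.normSq_eq_zero]
    simp only [hW, Pi.smul_apply, smul_eq_mul]
    rw [show v z 0 * (u * deriv v z 1) - v z 1 * (u * deriv v z 0) =
      u * (v z 0 * deriv v z 1 - v z 1 * deriv v z 0) by ring]
  rcases hWa.eventually_eq_zero_or_eventually_ne_zero with h0 | h0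
  · left
    obtain ⟨ρ, hρ, hρs⟩ := Metric.eventually_nhds_iff_ball.1 (h0.and (Metric.ball_mem_nhds z₀ hr))
    have hconst : ∀ z ∈ Metric.ball z₀ ρ, sphereMap φ s₀ z = sphereMap φ s₀ z₀ := by
      intro z hz
      refine (convex_ball z₀ ρ).is_const_of_fderivWithin_eq_zero (𝕜 := ℝ) (fun y hy =>
        (hφ.differentiableAt_sphereMap s₀ (hrt (hρs y hy).2)).differentiableWithinAt) ?_ hz
        (Metric.mem_ball_self hρ)
      intro y hy
      rw [fderivWithin_of_isOpen Metric.isOpen_ball hy]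
      ext1 u
      rw [(hsq y (hρs y hy).2 u).2 (by rw [(hρs y hy).1, mul_zero])]
      rfl
    filter_upwards [extChartAt_source_mem_nhds (I := 𝓘(ℝ, ℂ)) s₀,
      (continuousAt_extChartAt (I := 𝓘(ℝ, ℂ)) s₀).eventually (Metric.ball_mem_nhds z₀ hρ)]
      with s hs hsb
    have h1 := sphereCoord_injective (hconst _ hsb)
    rw [(extChartAt 𝓘(ℝ, ℂ) s₀).left_inv hs, hz₀, extChartAt_to_inv] at h1
    exact h1
  · right
    filter_upwards [h0, mem_nhdsWithin_of_mem_nhds (Metric.ball_mem_nhds z₀ hr)] with z hz hzb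
    rw [Ne, hsq z hzb, one_mul]
    exact hz

end SphereMap

end

/-! ### Consequences of the pluriclosed condition -/

section

open Set Filter Topology

section Pluriclosed

theorem typePart_zero {V : Type*} [AddCommGroup V] [Module ℝ V] [TopologicalSpace V] {k : ℕ}
    (J : V →L[ℝ] V) (p : ℕ) : typePart J p (0 : V [⋀^Fin k]→L[ℝ] ℂ) = 0 := by
  ext v
  rw [typePart_apply, alternating_zero_apply]
  exact Finset.sum_eq_zero fun T _ => by rw [alternating_zero_apply, mul_zero]

section General

variable {E : Type*} [NormedAddCommGroup E] [NormedSpace ℝ E]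
  {H : Type*} [TopologicalSpace H] {I : ModelWithCorners ℝ E H}
  {X : Type*} [TopologicalSpace X] [ChartedSpace H X] {k : ℕ}

theorem d_eq_zero (η : DiffForm I X ℂ k) (hη : ∀ x, η.at x = 0) (x : X) :
    (DiffForm.d η).at x = 0 := by
  have h1 : η.inChart x = fun _ => 0 := by
    funext y
    rw [inChart_eq, hη]
    rfl
  rw [d_at, h1]
  ext v
  rw [ContinuousAlternatingMap.compContinuousLinearMap_apply,
    extDeriv_apply (differentiableAt_const _)]
  simp

/-- Fields of endomorphisms, with the tangent spaces identified with the model space. -/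
def EndField.at (J : EndField I X) (x : X) : E →L[ℝ] E := J x

theorem d_congr {η η' : DiffForm I X ℂ k} (h : ∀ x, η.at x = η'.at x) (x : X) :
    (DiffForm.d η).at x = (DiffForm.d η').at x := by
  rw [show η = η' from funext h]

/-- The component of type `(p, k - p)` of a complex-valued `k`-form. -/
def DiffForm.typeForm (J : EndField I X) (p : ℕ) (η : DiffForm I X ℂ k) : DiffForm I X ℂ k :=
  fun y => typePart (J y) p (η y)

theorem delbar_at (J : EndField I X) (η : DiffForm I X ℂ k) (x : X) : (delbar J η).at x =
    ∑ p ∈ Finset.range (k + 1), typePart (J.at x) p ((DiffForm.d (η.typeForm J p)).at x) := rfl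

theorem del_at (J : EndField I X) (η : DiffForm I X ℂ k) (x : X) : (del J η).at x =
    ∑ p ∈ Finset.range (k + 1),
      typePart (J.at x) (p + 1) ((DiffForm.d (η.typeForm J p)).at x) := rfl

variable [I.Boundaryless] [IsManifold I ∞ X]

/-- For a real form `η` of type `(1, 1)`, the form `∂̄ η` is the component of type `(1, 2)`
of `dη`. -/
theorem delbar_complexify_at {J : EndField I X} (hJ : ∀ x v, J.at x (J.at x v) = -v)
    {η : DiffForm I X ℝ 2} (hη : η.IsSmooth)
    (hinv : ∀ x u v, η.at x ![J.at x u, J.at x v] = η.at x ![u, v]) (x : X) :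
    (delbar J η.complexify).at x = typePart (J.at x) 1
      (Complex.ofRealCLM.compContinuousAlternatingMap ((DiffForm.d η).at x)) := by
  have h1 : ∀ x, typePart (J.at x) 1 (η.complexify.at x) = η.complexify.at x ∧
      typePart (J.at x) 0 (η.complexify.at x) = 0 ∧ typePart (J.at x) 2 (η.complexify.at x) = 0 :=
    fun x => typePart_two_of_invariant _ (hJ x) _ fun u v =>
      congrArg (fun t : ℝ => (t : ℂ)) (hinv x u v)
  rw [delbar_at, Finset.sum_range_succ, Finset.sum_range_succ, Finset.sum_range_one,
    d_eq_zero (η.complexify.typeForm J 0) (fun x => (h1 x).2.1),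
    d_eq_zero (η.complexify.typeForm J 2) (fun x => (h1 x).2.2), typePart_zero, typePart_zero,
    zero_add, add_zero, d_congr (η := η.complexify.typeForm J 1) (fun x => (h1 x).1),
    ← d_postcomp _ hη]
  rfl

/-- For a form `Θ` of type `(1, 2)`, the form `∂ Θ` is the component of type `(2, 2)` of `dΘ`. -/
theorem del_at_of_typePart {J : EndField I X} {Θ : DiffForm I X ℂ 3}
    (h : ∀ x, typePart (J.at x) 1 (Θ.at x) = Θ.at x ∧ typePart (J.at x) 0 (Θ.at x) = 0 ∧
      typePart (J.at x) 2 (Θ.at x) = 0 ∧ typePart (J.at x) 3 (Θ.at x) = 0) (x : X) :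
    (del J Θ).at x = typePart (J.at x) 2 ((DiffForm.d Θ).at x) := by
  rw [del_at, Finset.sum_range_succ, Finset.sum_range_succ, Finset.sum_range_succ,
    Finset.sum_range_one,
    d_eq_zero (Θ.typeForm J 0) (fun x => (h x).2.1),
    d_eq_zero (Θ.typeForm J 2) (fun x => (h x).2.2.1),
    d_eq_zero (Θ.typeForm J 3) (fun x => (h x).2.2.2), typePart_zero, typePart_zero, typePart_zero,
    zero_add, add_zero, add_zero, d_congr (η := Θ.typeForm J 1) (fun x => (h x).1)]

end General

variable {S : Type*} [TopologicalSpace S] [ChartedSpace ℂ S] [IsManifold 𝓘(ℂ) ω S]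
  {M : Type*} [TopologicalSpace M] [ChartedSpace R4 M] [IsManifold (𝓡 4) ∞ M]
  {φ : S → CP1} {h : Hyperkahler M}

theorem mulI_mulI (u : ℂ) : mulI (mulI u) = -u := by
  change Complex.I * (Complex.I * u) = -u
  rw [← mul_assoc, Complex.I_mul_I, neg_one_mul]

theorem complexStructure_sq (φ : S → CP1) (h : Hyperkahler M) (x : S × M) (v : ℂ × R4) :
    (complexStructure φ h).at x ((complexStructure φ h).at x v) = -v :=
  Prod.ext (mulI_mulI v.1)
    ((h.isHyperTriple x.2).combo_combo (sphereCoord_dotProduct_self (φ x.1)) v.2)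

/-- The imaginary part of `∂̄ η`, a real `3`-form. Passing to it keeps the exterior calculus
real-valued. -/
def imDelbar (φ : S → CP1) (h : Hyperkahler M) (η : DiffForm modelX (S × M) ℝ 2) :
    DiffForm modelX (S × M) ℝ 3 :=
  (delbar (complexStructure φ h) η.complexify).postcomp Complex.imCLM

variable {η : DiffForm modelX (S × M) ℝ 2}

theorem IsHermitianMetric.delbar_at (hη : IsHermitianMetric (complexStructure φ h) η)
    (x : S × M) : (delbar (complexStructure φ h) η.complexify).at x =
      typePart ((complexStructure φ h).at x) 1
        (Complex.ofRealCLM.compContinuousAlternatingMap ((DiffForm.d η).at x)) :=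
  delbar_complexify_at (complexStructure_sq φ h) hη.smooth hη.type_one_one x

theorem IsHermitianMetric.isSmooth_delbar (hη : IsHermitianMetric (complexStructure φ h) η)
    (hφ : IsHolomorphic φ) : (delbar (complexStructure φ h) η.complexify).IsSmooth := by
  rintro ⟨s₀, x₀⟩
  have h1 := contDiffOn_typePart (contDiffOn_structureInChart h s₀ x₀ (hφ.contDiffOn_sphereMap s₀))
    (hη.smooth.d.postcomp (L := Complex.ofRealCLM) (s₀, x₀)) 1
  refine h1.congr fun p hp => ?_
  rw [inChart_eq, hη.delbar_at]
  exact typePart_compContinuousLinearMap _ (structureInChart φ h s₀ x₀ p) _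
    (structureInChart_comm φ h s₀ x₀ hp) 1 _

theorem IsHermitianMetric.isSmooth_imDelbar (hη : IsHermitianMetric (complexStructure φ h) η)
    (hφ : IsHolomorphic φ) : (imDelbar φ h η).IsSmooth :=
  (hη.isSmooth_delbar hφ).postcomp

theorem IsHermitianMetric.imDelbar_apply (hη : IsHermitianMetric (complexStructure φ h) η)
    (x : S × M) (a b c : ℂ × R4) : (imDelbar φ h η).at x ![a, b, c] =
      (1 / 8) * ((DiffForm.d η).at x ![(complexStructure φ h).at x a, b, c] +
        (DiffForm.d η).at x ![a, (complexStructure φ h).at x b, c] +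
        (DiffForm.d η).at x ![a, b, (complexStructure φ h).at x c] +
        3 * (DiffForm.d η).at x ![(complexStructure φ h).at x a, (complexStructure φ h).at x b,
          (complexStructure φ h).at x c]) := by
  rw [← im_typePart_three_one, ← hη.delbar_at]
  rfl

/-- If `η` is pluriclosed, then the component of type `(2, 2)` of the exterior derivative of the
real form `Im ∂̄ η` vanishes; contracted with `u` and `Ju`, this form is therefore
`J`-antiinvariant. -/
theorem IsPluriclosed.d_imDelbar_apply (hp : IsPluriclosed (complexStructure φ h) η)
    (hη : IsHermitianMetric (complexStructure φ h) η) (hφ : IsHolomorphic φ)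
    (x : S × M) (u v w : ℂ × R4) :
    (DiffForm.d (imDelbar φ h η)).at x ![u, (complexStructure φ h).at x u, v, w] +
      (DiffForm.d (imDelbar φ h η)).at x ![u, (complexStructure φ h).at x u,
        (complexStructure φ h).at x v, (complexStructure φ h).at x w] = 0 := by
  set Θ := delbar (complexStructure φ h) η.complexify with hΘ
  have h1 : (del (complexStructure φ h) Θ).at x = 0 :=
    (smul_eq_zero.1 (hp x)).resolve_left Complex.I_ne_zero
  rw [del_at_of_typePart fun x => by
    rw [hΘ, hη.delbar_at]; exact typePart_typePart_three _ (complexStructure_sq φ h x) _] at h1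
  have h2 := add_map_of_typePart_four_two _ (complexStructure_sq φ h x) _ h1 u v w
  rw [imDelbar, d_postcomp _ (hη.isSmooth_delbar hφ)]
  exact (Complex.add_im _ _).symm.trans (congrArg Complex.im h2)

/-! ### Passage to the slices -/

/-- The identification of the tangent spaces used in `toMixed`. -/
abbrev mixedInv (s₀ : S) (z : ℂ) : ℂ × R4 →L[ℝ] ℂ × R4 :=
  (chartInv 𝓘(ℝ, ℂ) s₀ z).prodMap (ContinuousLinearMap.id ℝ R4)

theorem mixedInv_mixedStructure (φ : S → CP1) (h : Hyperkahler M) (s₀ : S) {z : ℂ}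
    (hz : z ∈ (extChartAt 𝓘(ℝ, ℂ) s₀).target) (x : M) (v : ℂ × R4) :
    mixedInv s₀ z (mixedStructure φ h s₀ z x v) =
      (complexStructure φ h).at ((extChartAt 𝓘(ℝ, ℂ) s₀).symm z, x) (mixedInv s₀ z v) :=
  mixedStructure_comm φ h s₀ hz x v

theorem toMixed_two (s₀ : S) (η : DiffForm modelX (S × M) ℝ 2) (z : ℂ) (x : M) (a b : ℂ × R4) :
    toMixed s₀ η z x ![a, b] = η.at ((extChartAt 𝓘(ℝ, ℂ) s₀).symm z, x)
      ![mixedInv s₀ z a, mixedInv s₀ z b] :=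
  congrArg (η.at _) (comp_vec_two (mixedInv s₀ z) a b)

theorem toMixed_three (s₀ : S) (η : DiffForm modelX (S × M) ℝ 3) (z : ℂ) (x : M)
    (a b c : ℂ × R4) : toMixed s₀ η z x ![a, b, c] =
      η.at ((extChartAt 𝓘(ℝ, ℂ) s₀).symm z, x)
        ![mixedInv s₀ z a, mixedInv s₀ z b, mixedInv s₀ z c] :=
  congrArg (η.at _) (by funext l; fin_cases l <;> rfl)

theorem toMixed_four (s₀ : S) (η : DiffForm modelX (S × M) ℝ 4) (z : ℂ) (x : M)
    (a b c d : ℂ × R4) : toMixed s₀ η z x ![a, b, c, d] =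
      η.at ((extChartAt 𝓘(ℝ, ℂ) s₀).symm z, x)
        ![mixedInv s₀ z a, mixedInv s₀ z b, mixedInv s₀ z c, mixedInv s₀ z d] :=
  congrArg (η.at _) (by funext l; fin_cases l <;> rfl)

variable (φ h) in
/-- The complex structure of the fibre over `z`, at the point `x` of `M`. -/
abbrev fibreStructure (s₀ : S) (z : ℂ) (x : M) : R4 →L[ℝ] R4 :=
  IsHyperTriple.combo (h.I x) (h.J x) (h.K x) (sphereMap φ s₀ z)

theorem mixedStructure_left (s₀ : S) (z : ℂ) (x : M) (u : ℂ) :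
    mixedStructure φ h s₀ z x (u, 0) = (Complex.I * u, 0) :=
  Prod.ext rfl (map_zero (fibreStructure φ h s₀ z x))

theorem mixedStructure_right (s₀ : S) (z : ℂ) (x : M) (v : R4) :
    mixedStructure φ h s₀ z x (0, v) = (0, fibreStructure φ h s₀ z x v) :=
  Prod.ext (map_zero mulI) rfl

theorem slice_apply_two (w : MixedForm M 2) (z : ℂ) (x : M) (a b : R4) :
    (slice w z).at x ![a, b] = w z x ![(0, a), (0, b)] :=
  congrArg (w z x) (comp_vec_two (ContinuousLinearMap.inr ℝ ℂ R4) a b)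

theorem contract_apply_two (w : MixedForm M 3) (u : ℂ) (z : ℂ) (x : M) (a b : ℂ × R4) :
    contract u w z x ![a, b] = w z x ![(u, 0), a, b] := rfl

theorem contract_apply_three (w : MixedForm M 4) (u : ℂ) (z : ℂ) (x : M) (a b c : ℂ × R4) :
    contract u w z x ![a, b, c] = w z x ![(u, 0), a, b, c] := rfl

variable {s₀ : S} {z : ℂ} (hz : z ∈ (extChartAt 𝓘(ℝ, ℂ) s₀).target) (x : M)

include hz

theorem IsHermitianMetric.slice_invariant (hη : IsHermitianMetric (complexStructure φ h) η)
    (a b : R4) :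
    (slice (toMixed s₀ η) z).at x ![fibreStructure φ h s₀ z x a, fibreStructure φ h s₀ z x b] =
      (slice (toMixed s₀ η) z).at x ![a, b] := by
  rw [slice_apply_two, slice_apply_two, ← mixedStructure_right, ← mixedStructure_right,
    toMixed_two, toMixed_two, mixedInv_mixedStructure φ h s₀ hz,
    mixedInv_mixedStructure φ h s₀ hz]
  exact hη.type_one_one _ _ _

theorem IsHermitianMetric.slice_pos (hη : IsHermitianMetric (complexStructure φ h) η)
    {v : R4} (hv : v ≠ 0) :
    0 < (slice (toMixed s₀ η) z).at x ![v, fibreStructure φ h s₀ z x v] := by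
  rw [slice_apply_two, ← mixedStructure_right, toMixed_two,
    mixedInv_mixedStructure φ h s₀ hz]
  exact hη.pos _ _ fun h0 => hv (congrArg Prod.snd h0)

/-- The contraction of `Im ∂̄ η` with a horizontal vector `u`, restricted to a fibre, in terms of
the contractions of `dη` with `u` and `iu`. -/
theorem IsHermitianMetric.slice_imDelbar (hη : IsHermitianMetric (complexStructure φ h) η)
    (u : ℂ) (a b : R4) :
    (slice (contract u (toMixed s₀ (imDelbar φ h η))) z).at x ![a, b] =
      (1 / 8) * ((slice (contract (Complex.I * u) (toMixed s₀ (DiffForm.d η))) z).at x ![a, b] +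
      ((slice (contract u (toMixed s₀ (DiffForm.d η))) z).at x ![fibreStructure φ h s₀ z x a, b] +
      (slice (contract u (toMixed s₀ (DiffForm.d η))) z).at x ![a, fibreStructure φ h s₀ z x b]) +
      3 * (slice (contract (Complex.I * u) (toMixed s₀ (DiffForm.d η))) z).at x
        ![fibreStructure φ h s₀ z x a, fibreStructure φ h s₀ z x b]) := by
  simp only [slice_apply_two, contract_apply_two]
  simp only [← mixedStructure_left (φ := φ) (h := h) s₀ z x, ← mixedStructure_right, toMixed_three,
    mixedInv_mixedStructure φ h s₀ hz]
  refine (hη.imDelbar_apply _ _ _ _).trans ?_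
  ring

/-- The contraction of `d (Im ∂̄ η)` with the horizontal vectors `1` and `i` is of type
`(2, 0) + (0, 2)` on the fibres if `η` is pluriclosed. -/
theorem IsPluriclosed.slice_d_imDelbar (hp : IsPluriclosed (complexStructure φ h) η)
    (hη : IsHermitianMetric (complexStructure φ h) η) (hφ : IsHolomorphic φ) (a b : R4) :
    (slice (contract Complex.I (contract 1 (toMixed s₀ (DiffForm.d (imDelbar φ h η))))) z).at x
      ![a, b] +
    (slice (contract Complex.I (contract 1 (toMixed s₀ (DiffForm.d (imDelbar φ h η))))) z).at x
      ![fibreStructure φ h s₀ z x a, fibreStructure φ h s₀ z x b] = 0 := by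
  have e : ((Complex.I, 0) : ℂ × R4) = mixedStructure φ h s₀ z x (1, 0) := by
    rw [mixedStructure_left, mul_one]
  simp only [slice_apply_two, contract_apply_two, contract_apply_three, e]
  simp only [← mixedStructure_right, toMixed_four, mixedInv_mixedStructure φ h s₀ hz]
  exact hp.d_imDelbar_apply hη hφ _ _ _ _

end Pluriclosed

end

/-! ### The equation satisfied by the fibre integral -/

section

open Set Filter Topology MeasureTheory

section Integrals

variable {M : Type*} [TopologicalSpace M] [ChartedSpace R4 M] [IsManifold (𝓡 4) ∞ M]
  [MeasurableSpace M] [BorelSpace M] [CompactSpace M] [T2Space M]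

theorem IsSmoothFamily.integrable_sd_vec {U : Set ℂ} {W : ℂ → DiffForm (𝓡 4) M ℝ 2}
    (hW : IsSmoothFamily U W) (h : Hyperkahler M) {z : ℂ} (hz : z ∈ U) :
    Integrable (fun x => h.sd x ((W z).at x)) h.measure :=
  Integrable.of_eval fun i => hW.integrable_sd h hz i

theorem IsSmoothFamily.integralSd_eq {U : Set ℂ} {W : ℂ → DiffForm (𝓡 4) M ℝ 2}
    (hW : IsSmoothFamily U W) (h : Hyperkahler M) {z : ℂ} (hz : z ∈ U) :
    h.integralSd W z = ∫ x, h.sd x ((W z).at x) ∂h.measure := by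
  funext i
  exact (eval_integral (fun i => hW.integrable_sd h hz i) i).symm

/-- A pointwise linear relation can be integrated. -/
theorem IsSmoothFamily.integralSd_linear {U : Set ℂ} {W W₁ W₂ : ℂ → DiffForm (𝓡 4) M ℝ 2}
    (hW : IsSmoothFamily U W) (hW₁ : IsSmoothFamily U W₁) (hW₂ : IsSmoothFamily U W₂)
    (h : Hyperkahler M) {z : ℂ} (hz : z ∈ U) (L L' : (Fin 3 → ℝ) →ₗ[ℝ] (Fin 3 → ℝ))
    (hL : ∀ x, h.sd x ((W z).at x) = L (h.sd x ((W₁ z).at x)) + L' (h.sd x ((W₂ z).at x))) :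
    h.integralSd W z = L (h.integralSd W₁ z) + L' (h.integralSd W₂ z) := by
  have h1 := hW₁.integrable_sd_vec h hz
  have h2 := hW₂.integrable_sd_vec h hz
  have e1 := L.toContinuousLinearMap.integral_comp_comm h1
  have e2 := L'.toContinuousLinearMap.integral_comp_comm h2
  have i1 := L.toContinuousLinearMap.integrable_comp h1
  have i2 := L'.toContinuousLinearMap.integrable_comp h2
  simp only [LinearMap.coe_toContinuousLinearMap'] at e1 e2 i1 i2
  rw [hW.integralSd_eq h hz, hW₁.integralSd_eq h hz, hW₂.integralSd_eq h hz, ← e1, ← e2,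
    ← integral_add i1 i2]
  exact integral_congr_ae (Eventually.of_forall hL)

theorem IsSmoothFamily.dotProduct_integralSd {U : Set ℂ} {W : ℂ → DiffForm (𝓡 4) M ℝ 2}
    (hW : IsSmoothFamily U W) (h : Hyperkahler M) {z : ℂ} (hz : z ∈ U) (a : Fin 3 → ℝ) :
    a ⬝ᵥ h.integralSd W z = ∫ x, a ⬝ᵥ h.sd x ((W z).at x) ∂h.measure := by
  simp only [dotProduct]
  rw [integral_finsetSum _ fun i _ => (hW.integrable_sd h hz i).const_mul _]
  simp only [integral_const_mul]
  rfl

/-- The orthogonal projection to the line spanned by a unit vector. -/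
def projLin (a : Fin 3 → ℝ) : (Fin 3 → ℝ) →ₗ[ℝ] (Fin 3 → ℝ) where
  toFun v := (a ⬝ᵥ v) • a
  map_add' v w := by rw [dotProduct_add, add_smul]
  map_smul' t v := by rw [dotProduct_smul, smul_assoc]; rfl

theorem projLin_apply (a v : Fin 3 → ℝ) : projLin a v = (a ⬝ᵥ v) • a := rfl

variable {S : Type*} [TopologicalSpace S] [ChartedSpace ℂ S] [IsManifold 𝓘(ℂ) ω S]
  {φ : S → CP1} {h : Hyperkahler M} {η : DiffForm modelX (S × M) ℝ 2}

variable (h η) in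
/-- The fibre integrals of the wedge products of `η` with the fundamental forms, in a chart. -/
def fibreIntegral (s₀ : S) : ℂ → Fin 3 → ℝ := h.integralSd (slice (toMixed s₀ η))

variable (φ h η) in
/-- The fibre integrals of the contractions of the imaginary part of `∂̄ η`. -/
def fibreIntegralDelbar (s₀ : S) (u : ℂ) : ℂ → Fin 3 → ℝ :=
  h.integralSd (slice (contract u (toMixed s₀ (imDelbar φ h η))))

variable {s₀ : S} {z : ℂ} (hz : z ∈ (extChartAt 𝓘(ℝ, ℂ) s₀).target)

include hz

/-- The restriction of `η` to a fibre is of type `(1, 1)`, so `fibreIntegral` is a multiple of the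
map to the sphere. -/
theorem IsHermitianMetric.fibreIntegral_eq_smul
    (hη : IsHermitianMetric (complexStructure φ h) η) :
    fibreIntegral h η s₀ z =
      (sphereMap φ s₀ z ⬝ᵥ fibreIntegral h η s₀ z) • sphereMap φ s₀ z := by
  have hs := (hη.smooth.toMixed s₀).slice
  have h1 := hs.integralSd_linear hs hs h hz (projLin (sphereMap φ s₀ z)) 0 fun x => by
    rw [LinearMap.zero_apply, add_zero]
    exact (h.isHyperTriple x).sdPart_of_invariant (sphereMap_dotProduct_self φ s₀ z) _
      (hη.slice_invariant hz x)
  rw [LinearMap.zero_apply, add_zero] at h1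
  exact h1

theorem IsHermitianMetric.fibreIntegral_pos [Nonempty M]
    (hη : IsHermitianMetric (complexStructure φ h) η) :
    0 < sphereMap φ s₀ z ⬝ᵥ fibreIntegral h η s₀ z := by
  have hs := (hη.smooth.toMixed s₀).slice
  rw [fibreIntegral, hs.dotProduct_integralSd h hz]
  refine h.integral_pos ?_ fun x =>
    (h.isHyperTriple x).dotProduct_sdPart_pos _ _ fun v hv => hη.slice_pos hz x hv
  exact continuous_finsetSum _ fun i _ =>
    continuous_const.mul (h.continuous_sd (hs.isSmooth hz) i)

theorem IsHermitianMetric.differentiableAt_fibreIntegral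
    (hη : IsHermitianMetric (complexStructure φ h) η) :
    DifferentiableAt ℝ (fibreIntegral h η s₀) z :=
  (h.hasFDerivAt_integralSd (isOpen_extChartAt_target s₀) (hη.smooth.toMixed s₀).slice hz).1

theorem IsHermitianMetric.differentiableAt_fibreIntegralDelbar
    (hη : IsHermitianMetric (complexStructure φ h) η) (hφ : IsHolomorphic φ) (u : ℂ) :
    DifferentiableAt ℝ (fibreIntegralDelbar φ h η s₀ u) z :=
  (h.hasFDerivAt_integralSd (isOpen_extChartAt_target s₀)
    (((hη.isSmooth_imDelbar hφ).toMixed s₀).contract u).slice hz).1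

/-- By Cartan's formula and Stokes' theorem, the fibre integrals of contractions of `dη` are the
derivatives of the fibre integrals of `η`. The right-hand side is the effect on self-dual parts of
the projection to the type `(1, 2)`, see `IsHyperTriple.sdPart_typePart`. -/
theorem IsHermitianMetric.fibreIntegralDelbar_eq
    (hη : IsHermitianMetric (complexStructure φ h) η) (hφ : IsHolomorphic φ) (u : ℂ) :
    fibreIntegralDelbar φ h η s₀ u z = (1 / 8 : ℝ) •
      (fderiv ℝ (fibreIntegral h η s₀) z (Complex.I * u) + (-2 : ℝ) •
        crossProduct (sphereMap φ s₀ z) (fderiv ℝ (fibreIntegral h η s₀) z u) +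
      (3 : ℝ) • ((2 * (sphereMap φ s₀ z ⬝ᵥ fderiv ℝ (fibreIntegral h η s₀) z (Complex.I * u))) •
        sphereMap φ s₀ z - fderiv ℝ (fibreIntegral h η s₀) z (Complex.I * u))) := by
  set a := sphereMap φ s₀ z with ha
  have hU := isOpen_extChartAt_target (I := 𝓘(ℝ, ℂ)) s₀
  have hw := hη.smooth.toMixed s₀
  have hw' := hη.smooth.d.toMixed s₀
  have hd := isMixedD_toMixed hη.smooth s₀
  have h1 := (((hη.isSmooth_imDelbar hφ).toMixed s₀).contract u).slice.integralSd_linear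
    (hw'.contract (Complex.I * u)).slice (hw'.contract u).slice h hz
    ((1 / 8 : ℝ) • (LinearMap.id + (3 : ℝ) • ((2 : ℝ) • projLin a - LinearMap.id)))
    ((1 / 8 : ℝ) • (-2 : ℝ) • crossProduct a) fun x => by
      refine ((h.isHyperTriple x).sdPart_typePart (sphereMap_dotProduct_self φ s₀ z) _ _ _
        (hη.slice_imDelbar hz x u)).trans ?_
      simp only [LinearMap.smul_apply, LinearMap.add_apply, LinearMap.sub_apply, LinearMap.id_apply,
        projLin_apply, mul_smul]
      rw [← ha]
      simp only [Hyperkahler.sd]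
      module
  rw [h.integralSd_contract_d hU hw hd hz, h.integralSd_contract_d hU hw hd hz] at h1
  refine h1.trans ?_
  simp only [LinearMap.smul_apply, LinearMap.add_apply, LinearMap.sub_apply, LinearMap.id_apply,
    projLin_apply, mul_smul]
  simp only [fibreIntegral]
  module

/-- The fibre integral of the contraction of `d (Im ∂̄ η)` with `1` and `i` is the difference on the
left-hand side; by the pluriclosed condition it is orthogonal to the map to the sphere. -/
theorem IsPluriclosed.dotProduct_fderiv (hp : IsPluriclosed (complexStructure φ h) η)
    (hη : IsHermitianMetric (complexStructure φ h) η) (hφ : IsHolomorphic φ) :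
    sphereMap φ s₀ z ⬝ᵥ (fderiv ℝ (fibreIntegralDelbar φ h η s₀ Complex.I) z 1 -
      fderiv ℝ (fibreIntegralDelbar φ h η s₀ 1) z Complex.I) = 0 := by
  have hU := isOpen_extChartAt_target (I := 𝓘(ℝ, ℂ)) s₀
  have ht := hη.isSmooth_imDelbar hφ
  have h1 := h.integralSd_contract_contract_d hU (ht.toMixed s₀) (isMixedD_toMixed ht s₀) hz 1
    Complex.I
  have h2 := (((ht.d.toMixed s₀).contract 1).contract Complex.I).slice
  refine (congrArg (sphereMap φ s₀ z ⬝ᵥ ·) h1.symm).trans ?_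
  refine (h2.dotProduct_integralSd h hz _).trans ?_
  rw [← integral_zero M ℝ (μ := h.measure)]
  refine integral_congr_ae (Eventually.of_forall fun x => ?_)
  exact (h.isHyperTriple x).dotProduct_sdPart_of_antiinvariant (sphereMap_dotProduct_self φ s₀ z) _
    (hp.slice_d_imDelbar hz x hη hφ)

end Integrals

end

/-! ### A strong minimum principle -/

section

open Set Filter Topology

/-- The second derivative test in one variable, in the direction that needs only one derivative of
the derivative `p` at the point. -/
theorem deriv_nonneg_of_isLocalMin {g p : ℝ → ℝ} {t c : ℝ}
    (hg : ∀ᶠ s in 𝓝 t, HasDerivAt g (p s) s) (hp : HasDerivAt p c t) (hmin : IsLocalMin g t) :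
    0 ≤ c := by
  by_contra! hc
  have h1 : deriv g =ᶠ[𝓝 t] p := hg.mono fun s hs => hs.deriv
  have h2 : deriv (deriv g) t = c := by rw [h1.deriv_eq, hp.deriv]
  have hmax : IsLocalMax g t := isLocalMax_of_deriv_deriv_neg (by rwa [h2]) hmin.deriv_eq_zero
    hg.self_of_nhds.continuousAt
  have h3 : g =ᶠ[𝓝 t] fun _ => g t := by
    filter_upwards [hmin, hmax] with s hs hs' using le_antisymm hs' hs
  have h4 : deriv g =ᶠ[𝓝 t] fun _ => (0 : ℝ) := by simpa using h3.deriv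
  rw [h4.deriv_eq, deriv_const] at h2
  exact hc.ne h2.symm

theorem fderiv_nonneg_of_isLocalMin {E : Type*} [NormedAddCommGroup E] [NormedSpace ℝ E]
    {G p : E → ℝ} {z u : E}
    (hG : ∀ᶠ y in 𝓝 z, DifferentiableAt ℝ G y ∧ fderiv ℝ G y u = p y)
    (hp : DifferentiableAt ℝ p z) (hmin : IsLocalMin G z) : 0 ≤ fderiv ℝ p z u := by
  have hl : ∀ t : ℝ, HasDerivAt (fun t : ℝ => z + t • u) u t := fun t => by
    simpa using ((hasDerivAt_id t).smul_const u).const_add z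
  have hz : z + (0 : ℝ) • u = z := by simp
  have hc : Tendsto (fun t : ℝ => z + t • u) (𝓝 0) (𝓝 z) := by
    simpa using (hl 0).continuousAt.tendsto
  refine deriv_nonneg_of_isLocalMin (g := fun t : ℝ => G (z + t • u))
    (p := fun t : ℝ => p (z + t • u)) (t := 0) ?_ ?_ ?_
  · filter_upwards [hc.eventually hG] with t ht
    rw [← ht.2]
    exact ht.1.hasFDerivAt.comp_hasDerivAt t (hl t)
  · have h1 : HasFDerivAt p (fderiv ℝ p z) (z + (0 : ℝ) • u) := by rw [hz]; exact hp.hasFDerivAt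
    exact h1.comp_hasDerivAt 0 (hl 0)
  · filter_upwards [hc.eventually hmin] with t ht
    simpa using ht

/-- `F` is differentiable at `z` with first derivatives `P`, `Q` in the directions `1`, `i`, and `P`
and `Q` are differentiable at `z`. Where this holds locally, the Laplacian of `F` is
`fderiv ℝ P z 1 + fderiv ℝ Q z Complex.I`. -/
structure HasPartials (F P Q : ℂ → ℝ) (z : ℂ) : Prop where
  differentiableAt : DifferentiableAt ℝ F z
  fderiv_one : fderiv ℝ F z 1 = P z
  fderiv_I : fderiv ℝ F z Complex.I = Q z
  differentiableAt_one : DifferentiableAt ℝ P z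
  differentiableAt_I : DifferentiableAt ℝ Q z

theorem HasPartials.laplacian_nonneg {F P Q : ℂ → ℝ} {z : ℂ}
    (h : ∀ᶠ y in 𝓝 z, HasPartials F P Q y) (hmin : IsLocalMin F z) :
    0 ≤ fderiv ℝ P z 1 + fderiv ℝ Q z Complex.I :=
  add_nonneg
    (fderiv_nonneg_of_isLocalMin (h.mono fun _ hy => ⟨hy.1, hy.2⟩) h.self_of_nhds.4 hmin)
    (fderiv_nonneg_of_isLocalMin (h.mono fun _ hy => ⟨hy.1, hy.3⟩) h.self_of_nhds.5 hmin)

theorem HasPartials.sub_mul_normSq {F P Q : ℂ → ℝ} {z : ℂ} (h : HasPartials F P Q z) (δ : ℝ)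
    (z₀ : ℂ) : HasPartials (fun y => F y - δ * Complex.normSq (y - z₀))
      (fun y => P y - 2 * δ * (y - z₀).re) (fun y => Q y - 2 * δ * (y - z₀).im) z := by
  have hre : ∀ y, HasFDerivAt (fun y : ℂ => (y - z₀).re) Complex.reCLM y := fun y =>
    Complex.reCLM.hasFDerivAt.comp y ((hasFDerivAt_id y).sub_const z₀)
  have him : ∀ y, HasFDerivAt (fun y : ℂ => (y - z₀).im) Complex.imCLM y := fun y =>
    Complex.imCLM.hasFDerivAt.comp y ((hasFDerivAt_id y).sub_const z₀)
  have hn : HasFDerivAt (fun y : ℂ => F y - δ * Complex.normSq (y - z₀)) _ z :=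
    h.1.hasFDerivAt.sub (((((hre z).mul (hre z)).add ((him z).mul (him z)))).const_mul δ)
  refine ⟨hn.differentiableAt, ?_, ?_, h.4.sub ((hre z).differentiableAt.const_mul _),
    h.5.sub ((him z).differentiableAt.const_mul _)⟩
  · rw [hn.fderiv, ← h.2]
    simp
    ring
  · rw [hn.fderiv, ← h.3]
    simp
    ring

theorem fderiv_sub_mul_re {P : ℂ → ℝ} {z : ℂ} (h : DifferentiableAt ℝ P z) (c : ℝ) (z₀ : ℂ) :
    fderiv ℝ (fun y => P y - c * (y - z₀).re) z 1 = fderiv ℝ P z 1 - c := by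
  have hre : HasFDerivAt (fun y : ℂ => (y - z₀).re) Complex.reCLM z :=
    Complex.reCLM.hasFDerivAt.comp z ((hasFDerivAt_id z).sub_const z₀)
  rw [(h.hasFDerivAt.fun_sub (hre.const_mul c)).fderiv]
  simp

theorem fderiv_sub_mul_im {Q : ℂ → ℝ} {z : ℂ} (h : DifferentiableAt ℝ Q z) (c : ℝ) (z₀ : ℂ) :
    fderiv ℝ (fun y => Q y - c * (y - z₀).im) z Complex.I = fderiv ℝ Q z Complex.I - c := by
  have him : HasFDerivAt (fun y : ℂ => (y - z₀).im) Complex.imCLM z :=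
    Complex.imCLM.hasFDerivAt.comp z ((hasFDerivAt_id z).sub_const z₀)
  rw [(h.hasFDerivAt.fun_sub (him.const_mul c)).fderiv]
  simp

/-- A superharmonic function which is strictly superharmonic on a punctured neighbourhood of a point
does not have a local minimum there. -/
theorem HasPartials.not_isLocalMin {F P Q : ℂ → ℝ} {z₀ : ℂ}
    (h : ∀ᶠ z in 𝓝 z₀, HasPartials F P Q z ∧ fderiv ℝ P z 1 + fderiv ℝ Q z Complex.I ≤ 0)
    (hs : ∀ᶠ z in 𝓝[≠] z₀, fderiv ℝ P z 1 + fderiv ℝ Q z Complex.I < 0) :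
    ¬ IsLocalMin F z₀ := by
  intro hmin
  rw [eventually_nhdsWithin_iff] at hs
  obtain ⟨R, hR, hRs⟩ := Metric.eventually_nhds_iff_ball.1 ((h.and hs).and hmin)
  have hpart : ∀ z ∈ Metric.ball z₀ R, ∀ᶠ y in 𝓝 z, HasPartials F P Q y := fun z hz => by
    filter_upwards [Metric.isOpen_ball.mem_nhds hz] with y hy using (hRs y hy).1.1.1
  -- the minimum is strict, since a second minimum would be a point of strict superharmonicity
  have hlt : ∀ z ∈ Metric.ball z₀ R, z ≠ z₀ → F z₀ < F z := by
    intro z hz hne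
    refine lt_of_le_of_ne (hRs z hz).2 fun he => ?_
    have hm : IsLocalMin F z := by
      filter_upwards [Metric.isOpen_ball.mem_nhds hz] with y hy
      rw [← he]
      exact (hRs y hy).2
    exact absurd (HasPartials.laplacian_nonneg (hpart z hz) hm) ((hRs z hz).1.2 hne).not_ge
  set r := R / 2 with hr
  have hr0 : 0 < r := by positivity
  have hsub : Metric.closedBall z₀ r ⊆ Metric.ball z₀ R :=
    Metric.closedBall_subset_ball (by linarith)
  have hcont : ContinuousOn F (Metric.closedBall z₀ r) := fun z hz =>
    (hRs z (hsub hz)).1.1.1.1.continuousAt.continuousWithinAt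
  obtain ⟨w, hw, hwmin⟩ := (isCompact_sphere z₀ r).exists_isMinOn
    (NormedSpace.sphere_nonempty.2 hr0.le) (hcont.mono Metric.sphere_subset_closedBall)
  have hw0 : F z₀ < F w := hlt w (hsub (Metric.sphere_subset_closedBall hw))
    (Metric.ne_of_mem_sphere hw hr0.ne')
  -- subtracting a small multiple of `|z - z₀|²` keeps an interior minimum
  set δ := (F w - F z₀) / (2 * r ^ 2) with hδ
  have hδ0 : 0 < δ := div_pos (sub_pos.2 hw0) (by positivity)
  have hδr : δ * r ^ 2 = (F w - F z₀) / 2 := by rw [hδ]; field_simp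
  set G : ℂ → ℝ := fun y => F y - δ * Complex.normSq (y - z₀) with hG
  have hGpart : ∀ z ∈ Metric.ball z₀ R, HasPartials G _ _ z := fun z hz =>
    (hRs z hz).1.1.1.sub_mul_normSq δ z₀
  obtain ⟨z₁, hz₁, hz₁min⟩ := (isCompact_closedBall z₀ r).exists_isMinOn
    (Metric.nonempty_closedBall.2 hr0.le) fun z hz =>
      (hGpart z (hsub hz)).1.continuousAt.continuousWithinAt
  have hz₁b : z₁ ∈ Metric.ball z₀ r := by
    rw [← Metric.closedBall_sdiff_sphere]
    refine ⟨hz₁, fun hsp => ?_⟩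
    have h1 : G z₁ ≤ G z₀ := hz₁min (Metric.mem_closedBall_self hr0.le)
    have h2 : F w ≤ F z₁ := hwmin hsp
    have h3 : Complex.normSq (z₁ - z₀) = r ^ 2 := by
      rw [Complex.normSq_eq_norm_sq, ← dist_eq_norm, Metric.mem_sphere.1 hsp]
    simp only [hG, h3, hδr, sub_self, map_zero, mul_zero, sub_zero] at h1
    linarith
  have hm : IsLocalMin G z₁ := hz₁min.isLocalMin (mem_of_superset
    (Metric.isOpen_ball.mem_nhds hz₁b) Metric.ball_subset_closedBall)
  have h1 := HasPartials.laplacian_nonneg (by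
    filter_upwards [Metric.isOpen_ball.mem_nhds (hsub hz₁)] with y hy using hGpart y hy) hm
  have h2 := (hRs z₁ (hsub hz₁)).1.1
  rw [fderiv_sub_mul_re h2.1.4, fderiv_sub_mul_im h2.1.5] at h1
  linarith [h2.2]

/-! ### Superharmonicity of the fibre integral -/

theorem differentiableAt_dotProduct {f g : ℂ → Fin 3 → ℝ} {z : ℂ} (hf : DifferentiableAt ℝ f z)
    (hg : DifferentiableAt ℝ g z) : DifferentiableAt ℝ (fun y => f y ⬝ᵥ g y) z :=
  DifferentiableAt.fun_sum fun i _ =>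
    (differentiableAt_pi.1 hf i).mul (differentiableAt_pi.1 hg i)

theorem fderiv_dotProduct {f g : ℂ → Fin 3 → ℝ} {z : ℂ} (hf : DifferentiableAt ℝ f z)
    (hg : DifferentiableAt ℝ g z) (u : ℂ) : fderiv ℝ (fun y => f y ⬝ᵥ g y) z u =
      fderiv ℝ f z u ⬝ᵥ g z + f z ⬝ᵥ fderiv ℝ g z u := by
  have h1 : HasFDerivAt (fun y => f y ⬝ᵥ g y) _ z := HasFDerivAt.fun_sum (u := Finset.univ)
    fun i _ => ((hasFDerivAt_pi'.1 hf.hasFDerivAt i).mul (hasFDerivAt_pi'.1 hg.hasFDerivAt i))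
  rw [h1.fderiv]
  simp [dotProduct, Finset.sum_add_distrib, mul_comm, add_comm]

section Superharmonic

variable {M : Type*} [TopologicalSpace M] [ChartedSpace R4 M] [IsManifold (𝓡 4) ∞ M]
  [MeasurableSpace M] [BorelSpace M] [CompactSpace M] [T2Space M]
  {S : Type*} [TopologicalSpace S] [ChartedSpace ℂ S] [IsManifold 𝓘(ℂ) ω S]
  {φ : S → CP1} {h : Hyperkahler M} {η : DiffForm modelX (S × M) ℝ 2} {s₀ : S} {z : ℂ}

variable (φ h η s₀) in
/-- The integral over the fibre of the wedge product of `η` with the fundamental form of the fibre,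
up to a constant; it is the length of the vector `fibreIntegral`. -/
def fibreMass (z : ℂ) : ℝ := sphereMap φ s₀ z ⬝ᵥ fibreIntegral h η s₀ z

theorem IsHermitianMetric.differentiableAt_fibreMass (hz : z ∈ (extChartAt 𝓘(ℝ, ℂ) s₀).target)
    (hη : IsHermitianMetric (complexStructure φ h) η) (hφ : IsHolomorphic φ) :
    DifferentiableAt ℝ (fibreMass φ h η s₀) z :=
  differentiableAt_dotProduct (hφ.differentiableAt_sphereMap s₀ hz)
    (hη.differentiableAt_fibreIntegral hz)

theorem IsHermitianMetric.fderiv_fibreIntegral (hz : z ∈ (extChartAt 𝓘(ℝ, ℂ) s₀).target)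
    (hη : IsHermitianMetric (complexStructure φ h) η) (hφ : IsHolomorphic φ) (u : ℂ) :
    fderiv ℝ (fibreIntegral h η s₀) z u =
      fderiv ℝ (fibreMass φ h η s₀) z u • sphereMap φ s₀ z +
        fibreMass φ h η s₀ z • fderiv ℝ (sphereMap φ s₀) z u := by
  have he : fibreIntegral h η s₀ =ᶠ[𝓝 z] fun y => fibreMass φ h η s₀ y • sphereMap φ s₀ y := by
    filter_upwards [extChartAt_target_mem_nhds' hz] with y hy using hη.fibreIntegral_eq_smul hy
  rw [he.fderiv_eq, fderiv_fun_smul (hη.differentiableAt_fibreMass hz hφ)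
    (hφ.differentiableAt_sphereMap s₀ hz)]
  simp [add_comm]

/-- The fibre integrals of the contractions of the imaginary part of `∂̄ η`, in terms of the first
derivatives of the fibre mass. -/
theorem IsHermitianMetric.two_smul_fibreIntegralDelbar
    (hz : z ∈ (extChartAt 𝓘(ℝ, ℂ) s₀).target)
    (hη : IsHermitianMetric (complexStructure φ h) η) (hφ : IsHolomorphic φ) (u : ℂ) :
    (2 : ℝ) • fibreIntegralDelbar φ h η s₀ u z =
      fderiv ℝ (fibreMass φ h η s₀) z (Complex.I * u) • sphereMap φ s₀ z -
        fibreMass φ h η s₀ z • fderiv ℝ (sphereMap φ s₀) z (Complex.I * u) := by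
  rw [hη.fibreIntegralDelbar_eq hz hφ u, hη.fderiv_fibreIntegral hz hφ,
    hη.fderiv_fibreIntegral hz hφ, dotProduct_add, dotProduct_smul, dotProduct_smul,
    sphereMap_dotProduct_self, hφ.sphereMap_dotProduct_fderiv s₀ hz, map_add, map_smul, map_smul,
    cross_self, ← hφ.fderiv_sphereMap_I s₀ hz]
  simp only [smul_eq_mul]
  module

variable (φ h η s₀) in
/-- The derivative of the fibre mass in the direction `1`, for a Hermitian metric `η`. In this form
it is seen to be differentiable. -/
def fibreMassRe (z : ℂ) : ℝ :=
  (-2 : ℝ) * (sphereMap φ s₀ z ⬝ᵥ fibreIntegralDelbar φ h η s₀ Complex.I z)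

variable (φ h η s₀) in
/-- The derivative of the fibre mass in the direction `i`, for a Hermitian metric `η`. -/
def fibreMassIm (z : ℂ) : ℝ :=
  (2 : ℝ) * (sphereMap φ s₀ z ⬝ᵥ fibreIntegralDelbar φ h η s₀ 1 z)

theorem IsHermitianMetric.hasPartials_fibreMass (hz : z ∈ (extChartAt 𝓘(ℝ, ℂ) s₀).target)
    (hη : IsHermitianMetric (complexStructure φ h) η) (hφ : IsHolomorphic φ) :
    HasPartials (fibreMass φ h η s₀) (fibreMassRe φ h η s₀) (fibreMassIm φ h η s₀) z := by
  have ha := hφ.differentiableAt_sphereMap s₀ hz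
  have hdot : ∀ u, sphereMap φ s₀ z ⬝ᵥ ((2 : ℝ) • fibreIntegralDelbar φ h η s₀ u z) =
      fderiv ℝ (fibreMass φ h η s₀) z (Complex.I * u) := fun u => by
    rw [hη.two_smul_fibreIntegralDelbar hz hφ, dotProduct_sub, dotProduct_smul, dotProduct_smul,
      sphereMap_dotProduct_self, hφ.sphereMap_dotProduct_fderiv s₀ hz]
    simp
  refine ⟨hη.differentiableAt_fibreMass hz hφ, ?_, ?_,
    (differentiableAt_dotProduct ha (hη.differentiableAt_fibreIntegralDelbar hz hφ _)).const_mul _,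
    (differentiableAt_dotProduct ha (hη.differentiableAt_fibreIntegralDelbar hz hφ _)).const_mul _⟩
  · have h1 := hdot Complex.I
    rw [Complex.I_mul_I, map_neg, dotProduct_smul, smul_eq_mul] at h1
    rw [fibreMassRe]
    linarith
  · have h1 := hdot 1
    rw [mul_one, dotProduct_smul, smul_eq_mul] at h1
    rw [fibreMassIm, h1]

/-- The fibre mass `F` satisfies `ΔF = -F |da|²`, where `a` is the map to the sphere. The second
derivatives of `a` do not enter, since the first derivatives of `F` are expressed by
`fibreIntegralDelbar`. -/
theorem IsPluriclosed.laplacian_fibreMass (hz : z ∈ (extChartAt 𝓘(ℝ, ℂ) s₀).target)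
    (hp : IsPluriclosed (complexStructure φ h) η)
    (hη : IsHermitianMetric (complexStructure φ h) η) (hφ : IsHolomorphic φ) :
    fderiv ℝ (fibreMassRe φ h η s₀) z 1 + fderiv ℝ (fibreMassIm φ h η s₀) z Complex.I =
      -(fibreMass φ h η s₀ z *
        (fderiv ℝ (sphereMap φ s₀) z 1 ⬝ᵥ fderiv ℝ (sphereMap φ s₀) z 1 +
          fderiv ℝ (sphereMap φ s₀) z Complex.I ⬝ᵥ fderiv ℝ (sphereMap φ s₀) z Complex.I)) := by
  have ha := hφ.differentiableAt_sphereMap s₀ hz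
  have h1 := hη.differentiableAt_fibreIntegralDelbar hz hφ 1
  have hI := hη.differentiableAt_fibreIntegralDelbar hz hφ Complex.I
  have e1 : fderiv ℝ (fibreMassRe φ h η s₀) z 1 = (-2 : ℝ) *
      (fderiv ℝ (sphereMap φ s₀) z 1 ⬝ᵥ fibreIntegralDelbar φ h η s₀ Complex.I z +
        sphereMap φ s₀ z ⬝ᵥ fderiv ℝ (fibreIntegralDelbar φ h η s₀ Complex.I) z 1) := by
    rw [← fderiv_dotProduct ha hI, ← smul_eq_mul, ← smul_apply,
      ← fderiv_const_mul (differentiableAt_dotProduct ha hI)]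
    rfl
  have e2 : fderiv ℝ (fibreMassIm φ h η s₀) z Complex.I = (2 : ℝ) *
      (fderiv ℝ (sphereMap φ s₀) z Complex.I ⬝ᵥ fibreIntegralDelbar φ h η s₀ 1 z +
        sphereMap φ s₀ z ⬝ᵥ fderiv ℝ (fibreIntegralDelbar φ h η s₀ 1) z Complex.I) := by
    rw [← fderiv_dotProduct ha h1, ← smul_eq_mul, ← smul_apply,
      ← fderiv_const_mul (differentiableAt_dotProduct ha h1)]
    rfl
  have hdot : ∀ v u, fderiv ℝ (sphereMap φ s₀) z v ⬝ᵥ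
      ((2 : ℝ) • fibreIntegralDelbar φ h η s₀ u z) = -(fibreMass φ h η s₀ z *
        (fderiv ℝ (sphereMap φ s₀) z v ⬝ᵥ fderiv ℝ (sphereMap φ s₀) z (Complex.I * u))) :=
    fun v u => by
      rw [hη.two_smul_fibreIntegralDelbar hz hφ, dotProduct_sub, dotProduct_smul, dotProduct_smul,
        dotProduct_comm _ (sphereMap φ s₀ z), hφ.sphereMap_dotProduct_fderiv s₀ hz]
      simp
  have d1 := hdot 1 Complex.I
  have d2 := hdot Complex.I 1
  have d3 := hp.dotProduct_fderiv hz hη hφ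
  rw [Complex.I_mul_I, map_neg, dotProduct_neg, dotProduct_smul, smul_eq_mul] at d1
  rw [mul_one, dotProduct_smul, smul_eq_mul] at d2
  rw [dotProduct_sub] at d3
  rw [e1, e2]
  linear_combination -d1 + d2 - 2 * d3

end Superharmonic

end

/-! ### The minimum of the fibre integral -/

section

open Set Filter Topology MeasureTheory

section Minimum

variable {M : Type*} [TopologicalSpace M] [ChartedSpace R4 M] [IsManifold (𝓡 4) ∞ M]
  [MeasurableSpace M] [BorelSpace M] [CompactSpace M] [T2Space M]
  {S : Type*} [TopologicalSpace S] [ChartedSpace ℂ S] [IsManifold 𝓘(ℂ) ω S]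
  {φ : S → CP1} {h : Hyperkahler M} {η : DiffForm modelX (S × M) ℝ 2}

variable (φ h η) in
/-- The fibre mass as a function on the Riemann surface. No chart enters, as only the restriction
of `η` to the fibres is integrated. -/
def totalMass (s : S) : ℝ := sphereCoord (φ s) ⬝ᵥ fun i =>
  ∫ x, h.sd x ((η.at (s, x)).compContinuousLinearMap (ContinuousLinearMap.inr ℝ ℂ R4)) i ∂h.measure

theorem slice_toMixed_at (s₀ : S) (η : DiffForm modelX (S × M) ℝ 2) (z : ℂ) (x : M) :
    (slice (toMixed s₀ η) z).at x =
      (η.at ((extChartAt 𝓘(ℝ, ℂ) s₀).symm z, x)).compContinuousLinearMap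
        (ContinuousLinearMap.inr ℝ ℂ R4) := by
  ext v
  exact congrArg (η.at _) (funext fun l => Prod.ext (map_zero (chartInv 𝓘(ℝ, ℂ) s₀ z)) rfl)

theorem fibreMass_eq_totalMass (s₀ : S) (z : ℂ) :
    fibreMass φ h η s₀ z = totalMass φ h η ((extChartAt 𝓘(ℝ, ℂ) s₀).symm z) := by
  refine congrArg (sphereMap φ s₀ z ⬝ᵥ ·) (funext fun i => ?_)
  exact integral_congr_ae (Eventually.of_forall fun x => by simp only [slice_toMixed_at])

theorem IsHermitianMetric.continuous_totalMass (hη : IsHermitianMetric (complexStructure φ h) η)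
    (hφ : IsHolomorphic φ) : Continuous (totalMass φ h η) := by
  refine continuous_iff_continuousAt.2 fun s₀ => ?_
  have h1 : ContinuousAt (fun s => fibreMass φ h η s₀ (extChartAt 𝓘(ℝ, ℂ) s₀ s)) s₀ :=
    ContinuousAt.comp (f := extChartAt 𝓘(ℝ, ℂ) s₀)
      (hη.differentiableAt_fibreMass (mem_extChartAt_target s₀) hφ).continuousAt
      (continuousAt_extChartAt s₀)
  refine h1.congr ?_
  filter_upwards [extChartAt_source_mem_nhds (I := 𝓘(ℝ, ℂ)) s₀] with s hs
  rw [fibreMass_eq_totalMass, (extChartAt 𝓘(ℝ, ℂ) s₀).left_inv hs]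

/-- The map to `ℂP¹` is constant near a minimum of the fibre mass: otherwise its critical points
are isolated, and the fibre mass is strictly superharmonic near the minimum, except possibly at
the minimum itself. -/
theorem IsPluriclosed.eventually_eq_of_isMin [Nonempty M]
    (hp : IsPluriclosed (complexStructure φ h) η)
    (hη : IsHermitianMetric (complexStructure φ h) η) (hφ : IsHolomorphic φ) {s₀ : S}
    (hmin : ∀ s, totalMass φ h η s₀ ≤ totalMass φ h η s) : ∀ᶠ s in 𝓝 s₀, φ s = φ s₀ := by
  refine (hφ.eventually_const_or s₀).resolve_right fun hne => ?_
  set z₀ := extChartAt 𝓘(ℝ, ℂ) s₀ s₀ with hz₀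
  have hU : (extChartAt 𝓘(ℝ, ℂ) s₀).target ∈ 𝓝 z₀ := extChartAt_target_mem_nhds s₀
  have hnn : ∀ v : Fin 3 → ℝ, 0 ≤ v ⬝ᵥ v := fun v =>
    Finset.sum_nonneg fun i _ => mul_self_nonneg (v i)
  refine HasPartials.not_isLocalMin (F := fibreMass φ h η s₀) (P := fibreMassRe φ h η s₀)
    (Q := fibreMassIm φ h η s₀) (z₀ := z₀) ?_ ?_ ?_
  · filter_upwards [hU] with z hz
    refine ⟨hη.hasPartials_fibreMass hz hφ, ?_⟩
    rw [hp.laplacian_fibreMass hz hη hφ, neg_nonpos]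
    exact mul_nonneg (hη.fibreIntegral_pos hz).le (add_nonneg (hnn _) (hnn _))
  · filter_upwards [hne, mem_nhdsWithin_of_mem_nhds hU] with z hz1 hz
    rw [hp.laplacian_fibreMass hz hη hφ, neg_lt_zero]
    refine mul_pos (hη.fibreIntegral_pos hz) (add_pos_of_pos_of_nonneg ?_ (hnn _))
    exact (hnn _).lt_of_ne' fun h0 => hz1 (dotProduct_self_eq_zero.1 h0)
  · refine Eventually.of_forall fun z => ?_
    rw [fibreMass_eq_totalMass, fibreMass_eq_totalMass, hz₀, extChartAt_to_inv]
    exact hmin _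

end Minimum

/-! ### Unique continuation -/

/-- The identity theorem: the set of points near which `φ` takes the value `φ s₀` is open and
closed. -/
theorem IsHolomorphic.eq_of_eventually_eq {S : Type*} [TopologicalSpace S] [ChartedSpace ℂ S]
    [IsManifold 𝓘(ℂ) ω S] [PreconnectedSpace S] {φ : S → CP1} (hφ : IsHolomorphic φ) {s₀ : S}
    (h₀ : ∀ᶠ s in 𝓝 s₀, φ s = φ s₀) (s : S) : φ s = φ s₀ := by
  set A : Set S := {s | ∀ᶠ s' in 𝓝 s, φ s' = φ s₀} with hA
  have hAo : IsOpen A := isOpen_setOfPred_eventually_nhds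
  have hAc : IsClosed A := by
    refine isClosed_of_closure_subset fun s₁ hs₁ => ?_
    rcases hφ.eventually_const_or s₁ with h1 | h1
    · obtain ⟨s, hs, hsA⟩ := mem_closure_iff_nhds.1 hs₁ _ h1
      have : φ s₁ = φ s₀ := by rw [← hs.out, hsA.self_of_nhds]
      exact h1.mono fun s' hs' => hs'.trans this
    · -- at a point of `A` near `s₁` other than `s₁`, the derivative of `φ` vanishes
      by_contra hsA
      set e := extChartAt 𝓘(ℝ, ℂ) s₁ with he
      rw [eventually_nhdsWithin_iff] at h1
      have h2 := (continuousAt_extChartAt (I := 𝓘(ℝ, ℂ)) s₁).eventually h1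
      obtain ⟨s, ⟨hs, hss⟩, hsA'⟩ := mem_closure_iff_nhds.1 hs₁ _
        (inter_mem h2 (extChartAt_source_mem_nhds (I := 𝓘(ℝ, ℂ)) s₁))
      have hne : s ≠ s₁ := fun h => hsA (h ▸ hsA')
      refine hs (fun h => hne (e.injOn hss (mem_extChartAt_source s₁) h)) ?_
      have hc : sphereMap φ s₁ =ᶠ[𝓝 (e s)] fun _ => sphereCoord (φ s₀) := by
        have h3 : Tendsto e.symm (𝓝 (e s)) (𝓝 s) := by
          have := continuousAt_extChartAt_symm' (I := 𝓘(ℝ, ℂ)) hss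
          rwa [ContinuousAt, e.left_inv hss] at this
        filter_upwards [h3.eventually hsA'] with z hz
        rw [sphereMap, hz]
      rw [hc.fderiv_eq]
      simp
  have huniv : A = univ := IsClopen.eq_univ ⟨hAc, hAo⟩ ⟨s₀, h₀⟩
  have hs : s ∈ A := huniv ▸ mem_univ s
  exact hs.self_of_nhds

end

end CalabiGray

end

theorem mainTheorem2
    {S : Type*} [TopologicalSpace S] [T2Space S] [CompactSpace S] [ConnectedSpace S]
    [ChartedSpace ℂ S] [IsManifold 𝓘(ℂ) ω S]
    {M : Type*} [TopologicalSpace M] [T2Space M] [CompactSpace M] [ConnectedSpace M]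
    [ChartedSpace CalabiGray.R4 M] [IsManifold (𝓡 4) ∞ M]
    (φ : S → CalabiGray.CP1) (hφ : CalabiGray.IsVanishingSpinorialPair φ)
    (h : CalabiGray.Hyperkahler M) :
    ¬ ∃ ω₁ : CalabiGray.DiffForm CalabiGray.modelX (S × M) ℝ 2,
        CalabiGray.IsHermitianMetric (CalabiGray.complexStructure φ h) ω₁ ∧
          CalabiGray.IsPluriclosed (CalabiGray.complexStructure φ h) ω₁ := by
  rintro ⟨η, hη, hp⟩
  borelize M
  obtain ⟨s₀, -, hmin⟩ := isCompact_univ.exists_isMinOn Set.univ_nonempty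
    (hη.continuous_totalMass hφ.holomorphic).continuousOn
  exact hφ.nonconstant ⟨φ s₀, hφ.holomorphic.eq_of_eventually_eq
    (hp.eventually_eq_of_isMin hη hφ.holomorphic fun s => hmin (Set.mem_univ s))⟩
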